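/- Let $N\in\mathbb N$, $X=\mathbb R^N$, $\Xi=X\times X^\star$ with $X^\star\cong\mathbb R^N$, $\langle (q,p)\rangle=(1+|q|^2+|p|^2)^{1/2}$, and $\sigma((q',p'),(q'',p''))=q''\cdot p'-q'\cdot p''$. Let $d\xi$ be $(2\pi)^{-N}$ times Lebesgue measure on $\Xi$. Let $B$ be a magnetic field on $X$, i.e. a closed $2$-form whose components $B_{jk}=-B_{kj}$ are real smooth functions all of whose derivatives are polynomially bounded, and let $\Gamma^B(\langle a,b,c\rangle)$ be the flux of $B$ through the oriented triangle with vertices $a,b,c$. For $f,g\in\mathcal S(\Xi)$ put, with $\xi=(q,p)$, $\eta=(x,k)$, $\zeta=(y,l)$, $$(f\circ^B g)(\xi)=4^N\int_\Xi d\eta\int_\Xi d\zeta\; e^{-2i\sigma(\xi-\eta,\xi-\zeta)}\,e^{-i\Gamma^B(\langle q-y+x,\;x-q+y,\;y-x+q\rangle)}f(\eta)g(\zeta),$$ which is again in $\mathcal S(\Xi)$. For $F\in\mathcal S'(\Xi)$ and $f\in\mathcal S(\Xi)$ define $F\circ^B f,\ f\circ^B F\in\mathcal S'(\Xi)$ by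 $(F\circ^B f,h)=(F,f\circ^B h)$ and $(f\circ^B F,h)=(F,h\circ^B f)$ for all $h\in\mathcal S(\Xi)$, where functions are identified with distributions through $(f,h)=\int_\Xi f h\,d\xi$. The magnetic Moyal algebra is $$\mathcal M(\Xi)=\{F\in\mathcal S'(\Xi)\;:\;F\circ^B f\in\mathcal S(\Xi)\text{ and } f\circ^B F\in\mathcal S(\Xi)\text{ for all } f\in\mathcal S(\Xi)\}.$$ (1) Let $C^\infty_{\mathrm{pol,u}}(\Xi)$ be the set of smooth $f:\Xi\to\mathbb C$ for which there is $m\in\mathbb N$ such that for every multi-index $a$ there is $C_a$ with $|\partial^a f(\xi)|\le C_a\langle\xi\rangle^m$ for all $\xi\in\Xi$. Then every such $f$ is a tempered distribution and $C^\infty_{\mathrm{pol,u}}(\Xi)\subset\mathcal M(\Xi)$. (2) For $m\in\mathbb R$ let $R^m_0$ be the space of smooth $f:\Xi\to\mathbb C$ with $\langle\cdot\rangle^{-m}\partial^a f\in L^1(\Xi)$ for every multi-index $a$, with the locally convex topology defined by the norms $\sum_{|a|\le n}\|\langle\cdot\rangle^{-m}\partial^a f\|_{L^1}$, $n\in\mathbb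 N$. Then for every $m\in\mathbb R$ one has $\mathcal S(\Xi)\subset R^m_0\subset\mathcal S'(\Xi)$, and $\circ^B:\mathcal S(\Xi)\times\mathcal S(\Xi)\to\mathcal S(\Xi)$ extends to a jointly continuous bilinear map $R^m_0\times\mathcal S(\Xi)\to\mathcal S(\Xi)$, which sends $(f,g)$ to the product $f\circ^B g$ of the tempered distribution $f$ with the test function $g$ defined above. -/

import Mathlib

open MeasureTheory SchwartzMap
open scoped ContDiff

noncomputable section

namespace MagneticMoyal

/-- The configuration space `X = ℝ^N`; its dual `X*` is identified with `ℝ^N` through the canonical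
pairing `q · p = ∑ j, q j * p j`. -/
abbrev X (N : ℕ) : Type := EuclideanSpace ℝ (Fin N)

/-- The phase space `Ξ = X × X*`, with points `ξ = (q, p)`. -/
abbrev Phase (N : ℕ) : Type := X N × X N

/-- The canonical pairing `q · p`. -/
def pair {N : ℕ} (q p : X N) : ℝ := ∑ j, q j * p j

/-- The symplectic form `σ((q', p'), (q'', p'')) = q'' · p' - q' · p''`. -/
def sympl {N : ℕ} (ξ η : Phase N) : ℝ := pair η.1 ξ.2 - pair ξ.1 η.2

/-- The measure `dξ = dx ⊗ dp`, normalised so that `∫ dp e^{i x·p}` inverts `∫ dx e^{-i x·p}`: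
it is `(2π)^{-N}` times Lebesgue measure on `ℝ^N × ℝ^N`. -/
def phaseMeasure (N : ℕ) : Measure (Phase N) :=
  ENNReal.ofReal (((2 * Real.pi) ^ N)⁻¹) • (volume : Measure (Phase N))

/-- `⟨ξ⟩ = (1 + |q|² + |p|²)^{1/2}`, with Euclidean norms. -/
def bracket {N : ℕ} (ξ : Phase N) : ℝ := Real.sqrt (1 + ‖ξ.1‖ ^ 2 + ‖ξ.2‖ ^ 2)

/-- A magnetic field on `ℝ^N` with components of class `C^∞_pol` (smooth, every derivative
polynomially bounded): a closed `2`-form, given by its antisymmetric matrix of components. -/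
structure MagneticField (N : ℕ) where
  /-- The components `B_{jk}(x)`. -/
  comp : X N → Matrix (Fin N) (Fin N) ℝ
  temperate : ∀ j k, Function.HasTemperateGrowth (fun x => comp x j k)
  antisymm : ∀ x j k, comp x j k = -comp x k j
  /-- `∂_j B_{kl} + ∂_k B_{lj} + ∂_l B_{jk} = 0`. -/
  closed : ∀ x j k l,
    fderiv ℝ (fun y => comp y k l) x (EuclideanSpace.single j 1)
      + fderiv ℝ (fun y => comp y l j) x (EuclideanSpace.single k 1)
      + fderiv ℝ (fun y => comp y j k) x (EuclideanSpace.single l 1) = 0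

/-- The flux `Γ^B(<a, b, c>)` of `B` through the oriented triangle with vertices `a, b, c`, computed
in the parametrisation `(s, t) ↦ a + s (b - a) + t (c - a)`, `0 ≤ s ≤ 1`, `0 ≤ t ≤ 1 - s`. -/
def flux {N : ℕ} (B : MagneticField N) (a b c : X N) : ℝ :=
  ∫ s in (0 : ℝ)..1, ∫ t in (0 : ℝ)..(1 - s),
    ∑ j, ∑ k, B.comp (a + s • (b - a) + t • (c - a)) j k * (b - a) j * (c - a) k

/-- The magnetic Moyal product
`(f ∘^B g)(ξ) = 4^N ∫ dη ∫ dζ e^{-2iσ(ξ-η, ξ-ζ)} e^{-iΓ^B(<q-y+x, x-q+y, y-x+q>)} f(η) g(ζ)`,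
where `ξ = (q, p)`, `η = (x, k)`, `ζ = (y, l)`. -/
def moyal {N : ℕ} (B : MagneticField N) (f g : Phase N → ℂ) (ξ : Phase N) : ℂ :=
  4 ^ N * ∫ η, ∫ ζ,
    Complex.exp (-2 * Complex.I * (sympl (ξ - η) (ξ - ζ) : ℂ))
      * Complex.exp (-Complex.I *
          (flux B (ξ.1 - ζ.1 + η.1) (η.1 - ξ.1 + ζ.1) (ζ.1 - η.1 + ξ.1) : ℂ))
      * f η * g ζ ∂(phaseMeasure N) ∂(phaseMeasure N)

/-- The tempered distribution `F` is the function `f`, i.e. `(F, h) = ∫ dξ f(ξ) h(ξ)` for all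
`h ∈ 𝓢(Ξ)`, the integrals being absolutely convergent. -/
def Represents {N : ℕ} (F : 𝓢'(Phase N, ℂ)) (f : Phase N → ℂ) : Prop :=
  ∀ h : 𝓢(Phase N, ℂ), Integrable (fun ξ => f ξ * h ξ) (phaseMeasure N) ∧
    F h = ∫ ξ, f ξ * h ξ ∂(phaseMeasure N)

/-- `G = F ∘^B f` for `F, G ∈ 𝓢'(Ξ)` and `f ∈ 𝓢(Ξ)`: `f ∘^B h` is a Schwartz function and
`(G, h) = (F, f ∘^B h)`, for all `h ∈ 𝓢(Ξ)`. -/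
def IsLeftProduct {N : ℕ} (B : MagneticField N) (F : 𝓢'(Phase N, ℂ)) (f : 𝓢(Phase N, ℂ))
    (G : 𝓢'(Phase N, ℂ)) : Prop :=
  ∀ h : 𝓢(Phase N, ℂ), ∃ w : 𝓢(Phase N, ℂ), (∀ ξ, w ξ = moyal B f h ξ) ∧ G h = F w

/-- `G = f ∘^B F` for `F, G ∈ 𝓢'(Ξ)` and `f ∈ 𝓢(Ξ)`: `h ∘^B f` is a Schwartz function and
`(G, h) = (F, h ∘^B f)`, for all `h ∈ 𝓢(Ξ)`. -/
def IsRightProduct {N : ℕ} (B : MagneticField N) (F : 𝓢'(Phase N, ℂ)) (f : 𝓢(Phase N, ℂ))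
    (G : 𝓢'(Phase N, ℂ)) : Prop :=
  ∀ h : 𝓢(Phase N, ℂ), ∃ w : 𝓢(Phase N, ℂ), (∀ ξ, w ξ = moyal B h f ξ) ∧ G h = F w

/-- The left magnetic Moyal algebra `𝓜_L(Ξ) = {F | F ∘^B f ∈ 𝓢(Ξ) for all f ∈ 𝓢(Ξ)}`. -/
def leftMoyalAlgebra {N : ℕ} (B : MagneticField N) : Set 𝓢'(Phase N, ℂ) :=
  {F | ∀ f : 𝓢(Phase N, ℂ), ∃ G : 𝓢'(Phase N, ℂ), IsLeftProduct B F f G ∧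
    ∃ u : 𝓢(Phase N, ℂ), Represents G u}

/-- The right magnetic Moyal algebra `𝓜_R(Ξ) = {F | f ∘^B F ∈ 𝓢(Ξ) for all f ∈ 𝓢(Ξ)}`. -/
def rightMoyalAlgebra {N : ℕ} (B : MagneticField N) : Set 𝓢'(Phase N, ℂ) :=
  {F | ∀ f : 𝓢(Phase N, ℂ), ∃ G : 𝓢'(Phase N, ℂ), IsRightProduct B F f G ∧
    ∃ u : 𝓢(Phase N, ℂ), Represents G u}

/-- The magnetic Moyal algebra `𝓜(Ξ) = 𝓜_L(Ξ) ∩ 𝓜_R(Ξ)`. -/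
def moyalAlgebra {N : ℕ} (B : MagneticField N) : Set 𝓢'(Phase N, ℂ) :=
  leftMoyalAlgebra B ∩ rightMoyalAlgebra B

/-- The space `C^∞_{pol,u}(Ξ)`: smooth functions all of whose derivatives are bounded by multiples
of one and the same power `⟨ξ⟩^m`. -/
def CPolU (N : ℕ) : Set (Phase N → ℂ) :=
  {f | ContDiff ℝ ∞ f ∧ ∃ m : ℕ, ∀ n : ℕ, ∃ C : ℝ, ∀ ξ : Phase N,
    ‖iteratedFDeriv ℝ n f ξ‖ ≤ C * bracket ξ ^ m}

lemma continuous_bracket_rpow {N : ℕ} (m : ℝ) :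
    Continuous (fun ξ : Phase N => bracket ξ ^ m) := by
  have h : ∀ ξ : Phase N, (1 + ‖ξ.1‖ ^ 2 + ‖ξ.2‖ ^ 2) ≠ 0 := fun ξ => by positivity
  refine Continuous.rpow_const ?_ ?_
  · unfold bracket; fun_prop
  · intro ξ
    left
    unfold bracket
    exact (Real.sqrt_pos.2 (by positivity)).ne'

lemma bracket_nonneg {N : ℕ} (ξ : Phase N) : 0 ≤ bracket ξ := Real.sqrt_nonneg _

lemma continuous_weight {N : ℕ} (m : ℝ) (n : ℕ) {f : Phase N → ℂ} (hf : ContDiff ℝ ∞ f) :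
    Continuous (fun ξ => bracket ξ ^ (-m) * ‖iteratedFDeriv ℝ n f ξ‖) :=
  (continuous_bracket_rpow _).mul
    (hf.continuous_iteratedFDeriv (by exact_mod_cast le_top)).norm

lemma weight_add_le {N : ℕ} (m : ℝ) (n : ℕ) {f g : Phase N → ℂ} (hf : ContDiff ℝ ∞ f)
    (hg : ContDiff ℝ ∞ g) (ξ : Phase N) :
    bracket ξ ^ (-m) * ‖iteratedFDeriv ℝ n (f + g) ξ‖ ≤
      bracket ξ ^ (-m) * ‖iteratedFDeriv ℝ n f ξ‖
        + bracket ξ ^ (-m) * ‖iteratedFDeriv ℝ n g ξ‖ := by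
  rw [iteratedFDeriv_add_apply (hf.contDiffAt.of_le (by exact_mod_cast le_top))
    (hg.contDiffAt.of_le (by exact_mod_cast le_top)), ← mul_add]
  exact mul_le_mul_of_nonneg_left (norm_add_le _ _) (Real.rpow_nonneg (bracket_nonneg ξ) _)

lemma weight_smul {N : ℕ} (m : ℝ) (n : ℕ) (c : ℂ) {f : Phase N → ℂ} (hf : ContDiff ℝ ∞ f)
    (ξ : Phase N) :
    bracket ξ ^ (-m) * ‖iteratedFDeriv ℝ n (c • f) ξ‖ =
      ‖c‖ * (bracket ξ ^ (-m) * ‖iteratedFDeriv ℝ n f ξ‖) := by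
  rw [iteratedFDeriv_const_smul_apply (hf.contDiffAt.of_le (by exact_mod_cast le_top)), norm_smul]
  ring

/-- `R^m_0` as a linear space of functions: the smooth `f` such that `⟨·⟩^{-m} ∂^a f ∈ L^1` for
every `a`. -/
def R0Submodule (N : ℕ) (m : ℝ) : Submodule ℂ (Phase N → ℂ) where
  carrier := {f | ContDiff ℝ ∞ f ∧ ∀ n : ℕ,
    Integrable (fun ξ => bracket ξ ^ (-m) * ‖iteratedFDeriv ℝ n f ξ‖) (phaseMeasure N)}
  zero_mem' := by
    refine ⟨contDiff_const, fun n => ?_⟩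
    have h : (fun ξ : Phase N => bracket ξ ^ (-m) *
        ‖iteratedFDeriv ℝ n (0 : Phase N → ℂ) ξ‖) = fun _ => 0 := by
      funext ξ
      rw [iteratedFDeriv_zero]
      simp
    rw [h]
    exact integrable_zero _ _ _
  add_mem' := by
    rintro f g ⟨hf, hf'⟩ ⟨hg, hg'⟩
    refine ⟨hf.add hg, fun n => ((hf' n).add (hg' n)).mono'
      (continuous_weight m n (hf.add hg)).aestronglyMeasurable
      (Filter.Eventually.of_forall fun ξ => ?_)⟩
    rw [Real.norm_of_nonneg (mul_nonneg (Real.rpow_nonneg (bracket_nonneg ξ) _) (norm_nonneg _))]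
    exact weight_add_le m n hf hg ξ
  smul_mem' := by
    rintro c f ⟨hf, hf'⟩
    refine ⟨hf.const_smul c, fun n => ?_⟩
    have h : (fun ξ : Phase N => bracket ξ ^ (-m) * ‖iteratedFDeriv ℝ n (c • f) ξ‖) =
        fun ξ => ‖c‖ * (bracket ξ ^ (-m) * ‖iteratedFDeriv ℝ n f ξ‖) :=
      funext (weight_smul m n c hf)
    rw [h]
    exact (hf' n).const_mul _

/-- `R^m_0` as a type of its own, so that it carries only the topology defined below and not the
topology of pointwise convergence. -/
def R0 (N : ℕ) (m : ℝ) : Type := ↥(R0Submodule N m)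

instance (N : ℕ) (m : ℝ) : AddCommGroup (R0 N m) :=
  inferInstanceAs (AddCommGroup ↥(R0Submodule N m))

instance (N : ℕ) (m : ℝ) : Module ℂ (R0 N m) :=
  inferInstanceAs (Module ℂ ↥(R0Submodule N m))

/-- The function underlying an element of `R^m_0`. -/
def R0.toFun {N : ℕ} {m : ℝ} (f : R0 N m) : Phase N → ℂ := Subtype.val f

lemma R0.contDiff {N : ℕ} {m : ℝ} (f : R0 N m) : ContDiff ℝ ∞ f.toFun := (Subtype.property f).1

lemma R0.integrable {N : ℕ} {m : ℝ} (f : R0 N m) (n : ℕ) :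
    Integrable (fun ξ => bracket ξ ^ (-m) * ‖iteratedFDeriv ℝ n f.toFun ξ‖) (phaseMeasure N) :=
  (Subtype.property f).2 n

/-- The norms of `R^m_0`: the `n`-th one is the sum over the orders `j ≤ n` of the `L^1`-norms of
the `j`-th derivative weighted by `⟨·⟩^{-m}`. -/
def R0.norms (N : ℕ) (m : ℝ) : SeminormFamily ℂ (R0 N m) ℕ := fun n =>
  Seminorm.of
    (fun f => ∑ j ∈ Finset.range (n + 1),
      ∫ ξ, bracket ξ ^ (-m) * ‖iteratedFDeriv ℝ j f.toFun ξ‖ ∂(phaseMeasure N))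
    (by
      intro f g
      rw [← Finset.sum_add_distrib]
      refine Finset.sum_le_sum fun j _ => ?_
      rw [← integral_add (f.integrable j) (g.integrable j)]
      exact integral_mono ((f + g).integrable j) ((f.integrable j).add (g.integrable j))
        (weight_add_le m j f.contDiff g.contDiff))
    (by
      intro c f
      rw [Finset.mul_sum]
      refine Finset.sum_congr rfl fun j _ => ?_
      rw [← integral_const_mul]
      exact integral_congr_ae (Filter.Eventually.of_forall (weight_smul m j c f.contDiff)))

/-- The locally convex topology of `R^m_0` defined by its norms. -/
instance (N : ℕ) (m : ℝ) : TopologicalSpace (R0 N m) :=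
  (R0.norms N m).moduleFilterBasis.topology

lemma R0.withSeminorms (N : ℕ) (m : ℝ) : WithSeminorms (R0.norms N m) := ⟨rfl⟩

end MagneticMoyal

end

/-! Up to the factor `4 ^ N`, the product is the operator `osc b` with kernel exp(-2iσ(ξ-η, ξ-ζ))
b(q, x, y). The magnetic field enters only through the amplitude b, a function of the three
positions with temperate growth (`hasTemperateGrowth_magneticAmplitude`).

The core is `bddBilin_osc`: for every real m, sup |osc b f g| is at most a norm of f in R^m_0 times
a continuous seminorm of g. For bounded b and m = 0 this is the trivial L^1 × L^1 bound. The phase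
is quadratic, so integration by parts in the momentum variables converts factors q - y and q - x of
the amplitude into momentum derivatives of f and g, while a factor y goes into g. Polynomial growth
of b therefore costs derivatives of f but no weight (`bddBilin_zero_osc`). A weight on f is moved
away in steps of two powers: its position part enters the amplitude, and its momentum part is
carried through p to the momentum of g by integration by parts in the positions
(`bddBilin_osc_add_two`).

Derivatives of `osc b f g`, and its products with coordinates, are combinations of terms of the same
kind. The family `OscSpan` is closed under both operations, so the uniform bound upgrades to all
Schwartz seminorms (`seminorm_moyalSchwartz_le`).

For f in R^m_0, smooth truncations are Cauchy at a geometric rate in R^{m+1}_0. The estimate with m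
+ 1 gives convergence of the products in 𝓢, and the estimate with m gives joint continuity of the
limit `moyalR0`. The kernel is invariant under cyclic permutations, whence ∫ (f ∘ g) h = ∫ f (g ∘
h), and the limit is the weakly defined product (`integral_moyalR0_mul`). Products from the other
side follow by complex conjugation, which reverses the factors. Finally C^∞_{pol,u} lies in the
union of the R^m_0. -/

noncomputable section

namespace MagneticMoyal

open scoped LineDeriv

set_option linter.unusedSectionVars false

/-! ### Functions of temperate growth. -/

section TemperateGrowth

variable {D E F G : Type*} [NormedAddCommGroup D] [NormedSpace ℝ D] [NormedAddCommGroup E]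
  [NormedSpace ℝ E] [NormedAddCommGroup F] [NormedSpace ℝ F] [NormedAddCommGroup G]
  [NormedSpace ℝ G]

lemma HasTemperateGrowth.compCLM {g : E → F} (hg : g.HasTemperateGrowth) (L : D →L[ℝ] E) :
    Function.HasTemperateGrowth (fun x => g (L x)) :=
  hg.comp L.hasTemperateGrowth

lemma temperate_fderiv {f : E → F} (hf : f.HasTemperateGrowth) :
    Function.HasTemperateGrowth (fderiv ℝ f) := by
  refine ⟨hf.1.fderiv_right (by simp), fun n => ?_⟩
  obtain ⟨k, C, h⟩ := hf.2 (n + 1)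
  exact ⟨k, C, fun x => by rw [norm_iteratedFDeriv_fderiv]; exact h x⟩

lemma temperate_fderiv_apply {f : E → F} (hf : f.HasTemperateGrowth) (w : E) :
    Function.HasTemperateGrowth (fun x => fderiv ℝ f x w) :=
  (ContinuousLinearMap.apply ℝ F w).hasTemperateGrowth.comp (temperate_fderiv hf)

lemma HasTemperateGrowth.differentiable {f : E → F} (hf : f.HasTemperateGrowth) :
    Differentiable ℝ f := hf.1.differentiable (by simp)

lemma HasTemperateGrowth.bound {f : E → F} (hf : f.HasTemperateGrowth) :
    ∃ (k : ℕ) (C : ℝ), 0 ≤ C ∧ ∀ x, ‖f x‖ ≤ C * (1 + ‖x‖) ^ k := by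
  obtain ⟨k, C, hC, h⟩ := hf.norm_iteratedFDeriv_le_uniform 0
  exact ⟨k, C, hC, fun x => by simpa using h 0 le_rfl x⟩

/-- Each derivative is the function itself times a power of -i, hence of modulus 1. -/
lemma hasTemperateGrowth_cexp_mul_I :
    Function.HasTemperateGrowth (fun t : ℝ => Complex.exp (-Complex.I * t)) := by
  have key : ∀ n, iteratedDeriv n (fun t : ℝ => Complex.exp (-Complex.I * t)) =
      fun t : ℝ => (-Complex.I) ^ n * Complex.exp (-Complex.I * t) := by
    intro n
    induction n with
    | zero => simp
    | succ n ih =>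
      rw [iteratedDeriv_succ, ih]
      ext t
      have : HasDerivAt (fun t : ℝ => Complex.exp (-Complex.I * t))
          (Complex.exp (-Complex.I * t) * (-Complex.I * 1)) t :=
        ((Complex.ofRealCLM.hasDerivAt (x := t)).const_mul _).cexp
      rw [(this.const_mul _).deriv]
      ring
  refine ⟨(contDiff_const.mul Complex.ofRealCLM.contDiff).cexp, fun n => ⟨0, 1, fun t => ?_⟩⟩
  rw [norm_iteratedFDeriv_eq_norm_iteratedDeriv, key]
  have : ‖Complex.exp (-Complex.I * t)‖ = 1 := by
    rw [show -Complex.I * (t : ℂ) = ((-t : ℝ) : ℂ) * Complex.I by push_cast; ring,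
      Complex.norm_exp_ofReal_mul_I]
  rw [norm_mul, this]
  simp

lemma HasTemperateGrowth.cexp_neg_I_mul {f : E → ℝ} (hf : f.HasTemperateGrowth) :
    Function.HasTemperateGrowth (fun x => Complex.exp (-Complex.I * (f x : ℂ))) :=
  hasTemperateGrowth_cexp_mul_I.comp hf

end TemperateGrowth

/-! ### Bilinear integral operators with temperate kernels. -/

section Kernel

variable {V : Type*} [NormedAddCommGroup V] [NormedSpace ℝ V] [MeasurableSpace V] [BorelSpace V]
  [FiniteDimensional ℝ V] (μ : Measure V) [μ.IsAddHaarMeasure]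

/-- The bilinear integral transform with kernel `Ψ`. -/
def kernelOp (Ψ : V × V × V → ℂ) (f g : 𝓢(V, ℂ)) (ξ : V) : ℂ :=
  ∫ z : V × V, Ψ (ξ, z) * f z.1 * g z.2 ∂(μ.prod μ)

lemma integrable_weighted (f : 𝓢(V, ℂ)) (k : ℕ) :
    Integrable (fun x => (1 + ‖x‖) ^ k * ‖f x‖) μ := by
  have h := ((f.integrable (μ := μ)).norm.add (f.integrable_pow_mul μ k)).const_mul ((2 : ℝ) ^ k)
  refine h.mono' (by fun_prop) (Filter.Eventually.of_forall fun x => ?_)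
  rw [Real.norm_of_nonneg (by positivity)]
  have : (1 + ‖x‖) ^ k ≤ 2 ^ k * (1 + ‖x‖ ^ k) := by
    have h2 := add_pow_le (zero_le_one) (norm_nonneg x) k
    calc (1 + ‖x‖) ^ k ≤ 2 ^ (k - 1) * (1 ^ k + ‖x‖ ^ k) := h2
      _ ≤ 2 ^ k * (1 + ‖x‖ ^ k) := by
        rw [one_pow]; gcongr
        · norm_num
        · omega
  calc (1 + ‖x‖) ^ k * ‖f x‖ ≤ (2 ^ k * (1 + ‖x‖ ^ k)) * ‖f x‖ := by gcongr
    _ = _ := by simp only [Pi.add_apply]; ring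

/-- Splits the polynomial growth of a kernel into one factor per variable, so that the integrated
variables are absorbed by the two Schwartz functions. -/
lemma one_add_norm_prod_le (ξ : V) (z : V × V) :
    1 + ‖(ξ, z)‖ ≤ (1 + ‖ξ‖) * ((1 + ‖z.1‖) * (1 + ‖z.2‖)) := by
  have h1 : ‖(ξ, z)‖ ≤ ‖ξ‖ + (‖z.1‖ + ‖z.2‖) := by
    rw [Prod.norm_def, Prod.norm_def]
    simp only
    exact max_le (by linarith [norm_nonneg z.1, norm_nonneg z.2])
      (max_le (by linarith [norm_nonneg ξ, norm_nonneg z.2])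
        (by linarith [norm_nonneg ξ, norm_nonneg z.1]))
  have := norm_nonneg ξ
  have := norm_nonneg z.1
  have := norm_nonneg z.2
  nlinarith [mul_nonneg (norm_nonneg z.1) (norm_nonneg z.2), mul_nonneg (norm_nonneg ξ)
    (norm_nonneg z.1), mul_nonneg (norm_nonneg ξ) (norm_nonneg z.2), mul_nonneg (norm_nonneg ξ)
    (mul_nonneg (norm_nonneg z.1) (norm_nonneg z.2))]

lemma integrable_kernelOp_bound (f g : 𝓢(V, ℂ)) (c : ℝ) (k : ℕ) :
    Integrable (fun z : V × V => c * ((1 + ‖z.1‖) ^ k * ‖f z.1‖ * ((1 + ‖z.2‖) ^ k * ‖g z.2‖)))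
      (μ.prod μ) :=
  ((integrable_weighted μ f k).mul_prod (integrable_weighted μ g k)).const_mul c

lemma norm_kernel_le {F : Type*} [NormedAddCommGroup F] {Ψ : V × V × V → F} {k : ℕ} {C : ℝ}
    (hC : 0 ≤ C) (h : ∀ x, ‖Ψ x‖ ≤ C * (1 + ‖x‖) ^ k) (f g : 𝓢(V, ℂ)) (ξ : V) (z : V × V) :
    ‖Ψ (ξ, z)‖ * ‖f z.1‖ * ‖g z.2‖ ≤
      C * (1 + ‖ξ‖) ^ k * ((1 + ‖z.1‖) ^ k * ‖f z.1‖ * ((1 + ‖z.2‖) ^ k * ‖g z.2‖)) := by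
  calc ‖Ψ (ξ, z)‖ * ‖f z.1‖ * ‖g z.2‖
      ≤ (C * ((1 + ‖ξ‖) * ((1 + ‖z.1‖) * (1 + ‖z.2‖))) ^ k) * ‖f z.1‖ * ‖g z.2‖ := by
        gcongr
        refine (h _).trans ?_
        gcongr
        exact one_add_norm_prod_le ξ z
    _ = _ := by rw [mul_pow, mul_pow]; ring

variable {μ} in
lemma integrable_kernelOp {Ψ : V × V × V → ℂ} (hΨ : Ψ.HasTemperateGrowth) (f g : 𝓢(V, ℂ)) (ξ : V) :
    Integrable (fun z : V × V => Ψ (ξ, z) * f z.1 * g z.2) (μ.prod μ) := by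
  obtain ⟨k, C, hC, h⟩ := HasTemperateGrowth.bound hΨ
  have hc := hΨ.1.continuous
  refine (integrable_kernelOp_bound μ f g (C * (1 + ‖ξ‖) ^ k) k).mono' ?_
    (Filter.Eventually.of_forall fun z => ?_)
  · have : Continuous (fun z : V × V => Ψ (ξ, z) * f z.1 * g z.2) := by fun_prop
    exact this.aestronglyMeasurable
  · rw [norm_mul, norm_mul]
    exact norm_kernel_le hC h f g ξ z

lemma kernelOp_add_left {Ψ : V × V × V → ℂ} (hΨ : Ψ.HasTemperateGrowth) (f f' g : 𝓢(V, ℂ)) (ξ : V) :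
    kernelOp μ Ψ (f + f') g ξ = kernelOp μ Ψ f g ξ + kernelOp μ Ψ f' g ξ := by
  unfold kernelOp
  rw [← integral_add (integrable_kernelOp hΨ f g ξ) (integrable_kernelOp hΨ f' g ξ)]
  congr 1; ext z; simp only [add_apply]; ring

lemma kernelOp_add_right {Ψ : V × V × V → ℂ} (hΨ : Ψ.HasTemperateGrowth) (f g g' : 𝓢(V, ℂ)) (ξ : V) :
    kernelOp μ Ψ f (g + g') ξ = kernelOp μ Ψ f g ξ + kernelOp μ Ψ f g' ξ := by
  unfold kernelOp
  rw [← integral_add (integrable_kernelOp hΨ f g ξ) (integrable_kernelOp hΨ f g' ξ)]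
  congr 1; ext z; simp only [add_apply]; ring

lemma kernelOp_add_kernel {Ψ Φ : V × V × V → ℂ} (hΨ : Ψ.HasTemperateGrowth)
    (hΦ : Φ.HasTemperateGrowth) (f g : 𝓢(V, ℂ)) (ξ : V) :
    kernelOp μ (fun z => Ψ z + Φ z) f g ξ = kernelOp μ Ψ f g ξ + kernelOp μ Φ f g ξ := by
  unfold kernelOp
  rw [← integral_add (integrable_kernelOp hΨ f g ξ) (integrable_kernelOp hΦ f g ξ)]
  congr 1; ext z; ring

lemma kernelOp_smul_left (Ψ : V × V × V → ℂ) (c : ℂ) (f g : 𝓢(V, ℂ)) (ξ : V) :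
    kernelOp μ Ψ (c • f) g ξ = c * kernelOp μ Ψ f g ξ := by
  unfold kernelOp
  rw [← integral_const_mul]
  congr 1; ext z; simp only [smul_apply, smul_eq_mul]; ring

lemma kernelOp_smul_right (Ψ : V × V × V → ℂ) (c : ℂ) (f g : 𝓢(V, ℂ)) (ξ : V) :
    kernelOp μ Ψ f (c • g) ξ = c * kernelOp μ Ψ f g ξ := by
  unfold kernelOp
  rw [← integral_const_mul]
  congr 1; ext z; simp only [smul_apply, smul_eq_mul]; ring

lemma kernelOp_const_mul_kernel (Ψ : V × V × V → ℂ) (c : ℂ) (f g : 𝓢(V, ℂ)) (ξ : V) :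
    kernelOp μ (fun z => c * Ψ z) f g ξ = c * kernelOp μ Ψ f g ξ := by
  unfold kernelOp
  rw [← integral_const_mul]
  congr 1; ext z; ring

/-- Differentiation under the integral. The domination is uniform on the unit ball around ξ, where 1
+ ‖x‖ ≤ 2 + ‖ξ‖. -/
lemma hasFDerivAt_kernelOp {Ψ : V × V × V → ℂ} (hΨ : Ψ.HasTemperateGrowth) (f g : 𝓢(V, ℂ)) (ξ : V) :
    ∃ L : V →L[ℝ] ℂ, HasFDerivAt (kernelOp μ Ψ f g) L ξ ∧
      ∀ w, L w = kernelOp μ (fun z => fderiv ℝ Ψ z (w, 0)) f g ξ := by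
  set F' : V → V × V → V →L[ℝ] ℂ := fun ξ z =>
    (f z.1 * g z.2) • (fderiv ℝ Ψ (ξ, z)).comp (ContinuousLinearMap.inl ℝ V (V × V)) with hF'
  obtain ⟨k, C, hC, h⟩ := HasTemperateGrowth.bound (temperate_fderiv hΨ)
  have hc := hΨ.1.continuous
  have hc' : Continuous (fderiv ℝ Ψ) := (temperate_fderiv hΨ).1.continuous
  have hbound : ∀ z, ∀ x ∈ Metric.ball ξ 1, ‖F' x z‖ ≤ C * (2 + ‖ξ‖) ^ k *
      ((1 + ‖z.1‖) ^ k * ‖f z.1‖ * ((1 + ‖z.2‖) ^ k * ‖g z.2‖)) := by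
    intro z x hx
    have hx' : ‖x‖ ≤ 1 + ‖ξ‖ := by
      have := norm_le_norm_add_norm_sub' x ξ
      rw [mem_ball_iff_norm] at hx
      linarith
    have h1 : ‖F' x z‖ ≤ ‖fderiv ℝ Ψ (x, z)‖ * ‖f z.1‖ * ‖g z.2‖ := by
      simp only [hF', norm_smul, norm_mul]
      have h2 : ‖(fderiv ℝ Ψ (x, z)).comp (ContinuousLinearMap.inl ℝ V (V × V))‖
          ≤ ‖fderiv ℝ Ψ (x, z)‖ * 1 :=
        (ContinuousLinearMap.opNorm_comp_le _ _).trans (by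
          gcongr
          exact ContinuousLinearMap.opNorm_le_bound _ zero_le_one fun v => by simp)
      calc _ ≤ ‖f z.1‖ * ‖g z.2‖ * (‖fderiv ℝ Ψ (x, z)‖ * 1) := by gcongr
        _ = _ := by ring
    refine (h1.trans (norm_kernel_le hC h f g x z)).trans ?_
    gcongr C * ?_ ^ k * _
    linarith
  have hder : ∀ z, ∀ x ∈ Metric.ball ξ 1,
      HasFDerivAt (fun x => Ψ (x, z) * f z.1 * g z.2) (F' x z) x := by
    intro z x _
    have h1 : HasFDerivAt (fun x : V => (x, z)) (ContinuousLinearMap.inl ℝ V (V × V)) x :=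
      (hasFDerivAt_id x).prodMk (hasFDerivAt_const z x)
    have h2 := ((HasTemperateGrowth.differentiable hΨ (x, z)).hasFDerivAt.comp x h1)
    have h3 := h2.const_mul (f z.1 * g z.2)
    refine h3.congr_of_eventuallyEq (Filter.Eventually.of_forall fun y => ?_)
    simp only [Function.comp]
    ring
  have hmeas : AEStronglyMeasurable (F' ξ) (μ.prod μ) := by
    have : Continuous (F' ξ) := by
      refine Continuous.smul (f := fun z : V × V => f z.1 * g z.2) (by fun_prop) ?_
      exact (ContinuousLinearMap.compL ℝ V (V × V × V) ℂ).flip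
        (ContinuousLinearMap.inl ℝ V (V × V)) |>.continuous.comp (hc'.comp (f := fun z : V × V => (ξ, z)) (by fun_prop))
    exact this.aestronglyMeasurable
  have hint : Integrable (F' ξ) (μ.prod μ) :=
    (integrable_kernelOp_bound μ f g _ k).mono' hmeas
      (Filter.Eventually.of_forall fun z => hbound z ξ (Metric.mem_ball_self one_pos))
  refine ⟨∫ z, F' ξ z ∂(μ.prod μ), ?_, fun w => ?_⟩
  · exact hasFDerivAt_integral_of_dominated_of_fderiv_le (Metric.ball_mem_nhds ξ one_pos)
      (Filter.Eventually.of_forall fun x => by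
        have : Continuous (fun z : V × V => Ψ (x, z) * f z.1 * g z.2) := by fun_prop
        exact this.aestronglyMeasurable)
      (integrable_kernelOp hΨ f g ξ) hmeas (Filter.Eventually.of_forall hbound)
      (integrable_kernelOp_bound μ f g _ k) (Filter.Eventually.of_forall hder)
  · rw [ContinuousLinearMap.integral_apply hint]
    unfold kernelOp
    congr 1; ext z
    simp [hF']
    ring

/-- The three terms are the Leibniz expansion of a directional derivative of the integrand, whose
integral vanishes. This is the source of every integration by parts below. -/
lemma kernelOp_fderiv_snd {Ψ : V × V × V → ℂ} (hΨ : Ψ.HasTemperateGrowth) (f g : 𝓢(V, ℂ)) (ξ : V)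
    (v w : V) :
    kernelOp μ (fun z => fderiv ℝ Ψ z (0, v, w)) f g ξ
      + kernelOp μ Ψ (∂_{v} f) g ξ + kernelOp μ Ψ f (∂_{w} g) ξ = 0 := by
  have hi0 := integrable_kernelOp (μ := μ) hΨ f g ξ
  have hi1 := integrable_kernelOp (μ := μ) (temperate_fderiv_apply hΨ (0, v, w)) f g ξ
  have hi2 := integrable_kernelOp (μ := μ) hΨ (∂_{v} f) g ξ
  have hi3 := integrable_kernelOp (μ := μ) hΨ f (∂_{w} g) ξ
  set G : V × V → ℂ := fun z => Ψ (ξ, z) * f z.1 * g z.2 with hG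
  set G' : V × V → ℂ := fun z => fderiv ℝ Ψ (ξ, z) (0, v, w) * f z.1 * g z.2
    + Ψ (ξ, z) * (∂_{v} f) z.1 * g z.2 + Ψ (ξ, z) * f z.1 * (∂_{w} g) z.2 with hG'
  have hint : Integrable G' (μ.prod μ) := (hi1.add hi2).add hi3
  have hder : ∀ z, HasLineDerivAt ℝ G (G' z) z (v, w) := by
    intro z
    have h1 : HasFDerivAt (fun z : V × V => (ξ, z)) (ContinuousLinearMap.inr ℝ V (V × V)) z :=
      (hasFDerivAt_const ξ z).prodMk (hasFDerivAt_id z)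
    have h2 := (HasTemperateGrowth.differentiable hΨ (ξ, z)).hasFDerivAt.comp z h1
    have h3 : HasFDerivAt (fun z : V × V => f z.1) _ z := (f.hasFDerivAt z.1).comp z hasFDerivAt_fst
    have h4 : HasFDerivAt (fun z : V × V => g z.2) _ z := (g.hasFDerivAt z.2).comp z hasFDerivAt_snd
    have h5 : HasFDerivAt G _ z := (h2.mul h3).mul h4
    have h6 := h5.hasLineDerivAt (v, w)
    refine HasDerivAt.congr_deriv h6 ?_
    simp [hG', SchwartzMap.lineDerivOp_apply_eq_fderiv]
    ring
  -- Integration by parts against the constant function 1.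
  have key := integral_bilinear_hasLineDerivAt_right_eq_neg_left_of_integrable (μ := μ.prod μ)
    (f := fun _ : V × V => (1 : ℂ)) (f' := fun _ => 0) (g := G) (g' := G') (v := (v, w))
    (B := ContinuousLinearMap.mul ℝ ℂ) (by simp) (by simpa using hint) (by simpa using hi0)
    (fun z _ => by simpa using (hasFDerivAt_const (𝕜 := ℝ) (1 : ℂ) z).hasLineDerivAt (v, w))
    (fun z _ => hder z)
  simp only [ContinuousLinearMap.mul_apply', one_mul, zero_mul, integral_zero, neg_zero] at key
  unfold kernelOp
  rw [← integral_add hi1 hi2]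
  erw [← integral_add (hi1.add hi2) hi3]
  exact key

end Kernel

end MagneticMoyal

/-! ### Oscillatory operators on phase space and their integration by parts identities. -/

namespace MagneticMoyal

open scoped LineDeriv InnerProductSpace

set_option linter.unusedSectionVars false

variable {N : ℕ}

instance isAddHaarMeasure_phaseMeasure (N : ℕ) : (phaseMeasure N).IsAddHaarMeasure := by
  have : (volume : Measure (Phase N)).IsAddHaarMeasure :=
    inferInstanceAs (((volume : Measure (X N)).prod volume).IsAddHaarMeasure)
  unfold phaseMeasure
  exact Measure.IsAddHaarMeasure.smul _ (by simp [ENNReal.ofReal_eq_zero]; positivity)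
    ENNReal.ofReal_ne_top

lemma pair_eq_inner (q p : X N) : pair q p = ⟪p, q⟫_ℝ := by
  simp [pair, PiLp.inner_apply]

/-- The symplectic form as a continuous bilinear form. -/
def symplCLM (N : ℕ) : Phase N →L[ℝ] Phase N →L[ℝ] ℝ :=
  (innerSL ℝ).bilinearComp (ContinuousLinearMap.snd ℝ (X N) (X N))
      (ContinuousLinearMap.fst ℝ (X N) (X N))
    - (innerSL ℝ).bilinearComp (ContinuousLinearMap.fst ℝ (X N) (X N))
      (ContinuousLinearMap.snd ℝ (X N) (X N))

lemma symplCLM_apply (ξ η : Phase N) : symplCLM N ξ η = ⟪ξ.2, η.1⟫_ℝ - ⟪ξ.1, η.2⟫_ℝ := by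
  simp [symplCLM]

lemma sympl_eq (ξ η : Phase N) : sympl ξ η = symplCLM N ξ η := by
  rw [symplCLM_apply, sympl, pair_eq_inner, pair_eq_inner, real_inner_comm ξ.1]

/-- `(ξ, η, ζ) ↦ ξ - η`. -/
def diffFst (N : ℕ) : Phase N × Phase N × Phase N →L[ℝ] Phase N :=
  ContinuousLinearMap.fst ℝ _ _ - (ContinuousLinearMap.fst ℝ _ _).comp (ContinuousLinearMap.snd ℝ _ _)

/-- `(ξ, η, ζ) ↦ ξ - ζ`. -/
def diffSnd (N : ℕ) : Phase N × Phase N × Phase N →L[ℝ] Phase N :=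
  ContinuousLinearMap.fst ℝ _ _ - (ContinuousLinearMap.snd ℝ _ _).comp (ContinuousLinearMap.snd ℝ _ _)

@[simp] lemma diffFst_apply (z : Phase N × Phase N × Phase N) : diffFst N z = z.1 - z.2.1 := rfl

@[simp] lemma diffSnd_apply (z : Phase N × Phase N × Phase N) : diffSnd N z = z.1 - z.2.2 := rfl

/-- The positions `(q, x, y)` of a triple of points of phase space. -/
def positions (N : ℕ) : Phase N × Phase N × Phase N →L[ℝ] X N × X N × X N :=
  (ContinuousLinearMap.fst ℝ _ _).prodMap
    ((ContinuousLinearMap.fst ℝ _ _).prodMap (ContinuousLinearMap.fst ℝ _ _))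

@[simp] lemma positions_apply (z : Phase N × Phase N × Phase N) :
    positions N z = (z.1.1, z.2.1.1, z.2.2.1) := rfl

/-- The phase of the Moyal kernel. -/
def moyalPhase (z : Phase N × Phase N × Phase N) : ℝ := 2 * symplCLM N (diffFst N z) (diffSnd N z)

lemma hasTemperateGrowth_moyalPhase : Function.HasTemperateGrowth (moyalPhase (N := N)) :=
  (Function.HasTemperateGrowth.const 2).mul ((symplCLM N).bilinear_hasTemperateGrowth
    (diffFst N).hasTemperateGrowth (diffSnd N).hasTemperateGrowth)

/-- The oscillating kernel with amplitude `b`, a function of the positions. -/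
def oscKernel (b : X N × X N × X N → ℂ) (z : Phase N × Phase N × Phase N) : ℂ :=
  Complex.exp (-Complex.I * (moyalPhase z : ℂ)) * b (positions N z)

lemma hasTemperateGrowth_oscKernel {b : X N × X N × X N → ℂ} (hb : b.HasTemperateGrowth) :
    Function.HasTemperateGrowth (oscKernel b) :=
  (HasTemperateGrowth.cexp_neg_I_mul hasTemperateGrowth_moyalPhase).mul
    (HasTemperateGrowth.compCLM hb (positions N))

/-- The phase is quadratic, so the exponential contributes a factor linear in z; the derivative of
the amplitude again depends on positions only. -/
lemma fderiv_oscKernel {b : X N × X N × X N → ℂ} (hb : b.HasTemperateGrowth)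
    (z w : Phase N × Phase N × Phase N) :
    fderiv ℝ (oscKernel b) z w =
      -(2 * Complex.I) * ((symplCLM N (diffFst N w) (diffSnd N z)
        + symplCLM N (diffFst N z) (diffSnd N w) : ℝ) : ℂ) * oscKernel b z
      + oscKernel (fun u => fderiv ℝ b u (positions N w)) z := by
  have h1 : HasFDerivAt (fun z => symplCLM N (diffFst N z) (diffSnd N z)) _ z :=
    ((symplCLM N).hasFDerivAt_of_bilinear (diffFst N).hasFDerivAt (diffSnd N).hasFDerivAt)
  have h2 := Complex.ofRealCLM.hasFDerivAt.comp z (h1.const_mul 2)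
  have h3 := ((h2.const_mul (-Complex.I)).cexp)
  have h4 := (HasTemperateGrowth.differentiable hb (positions N z)).hasFDerivAt.comp z
    (positions N).hasFDerivAt
  have h5 : HasFDerivAt (oscKernel b) _ z := h3.mul h4
  rw [h5.fderiv]
  simp [oscKernel, moyalPhase]
  ring

/-- The oscillatory integral operator with amplitude `b`. -/
def osc (b : X N × X N × X N → ℂ) (f g : 𝓢(Phase N, ℂ)) (ξ : Phase N) : ℂ :=
  kernelOp (phaseMeasure N) (oscKernel b) f g ξ

lemma hasTemperateGrowth_momentum (e : X N) :
    Function.HasTemperateGrowth (fun ξ : Phase N => ((⟪ξ.2, e⟫_ℝ : ℝ) : ℂ)) :=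
  Function.Complex.hasTemperateGrowth_ofReal.comp
    ((Function.hasTemperateGrowth_inner_left e).comp
      (ContinuousLinearMap.snd ℝ (X N) (X N)).hasTemperateGrowth)

/-- Multiplication of Schwartz functions by `p · e`. -/
def mulMomentum (e : X N) : 𝓢(Phase N, ℂ) →L[ℂ] 𝓢(Phase N, ℂ) :=
  smulLeftCLM ℂ (fun ξ : Phase N => ((⟪ξ.2, e⟫_ℝ : ℝ) : ℂ))

lemma mulMomentum_apply (e : X N) (f : 𝓢(Phase N, ℂ)) (ξ : Phase N) :
    mulMomentum e f ξ = ((⟪ξ.2, e⟫_ℝ : ℝ) : ℂ) * f ξ := by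
  rw [mulMomentum, smulLeftCLM_apply_apply (hasTemperateGrowth_momentum e), smul_eq_mul]

section Identities

variable {b : X N × X N × X N → ℂ} (hb : b.HasTemperateGrowth) (f g : 𝓢(Phase N, ℂ)) (ξ : Phase N)

include hb

/-- Along the momentum of η in direction e the phase has derivative -2⟨q - y, e⟩ and the amplitude
is constant. Integration by parts therefore trades the factor q - y for a derivative of f, with no
weight appearing. -/
lemma osc_mul_left (e : X N) :
    osc (fun u => ((⟪u.1 - u.2.2, e⟫_ℝ : ℝ) : ℂ) * b u) f g ξ
      = Complex.I / 2 * osc b (∂_{((0, e) : Phase N)} f) g ξ := by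
  have h := kernelOp_fderiv_snd (phaseMeasure N) (hasTemperateGrowth_oscKernel hb) f g ξ (0, e) 0
  have h1 : kernelOp (phaseMeasure N) (oscKernel b) f (∂_{(0 : Phase N)} g) ξ = 0 := by
    have : ∂_{(0 : Phase N)} g = 0 := by ext; simp
    rw [this]; simp [kernelOp]
  have h2 : (fun z => fderiv ℝ (oscKernel b) z (0, (0, e), 0)) =
      fun z => 2 * Complex.I * oscKernel (fun u => ((⟪u.1 - u.2.2, e⟫_ℝ : ℝ) : ℂ) * b u) z := by
    ext z
    have h0 : ∀ v, fderiv ℝ b v (0, 0, 0) = 0 := fun v => map_zero _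
    rw [fderiv_oscKernel hb]
    simp [h0, inner_sub_right, symplCLM_apply, oscKernel, real_inner_comm e]
    ring
  rw [h1, h2, kernelOp_const_mul_kernel, add_zero] at h
  unfold osc
  linear_combination (-Complex.I / 2) * h + (kernelOp (phaseMeasure N)
    (oscKernel (fun u => ((⟪u.1 - u.2.2, e⟫_ℝ : ℝ) : ℂ) * b u)) f g ξ) * Complex.I_sq

/-- The same mechanism in the momentum of ζ, along which the phase has derivative 2⟨q - x, e⟩. -/
lemma osc_mul_right (e : X N) :
    osc (fun u => ((⟪u.1 - u.2.1, e⟫_ℝ : ℝ) : ℂ) * b u) f g ξ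
      = -(Complex.I / 2) * osc b f (∂_{((0, e) : Phase N)} g) ξ := by
  have h := kernelOp_fderiv_snd (phaseMeasure N) (hasTemperateGrowth_oscKernel hb) f g ξ 0 (0, e)
  have h1 : kernelOp (phaseMeasure N) (oscKernel b) (∂_{(0 : Phase N)} f) g ξ = 0 := by
    have : ∂_{(0 : Phase N)} f = 0 := by ext; simp
    rw [this]; simp [kernelOp]
  have h2 : (fun z => fderiv ℝ (oscKernel b) z (0, 0, (0, e))) =
      fun z => -(2 * Complex.I) *
        oscKernel (fun u => ((⟪u.1 - u.2.1, e⟫_ℝ : ℝ) : ℂ) * b u) z := by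
    ext z
    have h0 : ∀ v, fderiv ℝ b v (0, 0, 0) = 0 := fun v => map_zero _
    rw [fderiv_oscKernel hb]
    simp [h0, inner_sub_left, symplCLM_apply, oscKernel]
    ring
  rw [h1, h2, kernelOp_const_mul_kernel, add_zero] at h
  unfold osc
  linear_combination (Complex.I / 2) * h + (kernelOp (phaseMeasure N)
    (oscKernel (fun u => ((⟪u.1 - u.2.1, e⟫_ℝ : ℝ) : ℂ) * b u)) f g ξ) * Complex.I_sq

/-- Integration by parts in the position x of η: the phase has derivative 2⟨p - l, e⟩, which
replaces the outer momentum p by the momentum l of ζ, a multiplier of g. -/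
lemma momentum_mul_osc (e : X N) :
    ((⟪ξ.2, e⟫_ℝ : ℝ) : ℂ) * osc b f g ξ = osc b f (mulMomentum e g) ξ
      - Complex.I / 2 * (osc (fun u => fderiv ℝ b u (0, e, 0)) f g ξ
        + osc b (∂_{((e, 0) : Phase N)} f) g ξ) := by
  have h := kernelOp_fderiv_snd (phaseMeasure N) (hasTemperateGrowth_oscKernel hb) f g ξ (e, 0) 0
  have h1 : kernelOp (phaseMeasure N) (oscKernel b) f (∂_{(0 : Phase N)} g) ξ = 0 := by
    have : ∂_{(0 : Phase N)} g = 0 := by ext; simp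
    rw [this]; simp [kernelOp]
  have h2 : kernelOp (phaseMeasure N) (fun z => fderiv ℝ (oscKernel b) z (0, (e, 0), 0)) f g ξ =
      -(2 * Complex.I) * (((⟪ξ.2, e⟫_ℝ : ℝ) : ℂ) * osc b f g ξ - osc b f (mulMomentum e g) ξ)
        + osc (fun u => fderiv ℝ b u (0, e, 0)) f g ξ := by
    have i1 := integrable_kernelOp (μ := phaseMeasure N) (hasTemperateGrowth_oscKernel hb) f g ξ
    have i2 := integrable_kernelOp (μ := phaseMeasure N) (hasTemperateGrowth_oscKernel hb) f
      (mulMomentum e g) ξ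
    have i4 : Integrable (fun z : Phase N × Phase N => ((⟪ξ.2, e⟫_ℝ : ℝ) : ℂ) *
        (oscKernel b (ξ, z) * f z.1 * g z.2) - oscKernel b (ξ, z) * f z.1 * mulMomentum e g z.2)
        ((phaseMeasure N).prod (phaseMeasure N)) := (i1.const_mul _).sub i2
    have i3 := integrable_kernelOp (μ := phaseMeasure N) (hasTemperateGrowth_oscKernel
      (temperate_fderiv_apply hb (0, e, 0))) f g ξ
    unfold osc kernelOp
    rw [← integral_const_mul, ← integral_sub (i1.const_mul _) i2, ← integral_const_mul,
      ← integral_add (i4.const_mul _) i3]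
    congr 1; ext z
    beta_reduce
    rw [fderiv_oscKernel hb, mulMomentum_apply]
    simp [symplCLM_apply, real_inner_comm e, inner_sub_right]
    ring
  rw [h1, h2, add_zero] at h
  unfold osc at h ⊢
  linear_combination (Complex.I / 2) * h + (((⟪ξ.2, e⟫_ℝ : ℝ) : ℂ) *
      kernelOp (phaseMeasure N) (oscKernel b) f g ξ - kernelOp (phaseMeasure N) (oscKernel b) f
      (mulMomentum e g) ξ) * Complex.I_sq

/-- Integration by parts in the position y of ζ: the phase has derivative -2⟨p - k, e⟩, which
replaces the momentum k of η by the outer momentum p. Together with `momentum_mul_osc` it moves a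
momentum from f to g. -/
lemma osc_mulMomentum_left (e : X N) :
    osc b (mulMomentum e f) g ξ = ((⟪ξ.2, e⟫_ℝ : ℝ) : ℂ) * osc b f g ξ
      - Complex.I / 2 * (osc (fun u => fderiv ℝ b u (0, 0, e)) f g ξ
        + osc b f (∂_{((e, 0) : Phase N)} g) ξ) := by
  have h := kernelOp_fderiv_snd (phaseMeasure N) (hasTemperateGrowth_oscKernel hb) f g ξ 0 (e, 0)
  have h1 : kernelOp (phaseMeasure N) (oscKernel b) (∂_{(0 : Phase N)} f) g ξ = 0 := by
    have : ∂_{(0 : Phase N)} f = 0 := by ext; simp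
    rw [this]; simp [kernelOp]
  have h2 : kernelOp (phaseMeasure N) (fun z => fderiv ℝ (oscKernel b) z (0, 0, (e, 0))) f g ξ =
      (2 * Complex.I) * (((⟪ξ.2, e⟫_ℝ : ℝ) : ℂ) * osc b f g ξ - osc b (mulMomentum e f) g ξ)
        + osc (fun u => fderiv ℝ b u (0, 0, e)) f g ξ := by
    have i1 := integrable_kernelOp (μ := phaseMeasure N) (hasTemperateGrowth_oscKernel hb) f g ξ
    have i2 := integrable_kernelOp (μ := phaseMeasure N) (hasTemperateGrowth_oscKernel hb)
      (mulMomentum e f) g ξ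
    have i4 : Integrable (fun z : Phase N × Phase N => ((⟪ξ.2, e⟫_ℝ : ℝ) : ℂ) *
        (oscKernel b (ξ, z) * f z.1 * g z.2) - oscKernel b (ξ, z) * mulMomentum e f z.1 * g z.2)
        ((phaseMeasure N).prod (phaseMeasure N)) := (i1.const_mul _).sub i2
    have i3 := integrable_kernelOp (μ := phaseMeasure N) (hasTemperateGrowth_oscKernel
      (temperate_fderiv_apply hb (0, 0, e))) f g ξ
    unfold osc kernelOp
    rw [← integral_const_mul, ← integral_sub (i1.const_mul _) i2, ← integral_const_mul,
      ← integral_add (i4.const_mul _) i3]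
    congr 1; ext z
    beta_reduce
    rw [fderiv_oscKernel hb, mulMomentum_apply]
    simp [symplCLM_apply]
    ring
  rw [h1, h2, add_zero] at h
  unfold osc at h ⊢
  linear_combination (Complex.I / 2) * h - (((⟪ξ.2, e⟫_ℝ : ℝ) : ℂ) *
      kernelOp (phaseMeasure N) (oscKernel b) f g ξ - kernelOp (phaseMeasure N) (oscKernel b)
      (mulMomentum e f) g ξ) * Complex.I_sq

lemma differentiable_osc : Differentiable ℝ (osc b f g) := fun ξ => by
  obtain ⟨L, hL, -⟩ := hasFDerivAt_kernelOp (phaseMeasure N) (hasTemperateGrowth_oscKernel hb) f g ξ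
  exact hL.differentiableAt

/-- The phase depends only on ξ - η and ξ - ζ, so a simultaneous translation of all three points
differentiates only the amplitude. The translation of η and ζ is then put on f and g by parts. -/
lemma fderiv_osc (w : Phase N) :
    fderiv ℝ (osc b f g) ξ w = osc (fun u => fderiv ℝ b u (w.1, w.1, w.1)) f g ξ
      + osc b (∂_{w} f) g ξ + osc b f (∂_{w} g) ξ := by
  obtain ⟨L, hL, h⟩ := hasFDerivAt_kernelOp (phaseMeasure N) (hasTemperateGrowth_oscKernel hb) f g ξ
  have h0 := kernelOp_fderiv_snd (phaseMeasure N) (hasTemperateGrowth_oscKernel hb) f g ξ w w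
  have h1 := kernelOp_add_kernel (phaseMeasure N)
    (temperate_fderiv_apply (hasTemperateGrowth_oscKernel hb) (w, 0))
    (temperate_fderiv_apply (hasTemperateGrowth_oscKernel hb) (0, w, w)) f g ξ
  have h2 : (fun z => fderiv ℝ (oscKernel b) z (w, 0) + fderiv ℝ (oscKernel b) z (0, w, w)) =
      oscKernel (fun u => fderiv ℝ b u (w.1, w.1, w.1)) := by
    ext z
    rw [← map_add, fderiv_oscKernel hb]
    simp
  rw [h2] at h1
  have h3 : fderiv ℝ (osc b f g) ξ = L := HasFDerivAt.fderiv hL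
  rw [h3, h]
  unfold osc
  linear_combination -h0 - h1

end Identities

end MagneticMoyal

/-! ### Weights, and estimates for the norms of R^m_0. -/

namespace MagneticMoyal

open scoped LineDeriv InnerProductSpace

variable {N : ℕ}

lemma one_le_bracket (ξ : Phase N) : 1 ≤ bracket ξ := by
  rw [bracket, Real.one_le_sqrt]
  nlinarith [sq_nonneg ‖ξ.1‖, sq_nonneg ‖ξ.2‖]

lemma bracket_sq (ξ : Phase N) : bracket ξ ^ 2 = 1 + ‖ξ.1‖ ^ 2 + ‖ξ.2‖ ^ 2 :=
  Real.sq_sqrt (by positivity)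

lemma norm_le_bracket (ξ : Phase N) : ‖ξ‖ ≤ bracket ξ := by
  refine Real.le_sqrt_of_sq_le ?_
  rcases le_total ‖ξ.1‖ ‖ξ.2‖ with h | h
  · rw [Prod.norm_def, max_eq_right h]; nlinarith [sq_nonneg ‖ξ.1‖]
  · rw [Prod.norm_def, max_eq_left h]; nlinarith [sq_nonneg ‖ξ.2‖]

lemma bracket_le (ξ : Phase N) : bracket ξ ≤ 2 * (1 + ‖ξ‖) := by
  have h1 : ‖ξ.1‖ ≤ ‖ξ‖ := norm_fst_le ξ
  have h2 : ‖ξ.2‖ ≤ ‖ξ‖ := norm_snd_le ξ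
  rw [bracket, Real.sqrt_le_left (by positivity)]
  have := norm_nonneg ξ.1
  have := norm_nonneg ξ.2
  nlinarith

lemma bracket_rpow_le (m : ℝ) : ∃ k : ℕ, ∀ ξ : Phase N, bracket ξ ^ m ≤ 2 ^ k * (1 + ‖ξ‖) ^ k := by
  -- For m ≤ 0 the natural ceiling is 0, which suffices because the bracket is at least 1.
  refine ⟨⌈m⌉₊, fun ξ => ?_⟩
  rw [← mul_pow]
  calc bracket ξ ^ m ≤ bracket ξ ^ (⌈m⌉₊ : ℝ) :=
        Real.rpow_le_rpow_of_exponent_le (one_le_bracket ξ) (Nat.le_ceil m)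
    _ = bracket ξ ^ ⌈m⌉₊ := Real.rpow_natCast _ _
    _ ≤ _ := pow_le_pow_left₀ (bracket_nonneg ξ) (bracket_le ξ) _

lemma one_add_pow_le_two_pow (k : ℕ) {x : ℝ} (hx : 0 ≤ x) : (1 + x) ^ k ≤ 2 ^ k * (1 + x ^ k) := by
  calc (1 + x) ^ k ≤ 2 ^ (k - 1) * (1 ^ k + x ^ k) := add_pow_le zero_le_one hx k
    _ ≤ 2 ^ k * (1 + x ^ k) := by
      rw [one_pow]; gcongr
      · norm_num
      · omega

lemma integrable_weight_schwartz (m : ℝ) (f : 𝓢(Phase N, ℂ)) (n : ℕ) :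
    Integrable (fun ξ => bracket ξ ^ m * ‖iteratedFDeriv ℝ n f ξ‖) (phaseMeasure N) := by
  obtain ⟨k, hk⟩ := bracket_rpow_le (N := N) m
  have h0 := f.integrable_pow_mul_iteratedFDeriv (phaseMeasure N) 0 n
  have h1 := f.integrable_pow_mul_iteratedFDeriv (phaseMeasure N) k n
  have hc := continuous_weight (-m) n (f.smooth ⊤)
  rw [neg_neg] at hc
  refine ((h0.add h1).const_mul (2 ^ k * 2 ^ k)).mono' hc.aestronglyMeasurable
    (Filter.Eventually.of_forall fun ξ => ?_)
  have hb : 0 ≤ bracket ξ ^ m := Real.rpow_nonneg (bracket_nonneg ξ) m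
  rw [Real.norm_of_nonneg (by positivity)]
  calc bracket ξ ^ m * ‖iteratedFDeriv ℝ n f ξ‖
      ≤ (2 ^ k * (2 ^ k * (1 + ‖ξ‖ ^ k))) * ‖iteratedFDeriv ℝ n f ξ‖ := by
        gcongr
        refine (hk ξ).trans ?_
        gcongr
        exact one_add_pow_le_two_pow k (norm_nonneg ξ)
    _ = _ := by simp only [Pi.add_apply, pow_zero]; ring

/-- Schwartz functions as elements of `R^m_0`. -/
def toR0 (m : ℝ) : 𝓢(Phase N, ℂ) →ₗ[ℂ] R0 N m where
  toFun f := (⟨f, f.smooth ⊤, fun n => integrable_weight_schwartz (-m) f n⟩ : R0Submodule N m)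
  map_add' _ _ := rfl
  map_smul' _ _ := rfl

lemma toR0_toFun (m : ℝ) (f : 𝓢(Phase N, ℂ)) : (toR0 m f).toFun = f := rfl

lemma R0.norms_apply (m : ℝ) (n : ℕ) (f : R0 N m) : R0.norms N m n f =
    ∑ j ∈ Finset.range (n + 1),
      ∫ ξ, bracket ξ ^ (-m) * ‖iteratedFDeriv ℝ j f.toFun ξ‖ ∂(phaseMeasure N) := rfl

lemma weight_nonneg (m : ℝ) (n : ℕ) (f : Phase N → ℂ) (ξ : Phase N) :
    0 ≤ bracket ξ ^ m * ‖iteratedFDeriv ℝ n f ξ‖ :=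
  mul_nonneg (Real.rpow_nonneg (bracket_nonneg ξ) _) (norm_nonneg _)

lemma R0.norms_mono (m : ℝ) {n n' : ℕ} (h : n ≤ n') (f : R0 N m) :
    R0.norms N m n f ≤ R0.norms N m n' f := by
  rw [R0.norms_apply, R0.norms_apply]
  refine Finset.sum_le_sum_of_subset_of_nonneg (Finset.range_mono (by omega)) fun j _ _ => ?_
  exact integral_nonneg fun ξ => weight_nonneg _ _ _ _

/-- A pointwise bound of derivatives gives a bound of the norms. -/
lemma R0.norms_le_of_pointwise {m m' C : ℝ} {n k : ℕ} (f : R0 N m) (g : R0 N m')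
    (h : ∀ j ≤ n, ∀ ξ, bracket ξ ^ (-m) * ‖iteratedFDeriv ℝ j f.toFun ξ‖ ≤
      C * ∑ i ∈ Finset.range (k + 1), bracket ξ ^ (-m') * ‖iteratedFDeriv ℝ i g.toFun ξ‖) :
    R0.norms N m n f ≤ (n + 1) * C * R0.norms N m' k g := by
  rw [R0.norms_apply, R0.norms_apply, ← integral_finsetSum _ (fun i _ => g.integrable i)]
  have : ∀ j ∈ Finset.range (n + 1),
      ∫ ξ, bracket ξ ^ (-m) * ‖iteratedFDeriv ℝ j f.toFun ξ‖ ∂(phaseMeasure N) ≤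
      C * ∫ ξ, ∑ i ∈ Finset.range (k + 1), bracket ξ ^ (-m') * ‖iteratedFDeriv ℝ i g.toFun ξ‖
        ∂(phaseMeasure N) := by
    intro j hj
    rw [← integral_const_mul]
    refine integral_mono (f.integrable j)
      ((integrable_finsetSum _ fun i _ => g.integrable i).const_mul C) fun ξ => ?_
    exact h j (by simpa [Nat.lt_succ_iff] using hj) ξ
  refine (Finset.sum_le_sum this).trans (le_of_eq ?_)
  simp
  ring

lemma single_weight_le (m : ℝ) {j k : ℕ} (hj : j ≤ k) (f : Phase N → ℂ) (ξ : Phase N) :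
    bracket ξ ^ m * ‖iteratedFDeriv ℝ j f ξ‖ ≤
      ∑ i ∈ Finset.range (k + 1), bracket ξ ^ m * ‖iteratedFDeriv ℝ i f ξ‖ :=
  Finset.single_le_sum (f := fun i => bracket ξ ^ m * ‖iteratedFDeriv ℝ i f ξ‖)
    (fun i _ => weight_nonneg _ _ _ _) (by simp; omega)

lemma norms_toR0_mono {m m' : ℝ} (h : m ≤ m') (n : ℕ) (f : 𝓢(Phase N, ℂ)) :
    R0.norms N m' n (toR0 m' f) ≤ (n + 1) * 1 * R0.norms N m n (toR0 m f) := by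
  refine R0.norms_le_of_pointwise _ _ fun j hj ξ => ?_
  rw [one_mul]
  refine le_trans ?_ (single_weight_le (-m) hj _ ξ)
  rw [toR0_toFun, toR0_toFun]
  gcongr
  exact one_le_bracket ξ

lemma norms_toR0_lineDeriv (m : ℝ) (n : ℕ) (w : Phase N) (f : 𝓢(Phase N, ℂ)) :
    R0.norms N m n (toR0 m (∂_{w} f)) ≤ (n + 1) * ‖w‖ * R0.norms N m (n + 1) (toR0 m f) := by
  refine R0.norms_le_of_pointwise _ _ fun j hj ξ => ?_
  have h1 : ‖iteratedFDeriv ℝ j (∂_{w} f : 𝓢(Phase N, ℂ)) ξ‖ ≤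
      ‖w‖ * ‖iteratedFDeriv ℝ (j + 1) f ξ‖ := by
    have e : (∂_{w} f : 𝓢(Phase N, ℂ)) = ⇑(ContinuousLinearMap.apply ℝ ℂ w) ∘ fderiv ℝ f := rfl
    rw [e, ← norm_iteratedFDeriv_fderiv]
    refine ((ContinuousLinearMap.apply ℝ ℂ w).norm_iteratedFDeriv_comp_left
      (((f.smooth ⊤).fderiv_right (m := ∞) (by simp)).contDiffAt) (by exact_mod_cast le_top)).trans ?_
    gcongr
    refine ContinuousLinearMap.opNorm_le_bound _ (norm_nonneg _) fun L => ?_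
    simpa [mul_comm] using L.le_opNorm w
  calc _ ≤ bracket ξ ^ (-m) * (‖w‖ * ‖iteratedFDeriv ℝ (j + 1) f ξ‖) :=
        mul_le_mul_of_nonneg_left h1 (Real.rpow_nonneg (bracket_nonneg ξ) _)
    _ = ‖w‖ * (bracket ξ ^ (-m) * ‖iteratedFDeriv ℝ (j + 1) f ξ‖) := by ring
    _ ≤ _ := mul_le_mul_of_nonneg_left (single_weight_le (-m) (by omega) _ ξ) (norm_nonneg _)

/-- Leibniz formula at a single point. The constant c may depend on ξ, so it can carry a weight. -/
lemma norm_iteratedFDeriv_smul_le_of_bound {φ : Phase N → ℝ} {f : Phase N → ℂ} (hφ : ContDiff ℝ ∞ φ)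
    (hf : ContDiff ℝ ∞ f) {n : ℕ} {c : ℝ} {ξ : Phase N}
    (h : ∀ i ≤ n, ‖iteratedFDeriv ℝ i φ ξ‖ ≤ c) {j : ℕ} (hj : j ≤ n) :
    ‖iteratedFDeriv ℝ j (fun ξ => φ ξ • f ξ) ξ‖ ≤
      2 ^ n * c * ∑ i ∈ Finset.range (n + 1), ‖iteratedFDeriv ℝ i f ξ‖ := by
  have hc : 0 ≤ c := (norm_nonneg _).trans (h 0 (by omega))
  refine (norm_iteratedFDeriv_smul_le hφ hf ξ (n := j) (by exact_mod_cast le_top)).trans ?_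
  have hs : ∀ i ∈ Finset.range (j + 1), (j.choose i : ℝ) * ‖iteratedFDeriv ℝ i φ ξ‖ *
      ‖iteratedFDeriv ℝ (j - i) f ξ‖ ≤
      (j.choose i : ℝ) * (c * ∑ i ∈ Finset.range (n + 1), ‖iteratedFDeriv ℝ i f ξ‖) := by
    intro i hi
    rw [mul_assoc]
    have hi' : i ≤ j := by simpa [Nat.lt_succ_iff] using hi
    gcongr
    · exact h i (by omega)
    · exact Finset.single_le_sum (f := fun i => ‖iteratedFDeriv ℝ i f ξ‖)
        (fun i _ => norm_nonneg _) (by simp; omega)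
  refine (Finset.sum_le_sum hs).trans ?_
  rw [← Finset.sum_mul]
  have h2 : ∑ i ∈ Finset.range (j + 1), (j.choose i : ℝ) = 2 ^ j := by
    exact_mod_cast Nat.sum_range_choose j
  rw [h2, mul_assoc]
  have h3 : (2 : ℝ) ^ j ≤ 2 ^ n := pow_le_pow_right₀ (by norm_num) hj
  gcongr

/-- `1 + |q|² + |p|²`. -/
def bracketSq (ξ : Phase N) : ℝ := 1 + ‖ξ.1‖ ^ 2 + ‖ξ.2‖ ^ 2

lemma bracketSq_pos (ξ : Phase N) : 0 < bracketSq ξ := by unfold bracketSq; positivity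

lemma one_le_bracketSq (ξ : Phase N) : 1 ≤ bracketSq ξ := by
  unfold bracketSq; nlinarith [sq_nonneg ‖ξ.1‖, sq_nonneg ‖ξ.2‖]

lemma contDiff_bracketSq : ContDiff ℝ ∞ (bracketSq (N := N)) := by
  unfold bracketSq
  exact ((contDiff_const.add (contDiff_fst.norm_sq ℝ))).add (contDiff_snd.norm_sq ℝ)

/-- For a quadratic polynomial the first derivative is linear, the second constant and the later
ones zero, so one D serves all orders. -/
lemma exists_norm_iteratedFDeriv_bracketSq_le : ∃ D : ℝ, 1 ≤ D ∧ ∀ (i : ℕ) (ξ : Phase N), 1 ≤ i →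
    ‖iteratedFDeriv ℝ i (bracketSq (N := N)) ξ‖ ≤ D * bracketSq ξ := by
  set Λ : Phase N →L[ℝ] Phase N →L[ℝ] ℝ := (2 : ℝ) • ((innerSL ℝ).bilinearComp
      (ContinuousLinearMap.fst ℝ (X N) (X N)) (ContinuousLinearMap.fst ℝ (X N) (X N))
    + (innerSL ℝ).bilinearComp (ContinuousLinearMap.snd ℝ (X N) (X N))
      (ContinuousLinearMap.snd ℝ (X N) (X N))) with hΛ
  have hd : fderiv ℝ (bracketSq (N := N)) = Λ := by
    ext1 ξ
    have h1 : HasFDerivAt (fun ξ : Phase N => ‖ξ.1‖ ^ 2) _ ξ :=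
      (hasFDerivAt_fst (p := ξ) (𝕜 := ℝ)).norm_sq
    have h2 : HasFDerivAt (fun ξ : Phase N => ‖ξ.2‖ ^ 2) _ ξ :=
      (hasFDerivAt_snd (p := ξ) (𝕜 := ℝ)).norm_sq
    have h3 : HasFDerivAt (bracketSq (N := N)) _ ξ := (h1.const_add 1).add h2
    rw [h3.fderiv]
    ext v <;> simp [hΛ]
  refine ⟨‖Λ‖ + 1, by linarith [norm_nonneg Λ], fun i ξ hi => ?_⟩
  have h0 := one_le_bracketSq ξ
  have hn : ‖ξ‖ ≤ bracketSq ξ := by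
    have h4 := norm_le_bracket ξ
    have h5 := one_le_bracket ξ
    have h6 : bracketSq ξ = bracket ξ ^ 2 := (bracket_sq ξ).symm
    nlinarith
  have hL := norm_nonneg Λ
  obtain ⟨i, rfl⟩ := Nat.exists_eq_add_of_le' hi
  rw [← norm_iteratedFDeriv_fderiv, hd]
  rcases i with _ | i
  · rw [norm_iteratedFDeriv_zero]
    refine (Λ.le_opNorm ξ).trans ?_
    nlinarith
  · rw [← norm_iteratedFDeriv_fderiv]
    have : fderiv ℝ Λ = fun _ => Λ := by ext1 v; exact Λ.fderiv
    rw [this]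
    rcases i with _ | i
    · rw [norm_iteratedFDeriv_zero]; nlinarith
    · rw [iteratedFDeriv_succ_const]; simp; nlinarith

lemma contDiff_inv_bracketSq : ContDiff ℝ ∞ (fun ξ : Phase N => (bracketSq ξ)⁻¹) :=
  contDiff_bracketSq.inv fun ξ => (bracketSq_pos ξ).ne'

/-- Faà di Bruno bound for s ↦ 1/s composed with the weight. Retaining the full decay of the
reciprocal in every derivative is what makes division by the weight gain two powers. -/
lemma exists_norm_iteratedFDeriv_inv_bracketSq_le (n : ℕ) : ∃ C : ℝ, ∀ i ≤ n, ∀ ξ : Phase N,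
    ‖iteratedFDeriv ℝ i (fun ξ : Phase N => (bracketSq ξ)⁻¹) ξ‖ ≤ C * (bracketSq ξ)⁻¹ := by
  obtain ⟨D, hD1, hD⟩ := exists_norm_iteratedFDeriv_bracketSq_le (N := N)
  set c : ℝ := ∑ i ∈ Finset.range (n + 1),
    ‖iteratedFDerivWithin ℝ i (fun s : ℝ => s⁻¹) (Set.Ioi 0) 1‖ with hc
  have hc0 : 0 ≤ c := Finset.sum_nonneg fun _ _ => norm_nonneg _
  refine ⟨n.factorial * c * D ^ n, fun i hi ξ => ?_⟩
  have ht := bracketSq_pos ξ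
  -- Normalising the weight to be 1 at the point ξ leaves only the derivatives of 1/s at s = 1,
  -- which gives constants independent of ξ.
  set φ : Phase N → ℝ := fun η => (bracketSq ξ)⁻¹ • bracketSq η with hφ
  have hφc : ContDiff ℝ ∞ φ := contDiff_bracketSq.const_smul _
  have hφ1 : φ ξ = 1 := by simp [hφ, ht.ne']
  have e : (fun η : Phase N => (bracketSq η)⁻¹) =
      fun η => (bracketSq ξ)⁻¹ • ((fun s : ℝ => s⁻¹) ∘ φ) η := by
    ext η
    simp [hφ]
    field_simp
  have hg : ContDiffOn ℝ ∞ (fun s : ℝ => s⁻¹) (Set.Ioi 0) :=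
    contDiffOn_id.inv fun s hs => (ne_of_gt hs)
  have hr : Set.range φ ⊆ Set.Ioi 0 := by
    rintro - ⟨η, rfl⟩
    exact mul_pos (inv_pos.2 ht) (bracketSq_pos η)
  have key := norm_iteratedFDeriv_comp_le' (n := i) hr (isOpen_Ioi.uniqueDiffOn) hg hφc
    (by exact_mod_cast le_top) ξ (C := c) (D := D)
    (fun j hj => by
      rw [hφ1]
      exact Finset.single_le_sum (f := fun i => ‖iteratedFDerivWithin ℝ i (fun s : ℝ => s⁻¹)
        (Set.Ioi 0) 1‖) (fun _ _ => norm_nonneg _) (by simp; omega))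
    (fun j hj1 hj => by
      have h1 : iteratedFDeriv ℝ j φ ξ = (bracketSq ξ)⁻¹ • iteratedFDeriv ℝ j bracketSq ξ :=
        iteratedFDeriv_const_smul_apply (f := bracketSq) (a := (bracketSq ξ)⁻¹)
          ((contDiff_bracketSq.of_le (by exact_mod_cast le_top)).contDiffAt)
      rw [h1, norm_smul, Real.norm_of_nonneg (inv_nonneg.2 ht.le)]
      calc (bracketSq ξ)⁻¹ * ‖iteratedFDeriv ℝ j bracketSq ξ‖
          ≤ (bracketSq ξ)⁻¹ * (D * bracketSq ξ) := by
            gcongr; exact hD j ξ hj1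
        _ = D := by field_simp
        _ ≤ D ^ j := le_self_pow₀ hD1 (by omega))
  have h2 : iteratedFDeriv ℝ i (fun η : Phase N => (bracketSq η)⁻¹) ξ =
      (bracketSq ξ)⁻¹ • iteratedFDeriv ℝ i ((fun s : ℝ => s⁻¹) ∘ φ) ξ := by
    rw [e]
    exact iteratedFDeriv_const_smul_apply (f := (fun s : ℝ => s⁻¹) ∘ φ) (a := (bracketSq ξ)⁻¹)
      (((hg.comp_contDiff hφc fun η => hr ⟨η, rfl⟩).of_le (by exact_mod_cast le_top)).contDiffAt)
  rw [h2, norm_smul, Real.norm_of_nonneg (inv_nonneg.2 ht.le), mul_comm]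
  gcongr
  refine key.trans ?_
  gcongr

lemma hasTemperateGrowth_inv_bracketSq :
    Function.HasTemperateGrowth (fun ξ : Phase N => (((bracketSq ξ)⁻¹ : ℝ) : ℂ)) := by
  have : Function.HasTemperateGrowth (fun ξ : Phase N => (bracketSq ξ)⁻¹) := by
    refine ⟨contDiff_inv_bracketSq, fun n => ?_⟩
    obtain ⟨C, hC⟩ := exists_norm_iteratedFDeriv_inv_bracketSq_le (N := N) n
    have hC0 : 0 ≤ C := by
      have h := (norm_nonneg _).trans (hC n le_rfl 0)
      have h2 := inv_pos.2 (bracketSq_pos (0 : Phase N))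
      exact nonneg_of_mul_nonneg_left h h2
    refine ⟨0, C, fun ξ => (hC n le_rfl ξ).trans ?_⟩
    rw [pow_zero]
    gcongr
    exact inv_le_one_of_one_le₀ (one_le_bracketSq ξ)
  exact Function.Complex.hasTemperateGrowth_ofReal.comp this

/-- Division of Schwartz functions by `1 + |q|² + |p|²`. -/
def divBracketSq : 𝓢(Phase N, ℂ) →L[ℂ] 𝓢(Phase N, ℂ) :=
  smulLeftCLM ℂ (fun ξ : Phase N => (((bracketSq ξ)⁻¹ : ℝ) : ℂ))

lemma divBracketSq_apply (f : 𝓢(Phase N, ℂ)) (ξ : Phase N) :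
    divBracketSq f ξ = (bracketSq ξ)⁻¹ • f ξ := by
  rw [divBracketSq, smulLeftCLM_apply_apply hasTemperateGrowth_inv_bracketSq]
  simp

lemma exists_norms_divBracketSq_le (m : ℝ) (n : ℕ) : ∃ C : ℝ, 0 ≤ C ∧ ∀ f : 𝓢(Phase N, ℂ),
    R0.norms N m n (toR0 m (divBracketSq f)) ≤ C * R0.norms N (m + 2) n (toR0 (m + 2) f) := by
  obtain ⟨C, hC⟩ := exists_norm_iteratedFDeriv_inv_bracketSq_le (N := N) n
  have hC0 : 0 ≤ C := by
    have h := (norm_nonneg _).trans (hC n le_rfl 0)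
    exact nonneg_of_mul_nonneg_left h (inv_pos.2 (bracketSq_pos (0 : Phase N)))
  refine ⟨(n + 1) * (2 ^ n * C), by positivity, fun f =>
    R0.norms_le_of_pointwise _ _ fun j hj ξ => ?_⟩
  have h1 : (toR0 m (divBracketSq f)).toFun = fun ξ => (bracketSq ξ)⁻¹ • f ξ :=
    funext (divBracketSq_apply f)
  have h2 := norm_iteratedFDeriv_smul_le_of_bound contDiff_inv_bracketSq (f.smooth ⊤)
    (fun i hi => hC i hi ξ) hj
  rw [h1, ← Finset.mul_sum, toR0_toFun]
  have h3 : bracket ξ ^ (-(m + 2)) = bracket ξ ^ (-m) * (bracketSq ξ)⁻¹ := by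
    have : 0 < bracket ξ := one_pos.trans_le (one_le_bracket ξ)
    rw [neg_add, Real.rpow_add this, Real.rpow_neg this.le 2, bracketSq, ← bracket_sq]
    norm_num
  have hb : 0 ≤ bracket ξ ^ (-m) := Real.rpow_nonneg (bracket_nonneg ξ) _
  calc bracket ξ ^ (-m) * ‖iteratedFDeriv ℝ j (fun ξ => (bracketSq ξ)⁻¹ • f ξ) ξ‖
      ≤ bracket ξ ^ (-m) * (2 ^ n * (C * (bracketSq ξ)⁻¹) *
          ∑ i ∈ Finset.range (n + 1), ‖iteratedFDeriv ℝ i f ξ‖) := by gcongr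
    _ = _ := by rw [h3]; ring

end MagneticMoyal

/-! ### Uniformly bounded bilinear maps and their stability. -/

namespace MagneticMoyal

open scoped LineDeriv InnerProductSpace

variable {N : ℕ}

/-- Bilinear maps on Schwartz functions which are bounded, uniformly on phase space, by a norm of
`R^m_0` in the first argument and a continuous seminorm in the second one. -/
def BddBilin (m : ℝ) (U : 𝓢(Phase N, ℂ) → 𝓢(Phase N, ℂ) → Phase N → ℂ) : Prop :=
  ∃ (n : ℕ) (q : Seminorm ℂ 𝓢(Phase N, ℂ)), Continuous q ∧
    ∀ f g ξ, ‖U f g ξ‖ ≤ R0.norms N m n (toR0 m f) * q g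

lemma continuous_real_smul_seminorm {q : Seminorm ℂ 𝓢(Phase N, ℂ)} (hq : Continuous q) (c : NNReal) :
    Continuous ⇑(c • q) := by
  have : ⇑(c • q) = fun x => (c : ℝ) * q x := rfl
  rw [this]
  exact continuous_const.mul hq

namespace BddBilin

variable {m : ℝ} {U W : 𝓢(Phase N, ℂ) → 𝓢(Phase N, ℂ) → Phase N → ℂ}

lemma congr (hU : BddBilin m U) (h : ∀ f g ξ, W f g ξ = U f g ξ) : BddBilin m W := by
  obtain ⟨n, q, hq, hb⟩ := hU
  exact ⟨n, q, hq, fun f g ξ => by rw [h]; exact hb f g ξ⟩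

lemma add (hU : BddBilin m U) (hW : BddBilin m W) :
    BddBilin m (fun f g ξ => U f g ξ + W f g ξ) := by
  obtain ⟨n, q, hq, hb⟩ := hU
  obtain ⟨n', q', hq', hb'⟩ := hW
  refine ⟨max n n', q + q', hq.add hq', fun f g ξ => ?_⟩
  refine (norm_add_le _ _).trans ?_
  rw [_root_.add_apply, mul_add]
  refine add_le_add ((hb f g ξ).trans ?_) ((hb' f g ξ).trans ?_)
  · exact mul_le_mul_of_nonneg_right (R0.norms_mono m (le_max_left _ _) _) (apply_nonneg _ _)
  · exact mul_le_mul_of_nonneg_right (R0.norms_mono m (le_max_right _ _) _) (apply_nonneg _ _)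

lemma const_mul (c : ℂ) (hU : BddBilin m U) : BddBilin m (fun f g ξ => c * U f g ξ) := by
  obtain ⟨n, q, hq, hb⟩ := hU
  refine ⟨n, ‖c‖₊ • q, continuous_real_smul_seminorm hq _, fun f g ξ => ?_⟩
  have : (‖c‖₊ • q) g = ‖c‖ * q g := rfl
  rw [this, norm_mul]
  calc ‖c‖ * ‖U f g ξ‖ ≤ ‖c‖ * (R0.norms N m n (toR0 m f) * q g) := by gcongr; exact hb f g ξ
    _ = _ := by ring

lemma zero : BddBilin m (fun (_ _ : 𝓢(Phase N, ℂ)) (_ : Phase N) => (0 : ℂ)) :=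
  ⟨0, 0, continuous_const (y := (0 : ℝ)), fun f g ξ => by simp⟩

lemma sum {ι : Type*} (s : Finset ι) {U : ι → 𝓢(Phase N, ℂ) → 𝓢(Phase N, ℂ) → Phase N → ℂ}
    (h : ∀ i ∈ s, BddBilin m (U i)) : BddBilin m (fun f g ξ => ∑ i ∈ s, U i f g ξ) := by
  classical
  induction s using Finset.induction_on with
  | empty => simpa using zero
  | insert i s hi ih =>
    simp only [Finset.sum_insert hi]
    exact (h i (by simp)).add (ih fun j hj => h j (by simp [hj]))

lemma comp_right (hU : BddBilin m U) (L : 𝓢(Phase N, ℂ) →L[ℂ] 𝓢(Phase N, ℂ)) :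
    BddBilin m (fun f g ξ => U f (L g) ξ) := by
  obtain ⟨n, q, hq, hb⟩ := hU
  exact ⟨n, q.comp L.toLinearMap, hq.comp L.continuous, fun f g ξ => hb f (L g) ξ⟩

/-- The norm estimate is all that is asked of A; it may shift both the weight and the number of
derivatives. -/
lemma comp_left (hU : BddBilin m U) {m' : ℝ} (A : 𝓢(Phase N, ℂ) → 𝓢(Phase N, ℂ))
    (hA : ∀ n, ∃ (n' : ℕ) (C : ℝ), 0 ≤ C ∧ ∀ f,
      R0.norms N m n (toR0 m (A f)) ≤ C * R0.norms N m' n' (toR0 m' f)) :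
    BddBilin m' (fun f g ξ => U (A f) g ξ) := by
  obtain ⟨n, q, hq, hb⟩ := hU
  obtain ⟨n', C, hC, hA⟩ := hA n
  refine ⟨n', C.toNNReal • q, continuous_real_smul_seminorm hq _, fun f g ξ => ?_⟩
  have : (C.toNNReal • q) g = C * q g := by
    change (C.toNNReal : ℝ) * q g = _
    rw [Real.coe_toNNReal C hC]
  rw [this]
  calc ‖U (A f) g ξ‖ ≤ R0.norms N m n (toR0 m (A f)) * q g := hb _ _ _
    _ ≤ (C * R0.norms N m' n' (toR0 m' f)) * q g := by gcongr; exact hA f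
    _ = _ := by ring

lemma comp_lineDeriv (hU : BddBilin m U) (w : Phase N) :
    BddBilin m (fun f g ξ => U (∂_{w} f) g ξ) :=
  hU.comp_left _ fun n => ⟨n + 1, (n + 1) * ‖w‖, by positivity, norms_toR0_lineDeriv m n w⟩

lemma comp_lineDeriv_right (hU : BddBilin m U) (w : Phase N) :
    BddBilin m (fun f g ξ => U f (∂_{w} g) ξ) :=
  hU.comp_right (LineDeriv.lineDerivOpCLM ℂ 𝓢(Phase N, ℂ) w)

/-- The norms decrease as the weight index grows, so the bound with the larger index is the stronger
one. -/
lemma mono {m' : ℝ} (h : m ≤ m') (hU : BddBilin m' U) : BddBilin m U :=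
  hU.comp_left id fun n => ⟨n, (n + 1) * 1, by positivity, norms_toR0_mono h n⟩

end BddBilin

/-! ### Amplitudes of polynomial growth, without weight on the first argument. -/

section Amplitudes

lemma osc_sum {ι : Type*} (s : Finset ι) {b : ι → X N × X N × X N → ℂ}
    (hb : ∀ i ∈ s, (b i).HasTemperateGrowth) (f g : 𝓢(Phase N, ℂ)) (ξ : Phase N) :
    osc (fun u => ∑ i ∈ s, b i u) f g ξ = ∑ i ∈ s, osc (b i) f g ξ := by
  unfold osc kernelOp
  rw [← integral_finsetSum _ fun i hi =>
    integrable_kernelOp (hasTemperateGrowth_oscKernel (hb i hi)) f g ξ]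
  congr 1; ext z
  simp [oscKernel, Finset.mul_sum, Finset.sum_mul]

lemma osc_add {b c : X N × X N × X N → ℂ} (hb : b.HasTemperateGrowth) (hc : c.HasTemperateGrowth)
    (f g : 𝓢(Phase N, ℂ)) (ξ : Phase N) :
    osc (fun u => b u + c u) f g ξ = osc b f g ξ + osc c f g ξ := by
  unfold osc
  rw [← kernelOp_add_kernel _ (hasTemperateGrowth_oscKernel hb) (hasTemperateGrowth_oscKernel hc)]
  congr 1; ext z
  simp [oscKernel, mul_add]

variable {m : ℝ} {b : X N × X N × X N → ℂ}

/-- The relative positions `q - y`, `q - x` and the position `y`. -/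
def relPos (N : ℕ) : Fin 3 → (X N × X N × X N →L[ℝ] X N) :=
  ![ContinuousLinearMap.fst ℝ _ _ - (ContinuousLinearMap.snd ℝ _ _).comp
      (ContinuousLinearMap.snd ℝ _ _),
    ContinuousLinearMap.fst ℝ _ _ - (ContinuousLinearMap.fst ℝ _ _).comp
      (ContinuousLinearMap.snd ℝ _ _),
    (ContinuousLinearMap.snd ℝ _ _).comp (ContinuousLinearMap.snd ℝ _ _)]

lemma hasTemperateGrowth_inner_clm (L : X N × X N × X N →L[ℝ] X N) (e : X N) :
    Function.HasTemperateGrowth (fun u => ((⟪L u, e⟫_ℝ : ℝ) : ℂ)) :=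
  Function.Complex.hasTemperateGrowth_ofReal.comp
    ((Function.hasTemperateGrowth_inner_left e).comp L.hasTemperateGrowth)

lemma ofReal_one_add_norm_sq_mul (v : X N) (z : ℂ) : ((1 + ‖v‖ ^ 2 : ℝ) : ℂ) * z =
    z + ∑ j, ((⟪v, EuclideanSpace.single j 1⟫_ℝ : ℝ) : ℂ) *
      (((⟪v, EuclideanSpace.single j 1⟫_ℝ : ℝ) : ℂ) * z) := by
  have : ‖v‖ ^ 2 = ∑ j, ⟪v, EuclideanSpace.single j 1⟫_ℝ * ⟪v, EuclideanSpace.single j 1⟫_ℝ := by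
    rw [EuclideanSpace.norm_sq_eq]
    refine Finset.sum_congr rfl fun j _ => ?_
    rw [EuclideanSpace.inner_single_right]
    simp [sq]
  rw [this]
  push_cast
  rw [add_mul, one_mul, Finset.sum_mul]
  congr 1
  exact Finset.sum_congr rfl fun j _ => by ring

lemma hasTemperateGrowth_one_add_norm_sq (L : X N × X N × X N →L[ℝ] X N) :
    Function.HasTemperateGrowth (fun u => ((1 + ‖L u‖ ^ 2 : ℝ) : ℂ)) :=
  Function.Complex.hasTemperateGrowth_ofReal.comp
    ((Function.HasTemperateGrowth.const 1).add
      ((Function.hasTemperateGrowth_norm_sq (X N)).comp L.hasTemperateGrowth))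

/-- The quadratic factor is 1 plus a sum of squares of coordinates, so the rule for a single linear
factor is applied twice. -/
lemma bddBilin_osc_mul_sq_of_inner (hb : b.HasTemperateGrowth) (L : X N × X N × X N →L[ℝ] X N)
    (hU : BddBilin m (osc b))
    (h : ∀ (c : X N × X N × X N → ℂ), c.HasTemperateGrowth → ∀ e : X N, BddBilin m (osc c) →
      BddBilin m (osc fun u => ((⟪L u, e⟫_ℝ : ℝ) : ℂ) * c u)) :
    BddBilin m (osc fun u => ((1 + ‖L u‖ ^ 2 : ℝ) : ℂ) * b u) := by
  have ht : ∀ e : X N, Function.HasTemperateGrowth (fun u => ((⟪L u, e⟫_ℝ : ℝ) : ℂ) * b u) :=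
    fun e => (hasTemperateGrowth_inner_clm L e).mul hb
  have ht2 : ∀ e : X N, Function.HasTemperateGrowth
      (fun u => ((⟪L u, e⟫_ℝ : ℝ) : ℂ) * (((⟪L u, e⟫_ℝ : ℝ) : ℂ) * b u)) :=
    fun e => (hasTemperateGrowth_inner_clm L e).mul (ht e)
  have key := hU.add (BddBilin.sum Finset.univ fun (j : Fin N) _ =>
    h _ (ht (EuclideanSpace.single j 1)) (EuclideanSpace.single j 1) (h b hb _ hU))
  refine key.congr fun f g ξ => ?_
  rw [← osc_sum _ fun j _ => ht2 _, ← osc_add hb (.sum fun j _ => ht2 _)]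
  congr 1; ext u
  exact ofReal_one_add_norm_sq_mul _ _

lemma osc_mul_position_right (b : X N × X N × X N → ℂ) (e : X N) (f g : 𝓢(Phase N, ℂ)) (ξ : Phase N) :
    osc (fun u => ((⟪u.2.2, e⟫_ℝ : ℝ) : ℂ) * b u) f g ξ =
      osc b f (smulLeftCLM ℂ (fun ξ : Phase N => ((⟪ξ.1, e⟫_ℝ : ℝ) : ℂ)) g) ξ := by
  have ht : Function.HasTemperateGrowth (fun ξ : Phase N => ((⟪ξ.1, e⟫_ℝ : ℝ) : ℂ)) :=
    Function.Complex.hasTemperateGrowth_ofReal.comp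
      ((Function.hasTemperateGrowth_inner_left e).comp
        (ContinuousLinearMap.fst ℝ (X N) (X N)).hasTemperateGrowth)
  unfold osc kernelOp
  congr 1; ext z
  rw [smulLeftCLM_apply_apply ht]
  simp [oscKernel]
  ring

/-- The three cases q - y, q - x and y cost, respectively, a derivative of f, a derivative of g and
a multiplier of g. The weight index m is preserved in all of them. -/
lemma bddBilin_osc_mul_relPos (hb : b.HasTemperateGrowth) (i : Fin 3) (hU : BddBilin m (osc b)) :
    BddBilin m (osc fun u => ((1 + ‖relPos N i u‖ ^ 2 : ℝ) : ℂ) * b u) := by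
  refine bddBilin_osc_mul_sq_of_inner hb _ hU fun c hc e hcU => ?_
  fin_cases i
  · exact ((hcU.comp_lineDeriv ((0, e) : Phase N)).const_mul (Complex.I / 2)).congr
      fun f g ξ => osc_mul_left hc f g ξ e
  · exact ((hcU.comp_lineDeriv_right ((0, e) : Phase N)).const_mul (-(Complex.I / 2))).congr
      fun f g ξ => osc_mul_right hc f g ξ e
  · exact (hcU.comp_right _).congr fun f g ξ => osc_mul_position_right c e f g ξ

/-- The exponential has modulus 1, so the operator is bounded by C times the product of the L^1
norms; that of g is a continuous seminorm on 𝓢. -/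
lemma bddBilin_osc_of_bounded {C : ℝ} (hC : 0 ≤ C)
    (h : ∀ u, ‖b u‖ ≤ C) : BddBilin 0 (osc b) := by
  set μ := phaseMeasure N with hμ
  refine ⟨0, C.toNNReal • (normSeminorm ℂ (Lp ℂ 1 μ)).comp
    (SchwartzMap.toLpCLM ℂ ℂ 1 μ).toLinearMap,
    continuous_real_smul_seminorm ?_ _, fun f g ξ => ?_⟩
  · exact continuous_norm.comp (SchwartzMap.toLpCLM ℂ ℂ 1 μ).continuous
  have h1 : (C.toNNReal • (normSeminorm ℂ (Lp ℂ 1 μ)).comp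
      (SchwartzMap.toLpCLM ℂ ℂ 1 μ).toLinearMap) g = C * ∫ ξ, ‖g ξ‖ ∂μ := by
    change (C.toNNReal : ℝ) * ‖g.toLp 1 μ‖ = _
    rw [Real.coe_toNNReal C hC, norm_toLp_one]
  have h2 : R0.norms N 0 0 (toR0 0 f) = ∫ ξ, ‖f ξ‖ ∂μ := by
    rw [R0.norms_apply]
    simp [toR0_toFun, hμ]
  rw [h1, h2]
  unfold osc kernelOp
  calc ‖∫ z : Phase N × Phase N, oscKernel b (ξ, z) * f z.1 * g z.2 ∂(μ.prod μ)‖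
      ≤ ∫ z : Phase N × Phase N, C * (‖f z.1‖ * ‖g z.2‖) ∂(μ.prod μ) := by
        refine norm_integral_le_of_norm_le
          (((f.integrable (μ := μ)).norm.mul_prod (g.integrable (μ := μ)).norm).const_mul C)
          (Filter.Eventually.of_forall fun z => ?_)
        rw [norm_mul, norm_mul, mul_assoc]
        gcongr
        rw [oscKernel, norm_mul]
        have : ‖Complex.exp (-Complex.I * (moyalPhase (ξ, z) : ℂ))‖ = 1 := by
          rw [show -Complex.I * (moyalPhase (ξ, z) : ℂ) =
            ((-moyalPhase (ξ, z) : ℝ) : ℂ) * Complex.I by push_cast; ring,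
            Complex.norm_exp_ofReal_mul_I]
        rw [this, one_mul]
        exact h _
    _ = _ := by
      rw [integral_const_mul, integral_prod_mul (fun x => ‖f x‖) (fun x => ‖g x‖)]
      ring

/-- All three positions are recovered from q - y, q - x and y. The constant 8 comes from 1 + t ≤ 2(1
+ t²), used once for each of them. -/
lemma one_add_norm_le_relPos (u : X N × X N × X N) : 1 + ‖u‖ ≤
    8 * ((1 + ‖relPos N 0 u‖ ^ 2) * ((1 + ‖relPos N 1 u‖ ^ 2) * (1 + ‖relPos N 2 u‖ ^ 2))) := by
  obtain ⟨q, x, y⟩ := u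
  have e0 : relPos N 0 (q, x, y) = q - y := rfl
  have e1 : relPos N 1 (q, x, y) = q - x := rfl
  have e2 : relPos N 2 (q, x, y) = y := rfl
  rw [e0, e1, e2]
  have hq : ‖q‖ ≤ ‖q - y‖ + ‖y‖ := by simpa using norm_add_le (q - y) y
  have hx : ‖x‖ ≤ ‖q - y‖ + ‖q - x‖ + ‖y‖ := by
    have := norm_sub_le q (q - x)
    rw [sub_sub_cancel] at this
    linarith
  have hu : ‖(q, x, y)‖ ≤ ‖q - y‖ + ‖q - x‖ + ‖y‖ := by
    rw [Prod.norm_def, Prod.norm_def]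
    exact max_le (by simp only; linarith [norm_nonneg (q - x)])
      (max_le hx (by simp only; linarith [norm_nonneg (q - x), norm_nonneg (q - y)]))
  have key : ∀ t : ℝ, 0 ≤ t → 1 + t ≤ 2 * (1 + t ^ 2) := fun t _ => by nlinarith [sq_nonneg (t - 1)]
  have a0 := norm_nonneg (q - y)
  have a1 := norm_nonneg (q - x)
  have a2 := norm_nonneg y
  calc 1 + ‖(q, x, y)‖ ≤ (1 + ‖q - y‖) * ((1 + ‖q - x‖) * (1 + ‖y‖)) := by
        nlinarith [mul_nonneg a0 a1, mul_nonneg a0 a2, mul_nonneg a1 a2,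
          mul_nonneg a0 (mul_nonneg a1 a2)]
    _ ≤ (2 * (1 + ‖q - y‖ ^ 2)) * ((2 * (1 + ‖q - x‖ ^ 2)) * (2 * (1 + ‖y‖ ^ 2))) := by
        gcongr
        · exact key _ a0
        · exact key _ a1
        · exact key _ a2
    _ = _ := by ring

/-- The product of the weights of the relative positions. -/
def relWeight (u : X N × X N × X N) : ℝ :=
  (1 + ‖relPos N 0 u‖ ^ 2) * ((1 + ‖relPos N 1 u‖ ^ 2) * (1 + ‖relPos N 2 u‖ ^ 2))

lemma relWeight_pos (u : X N × X N × X N) : 0 < relWeight u := by unfold relWeight; positivity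

lemma hasTemperateGrowth_relWeight_inv :
    Function.HasTemperateGrowth (fun u : X N × X N × X N => (((relWeight u)⁻¹ : ℝ) : ℂ)) := by
  have h : ∀ i, Function.HasTemperateGrowth
      (fun u : X N × X N × X N => (1 + ‖relPos N i u‖ ^ 2) ^ (-1 : ℝ)) := fun i =>
    (Function.hasTemperateGrowth_one_add_norm_sq_rpow (X N) (-1)).comp
      (relPos N i).hasTemperateGrowth
  have e : (fun u : X N × X N × X N => (relWeight u)⁻¹) = fun u =>
      (1 + ‖relPos N 0 u‖ ^ 2) ^ (-1 : ℝ) * ((1 + ‖relPos N 1 u‖ ^ 2) ^ (-1 : ℝ) *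
        (1 + ‖relPos N 2 u‖ ^ 2) ^ (-1 : ℝ)) := by
    ext u
    simp only [relWeight, Real.rpow_neg_one, mul_inv]
  refine Function.Complex.hasTemperateGrowth_ofReal.comp (f := fun u => (relWeight u)⁻¹) ?_
  rw [e]
  exact (h 0).mul ((h 1).mul (h 2))

lemma hasTemperateGrowth_relWeight :
    Function.HasTemperateGrowth (fun u : X N × X N × X N => ((relWeight u : ℝ) : ℂ)) := by
  have e : (fun u : X N × X N × X N => ((relWeight u : ℝ) : ℂ)) = fun u =>
      ((1 + ‖relPos N 0 u‖ ^ 2 : ℝ) : ℂ) * (((1 + ‖relPos N 1 u‖ ^ 2 : ℝ) : ℂ) *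
        ((1 + ‖relPos N 2 u‖ ^ 2 : ℝ) : ℂ)) := by
    ext u; simp [relWeight]
  rw [e]
  exact (hasTemperateGrowth_one_add_norm_sq _).mul
    ((hasTemperateGrowth_one_add_norm_sq _).mul (hasTemperateGrowth_one_add_norm_sq _))

lemma bddBilin_osc_mul_relWeight (hb : b.HasTemperateGrowth) (hU : BddBilin m (osc b)) :
    BddBilin m (osc fun u => ((relWeight u : ℝ) : ℂ) * b u) := by
  have h2 := bddBilin_osc_mul_relPos hb 2 hU
  have t2 := (hasTemperateGrowth_one_add_norm_sq (relPos N 2)).mul hb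
  have h1 := bddBilin_osc_mul_relPos t2 1 h2
  have t1 := (hasTemperateGrowth_one_add_norm_sq (relPos N 1)).mul t2
  have h0 := bddBilin_osc_mul_relPos t1 0 h1
  refine h0.congr fun f g ξ => ?_
  congr 1; ext u
  simp [relWeight]
  ring

lemma bddBilin_osc_mul_relWeight_pow (hb : b.HasTemperateGrowth) (hU : BddBilin m (osc b)) (k : ℕ) :
    BddBilin m (osc fun u => ((relWeight u : ℝ) : ℂ) ^ k * b u) := by
  induction k with
  | zero => simpa using hU
  | succ k ih =>
    refine (bddBilin_osc_mul_relWeight ((hasTemperateGrowth_relWeight.pow k).mul hb) ih).congr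
      fun f g ξ => ?_
    congr 1; ext u
    simp [pow_succ]
    ring

/-- Dividing b by a power of `relWeight` makes it bounded; the weight is then multiplied back by
integration by parts. -/
lemma bddBilin_zero_osc (hb : b.HasTemperateGrowth) : BddBilin 0 (osc b) := by
  obtain ⟨k, C, hC, h⟩ := HasTemperateGrowth.bound hb
  set b' : X N × X N × X N → ℂ := fun u => (((relWeight u)⁻¹ : ℝ) : ℂ) ^ k * b u with hb'
  have hbt : b'.HasTemperateGrowth := (hasTemperateGrowth_relWeight_inv.pow k).mul hb
  have hbd : ∀ u, ‖b' u‖ ≤ C * 8 ^ k := by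
    intro u
    have hw := relWeight_pos u
    have h1 : ‖(((relWeight u)⁻¹ : ℝ) : ℂ)‖ = (relWeight u)⁻¹ := by
      rw [Complex.norm_real, Real.norm_of_nonneg (inv_nonneg.2 hw.le)]
    rw [hb', norm_mul, norm_pow, h1]
    calc (relWeight u)⁻¹ ^ k * ‖b u‖ ≤ (relWeight u)⁻¹ ^ k * (C * (8 * relWeight u) ^ k) := by
          gcongr
          refine (h u).trans ?_
          gcongr
          exact one_add_norm_le_relPos u
      _ = C * 8 ^ k := by rw [mul_pow, inv_pow]; field_simp
  refine (bddBilin_osc_mul_relWeight_pow hbt (bddBilin_osc_of_bounded (by positivity) hbd)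
    k).congr fun f g ξ => ?_
  congr 1; ext u
  have hw : ((relWeight u : ℝ) : ℂ) ≠ 0 := by exact_mod_cast (relWeight_pos u).ne'
  simp only [hb']
  push_cast
  rw [← mul_assoc, ← mul_pow, mul_inv_cancel₀ hw, one_pow, one_mul]

end Amplitudes

/-! ### Polynomial weights on the first argument. -/

section Weights

lemma lineDeriv_mulMomentum (e e' : X N) (f : 𝓢(Phase N, ℂ)) :
    ∂_{((e', 0) : Phase N)} (mulMomentum e f) = mulMomentum e (∂_{((e', 0) : Phase N)} f) := by
  ext ξ
  have h1 : HasFDerivAt (fun ξ : Phase N => ((⟪ξ.2, e⟫_ℝ : ℝ) : ℂ)) _ ξ :=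
    Complex.ofRealCLM.hasFDerivAt.comp ξ
      ((hasFDerivAt_snd (𝕜 := ℝ) (p := ξ)).inner ℝ (hasFDerivAt_const e ξ))
  have h2 := h1.mul (f.hasFDerivAt ξ)
  have h3 : ⇑(mulMomentum e f) = (fun ξ : Phase N => ((⟪ξ.2, e⟫_ℝ : ℝ) : ℂ)) * f :=
    funext (mulMomentum_apply e f)
  rw [mulMomentum_apply, lineDerivOp_apply_eq_fderiv, lineDerivOp_apply_eq_fderiv, h3, h2.fderiv]
  simp

/-- The momentum of f is replaced by p and then by that of g. The operator K lets the step be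
iterated; it must commute with the position derivative that integration by parts puts on K f. -/
lemma bddBilin_osc_mulMomentum {m : ℝ} (K : 𝓢(Phase N, ℂ) → 𝓢(Phase N, ℂ))
    (hK : ∀ b : X N × X N × X N → ℂ, b.HasTemperateGrowth → BddBilin m fun f g => osc b (K f) g)
    (e : X N) (hc : ∀ f, ∂_{((e, 0) : Phase N)} (K f) = K (∂_{((e, 0) : Phase N)} f))
    (b : X N × X N × X N → ℂ) (hb : b.HasTemperateGrowth) :
    BddBilin m fun f g => osc b (mulMomentum e (K f)) g := by
  have h1 := (hK b hb).comp_right (mulMomentum e)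
  have h2 := hK _ (temperate_fderiv_apply hb (0, e, 0))
  have h3 := (hK b hb).comp_lineDeriv ((e, 0) : Phase N)
  have h4 := hK _ (temperate_fderiv_apply hb (0, 0, e))
  have h5 := (hK b hb).comp_lineDeriv_right ((e, 0) : Phase N)
  refine (h1.add (((h2.add h3).add (h4.add h5)).const_mul (-(Complex.I / 2)))).congr
    fun f g ξ => ?_
  rw [osc_mulMomentum_left hb, momentum_mul_osc hb, hc]
  ring

/-- Write f as the weight 1 + |x|² + |k|² times `divBracketSq f`, which gains two powers. The part 1
+ |x|² changes the amplitude, so the hypothesis is needed for all amplitudes; |k|² is two momentum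
multiplications per coordinate. -/
lemma bddBilin_osc_add_two {m : ℝ}
    (h : ∀ b : X N × X N × X N → ℂ, b.HasTemperateGrowth → BddBilin m (osc b))
    (b : X N × X N × X N → ℂ) (hb : b.HasTemperateGrowth) : BddBilin (m + 2) (osc b) := by
  set L : X N × X N × X N →L[ℝ] X N :=
    (ContinuousLinearMap.fst ℝ _ _).comp (ContinuousLinearMap.snd ℝ _ _) with hL
  have ht : Function.HasTemperateGrowth fun u => ((1 + ‖L u‖ ^ 2 : ℝ) : ℂ) * b u :=
    (hasTemperateGrowth_one_add_norm_sq L).mul hb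
  have h1 := h _ ht
  have h2 : ∀ j : Fin N, BddBilin m fun f g => osc b (mulMomentum (EuclideanSpace.single j 1)
      (mulMomentum (EuclideanSpace.single j 1) f)) g := fun j =>
    -- Used first with K the identity, then with K the momentum multiplication just obtained.
    bddBilin_osc_mulMomentum _ (bddBilin_osc_mulMomentum id h _ fun _ => rfl) _
      (fun f => lineDeriv_mulMomentum _ _ f) b hb
  have h3 := h1.add (BddBilin.sum Finset.univ fun j _ => h2 j)
  refine (h3.comp_left (m' := m + 2) divBracketSq fun n => ⟨n, exists_norms_divBracketSq_le m n⟩).congr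
    fun f g ξ => ?_
  have i1 := integrable_kernelOp (μ := phaseMeasure N) (hasTemperateGrowth_oscKernel ht)
    (divBracketSq f) g ξ
  have i2 := fun j : Fin N => integrable_kernelOp (μ := phaseMeasure N)
    (hasTemperateGrowth_oscKernel hb) (mulMomentum (EuclideanSpace.single j 1)
      (mulMomentum (EuclideanSpace.single j 1) (divBracketSq f))) g ξ
  unfold osc kernelOp
  rw [← integral_finsetSum _ fun j _ => i2 j, ← integral_add i1 (integrable_finsetSum _ fun j _ => i2 j)]
  congr 1; ext z
  simp only [mulMomentum_apply, divBracketSq_apply, oscKernel]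
  have e1 := ofReal_one_add_norm_sq_mul z.1.2 ((bracketSq z.1)⁻¹ • f z.1)
  have e2 : f z.1 = ((bracketSq z.1 : ℝ) : ℂ) * ((bracketSq z.1)⁻¹ • f z.1) := by
    have := (bracketSq_pos z.1).ne'
    rw [Complex.real_smul]
    push_cast
    rw [mul_inv_cancel_left₀]
    exact_mod_cast this
  have e3 : L (positions N (ξ, z)) = z.1.1 := rfl
  rw [e3, ← Finset.sum_mul, ← Finset.mul_sum, ← sub_eq_iff_eq_add'.2 e1]
  conv_lhs => rw [e2]
  rw [bracketSq]
  push_cast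
  ring

/-- Even indices 2k by induction; a general m lies below one of them. -/
lemma bddBilin_osc (m : ℝ) (b : X N × X N × X N → ℂ) (hb : b.HasTemperateGrowth) :
    BddBilin m (osc b) := by
  have key : ∀ k : ℕ, ∀ b : X N × X N × X N → ℂ, b.HasTemperateGrowth →
      BddBilin (2 * k : ℝ) (osc b) := by
    intro k
    induction k with
    | zero => intro b hb; simpa using bddBilin_zero_osc hb
    | succ k ih =>
      intro b hb
      have := bddBilin_osc_add_two ih b hb
      convert this using 1
      push_cast
      ring
  obtain ⟨k, hk⟩ := exists_nat_ge m
  refine (key k b hb).mono (hk.trans ?_)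
  have : (0 : ℝ) ≤ k := k.cast_nonneg
  linarith

end Weights

end MagneticMoyal

/-! ### From uniform bounds to Schwartz seminorms. -/

namespace MagneticMoyal

open scoped LineDeriv InnerProductSpace

variable {N : ℕ}

/-- The bilinear maps generated by the oscillatory integral operators, derivatives of the first
argument and continuous endomorphisms of the second one. -/
inductive OscSpan : (𝓢(Phase N, ℂ) → 𝓢(Phase N, ℂ) → Phase N → ℂ) → Prop
  | base (b : X N × X N × X N → ℂ) (hb : b.HasTemperateGrowth) : OscSpan (osc b)
  | add {U W : 𝓢(Phase N, ℂ) → 𝓢(Phase N, ℂ) → Phase N → ℂ} (hU : OscSpan U) (hW : OscSpan W) :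
      OscSpan (fun f g ξ => U f g ξ + W f g ξ)
  | const_mul (c : ℂ) {U : 𝓢(Phase N, ℂ) → 𝓢(Phase N, ℂ) → Phase N → ℂ} (hU : OscSpan U) :
      OscSpan (fun f g ξ => c * U f g ξ)
  | left (w : Phase N) {U : 𝓢(Phase N, ℂ) → 𝓢(Phase N, ℂ) → Phase N → ℂ} (hU : OscSpan U) :
      OscSpan (fun f g ξ => U (∂_{w} f) g ξ)
  | right (L : 𝓢(Phase N, ℂ) →L[ℂ] 𝓢(Phase N, ℂ))
      {U : 𝓢(Phase N, ℂ) → 𝓢(Phase N, ℂ) → Phase N → ℂ} (hU : OscSpan U) :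
      OscSpan (fun f g ξ => U f (L g) ξ)

namespace OscSpan

variable {U : 𝓢(Phase N, ℂ) → 𝓢(Phase N, ℂ) → Phase N → ℂ}

lemma bddBilin (m : ℝ) (hU : OscSpan U) : BddBilin m U := by
  induction hU with
  | base b hb => exact bddBilin_osc m b hb
  | add _ _ h1 h2 => exact h1.add h2
  | const_mul c _ h => exact h.const_mul c
  | left w _ h => exact h.comp_lineDeriv w
  | right L _ h => exact h.comp_right L

lemma differentiable (hU : OscSpan U) (f g : 𝓢(Phase N, ℂ)) : Differentiable ℝ (U f g) := by
  induction hU generalizing f g with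
  | base b hb => exact differentiable_osc hb f g
  | add _ _ h1 h2 => exact (h1 f g).add (h2 f g)
  | const_mul c _ h => exact (h f g).const_mul c
  | left w _ h => exact h _ g
  | right L _ h => exact h f _

lemma exists_fderiv (w : Phase N) (hU : OscSpan U) :
    ∃ W, OscSpan W ∧ ∀ f g ξ, fderiv ℝ (U f g) ξ w = W f g ξ := by
  induction hU with
  | base b hb =>
    exact ⟨_, ((base _ (temperate_fderiv_apply hb (w.1, w.1, w.1))).add
      (left w (base b hb))).add (right (LineDeriv.lineDerivOpCLM ℂ 𝓢(Phase N, ℂ) w) (base b hb)),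
      fun f g ξ => fderiv_osc hb f g ξ w⟩
  | @add U W hU hW h1 h2 =>
    obtain ⟨U', hU', e1⟩ := h1
    obtain ⟨W', hW', e2⟩ := h2
    refine ⟨_, hU'.add hW', fun f g ξ => ?_⟩
    rw [← e1, ← e2, fderiv_fun_add (hU.differentiable f g ξ) (hW.differentiable f g ξ)]
    rfl
  | @const_mul c U hU h =>
    obtain ⟨U', hU', e⟩ := h
    refine ⟨_, hU'.const_mul c, fun f g ξ => ?_⟩
    rw [← e, fderiv_const_mul (hU.differentiable f g ξ)]
    rfl
  | left w _ h =>
    obtain ⟨U', hU', e⟩ := h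
    exact ⟨_, hU'.left w, fun f g ξ => e _ g ξ⟩
  | right L _ h =>
    obtain ⟨U', hU', e⟩ := h
    exact ⟨_, hU'.right L, fun f g ξ => e f _ ξ⟩

/-- The position part is absorbed by the amplitude, the momentum part by `momentum_mul_osc`. -/
lemma exists_inner_mul (e : Phase N) (hU : OscSpan U) :
    ∃ W, OscSpan W ∧ ∀ f g ξ, ((⟪ξ.1, e.1⟫_ℝ + ⟪ξ.2, e.2⟫_ℝ : ℝ) : ℂ) * U f g ξ = W f g ξ := by
  induction hU with
  | base b hb =>
    refine ⟨_, (base (fun u => ((⟪u.1, e.1⟫_ℝ : ℝ) : ℂ) * b u) ((hasTemperateGrowth_inner_clm (ContinuousLinearMap.fst ℝ _ _) e.1).mul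
      hb)).add ((right (mulMomentum e.2) (base b hb)).add
        (((base _ (temperate_fderiv_apply hb (0, e.2, 0))).add
          (left ((e.2, 0) : Phase N) (base b hb))).const_mul (-(Complex.I / 2)))), fun f g ξ => ?_⟩
    have h1 : ((⟪ξ.1, e.1⟫_ℝ : ℝ) : ℂ) * osc b f g ξ =
        osc (fun u => ((⟪u.1, e.1⟫_ℝ : ℝ) : ℂ) * b u) f g ξ := by
      unfold osc kernelOp
      rw [← integral_const_mul]
      congr 1; ext z
      simp [oscKernel]
      ring
    have h2 := momentum_mul_osc hb f g ξ e.2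
    push_cast
    rw [add_mul, h1, h2]
    ring
  | add _ _ h1 h2 =>
    obtain ⟨U', hU', e1⟩ := h1
    obtain ⟨W', hW', e2⟩ := h2
    exact ⟨_, hU'.add hW', fun f g ξ => by rw [← e1, ← e2, mul_add]⟩
  | const_mul c _ h =>
    obtain ⟨U', hU', e⟩ := h
    exact ⟨_, hU'.const_mul c, fun f g ξ => by rw [← e]; ring⟩
  | left w _ h =>
    obtain ⟨U', hU', e⟩ := h
    exact ⟨_, hU'.left w, fun f g ξ => e _ g ξ⟩
  | right L _ h =>
    obtain ⟨U', hU', e⟩ := h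
    exact ⟨_, hU'.right L, fun f g ξ => e f _ ξ⟩

/-- A basis of phase space. -/
def phaseBasis (N : ℕ) : Module.Basis (Fin N ⊕ Fin N) ℝ (Phase N) :=
  (EuclideanSpace.basisFun (Fin N) ℝ).toBasis.prod (EuclideanSpace.basisFun (Fin N) ℝ).toBasis

lemma norm_le_sum_coord (ξ : Phase N) : ‖ξ‖ ≤ ∑ j : Fin N,
    (|⟪ξ.1, EuclideanSpace.single j 1⟫_ℝ + ⟪ξ.2, (0 : X N)⟫_ℝ|
      + |⟪ξ.1, (0 : X N)⟫_ℝ + ⟪ξ.2, EuclideanSpace.single j 1⟫_ℝ|) := by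
  have key : ∀ v : X N, ‖v‖ ≤ ∑ j : Fin N, |⟪v, EuclideanSpace.single j 1⟫_ℝ| := by
    intro v
    have h := (EuclideanSpace.basisFun (Fin N) ℝ).sum_repr v
    conv_lhs => rw [← h]
    refine (norm_sum_le _ _).trans (Finset.sum_le_sum fun j _ => ?_)
    rw [norm_smul, EuclideanSpace.inner_single_right]
    simp
  rw [Finset.sum_add_distrib]
  simp only [inner_zero_right, add_zero, zero_add]
  have h1 := key ξ.1
  have h2 := key ξ.2
  have p1 : 0 ≤ ∑ j : Fin N, |⟪ξ.1, EuclideanSpace.single j 1⟫_ℝ| :=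
    Finset.sum_nonneg fun _ _ => abs_nonneg _
  have p2 : 0 ≤ ∑ j : Fin N, |⟪ξ.2, EuclideanSpace.single j 1⟫_ℝ| :=
    Finset.sum_nonneg fun _ _ => abs_nonneg _
  rw [Prod.norm_def]
  exact max_le (by linarith) (by linarith)

/-- One factor ‖ξ‖ is at most the sum of the absolute coordinates, and each coordinate multiple
stays in the span; hence induction on k with U varying. -/
lemma bddBilin_norm_pow_mul (m : ℝ) (k : ℕ) (hU : OscSpan U) :
    BddBilin m (fun f g ξ => ((‖ξ‖ ^ k * ‖U f g ξ‖ : ℝ) : ℂ)) := by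
  induction k generalizing U with
  | zero =>
    obtain ⟨n, q, hq, hb⟩ := hU.bddBilin m
    exact ⟨n, q, hq, fun f g ξ => by simpa using hb f g ξ⟩
  | succ k ih =>
    choose W1 hW1 e1 using fun j : Fin N => hU.exists_inner_mul (EuclideanSpace.single j 1, 0)
    choose W2 hW2 e2 using fun j : Fin N => hU.exists_inner_mul (0, EuclideanSpace.single j 1)
    obtain ⟨n, q, hq, hb⟩ := BddBilin.sum Finset.univ fun j _ => (ih (hW1 j)).add (ih (hW2 j))
    refine ⟨n, q, hq, fun f g ξ => le_trans ?_ (hb f g ξ)⟩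
    have hnn : 0 ≤ ∑ j, (‖ξ‖ ^ k * ‖W1 j f g ξ‖ + ‖ξ‖ ^ k * ‖W2 j f g ξ‖) :=
      Finset.sum_nonneg fun _ _ => by positivity
    have h3 : ‖∑ j, (((‖ξ‖ ^ k * ‖W1 j f g ξ‖ : ℝ) : ℂ) + ((‖ξ‖ ^ k * ‖W2 j f g ξ‖ : ℝ) : ℂ))‖ =
        ∑ j, (‖ξ‖ ^ k * ‖W1 j f g ξ‖ + ‖ξ‖ ^ k * ‖W2 j f g ξ‖) := by
      rw [← Real.norm_of_nonneg hnn, ← Complex.norm_real]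
      push_cast
      rfl
    rw [h3, Complex.norm_real, Real.norm_of_nonneg (by positivity), pow_succ, mul_assoc]
    calc ‖ξ‖ ^ k * (‖ξ‖ * ‖U f g ξ‖) ≤ ‖ξ‖ ^ k * ((∑ j : Fin N,
          (|⟪ξ.1, EuclideanSpace.single j 1⟫_ℝ + ⟪ξ.2, (0 : X N)⟫_ℝ|
          + |⟪ξ.1, (0 : X N)⟫_ℝ + ⟪ξ.2, EuclideanSpace.single j 1⟫_ℝ|)) * ‖U f g ξ‖) := by
          gcongr
          exact norm_le_sum_coord ξ
      _ = _ := by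
        rw [Finset.sum_mul, Finset.mul_sum]
        refine Finset.sum_congr rfl fun j _ => ?_
        rw [← e1, ← e2, norm_mul, norm_mul, Complex.norm_real, Complex.norm_real, Real.norm_eq_abs,
          Real.norm_eq_abs]
        ring

/-- Writes the full derivative through the basis directions with scalar coefficients in the span, so
that higher derivatives can be treated by induction. -/
lemma fderiv_eq_sum (hU : OscSpan U) :
    ∃ (W : Fin N ⊕ Fin N → 𝓢(Phase N, ℂ) → 𝓢(Phase N, ℂ) → Phase N → ℂ)
      (L : Fin N ⊕ Fin N → (ℂ →L[ℝ] (Phase N →L[ℝ] ℂ))), (∀ i, OscSpan (W i)) ∧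
      ∀ f g, fderiv ℝ (U f g) = fun ξ => ∑ i, L i (W i f g ξ) := by
  choose W hW e using fun i => hU.exists_fderiv (phaseBasis N i)
  refine ⟨W, fun i => ContinuousLinearMap.smulRightL ℝ (Phase N) ℂ
    (LinearMap.toContinuousLinearMap ((phaseBasis N).coord i)), hW, fun f g => ?_⟩
  ext ξ : 1
  refine ContinuousLinearMap.coe_injective ((phaseBasis N).ext fun i => ?_)
  simp only [ContinuousLinearMap.coe_coe, e]
  rcases i with i | i <;> simp [Finsupp.single_apply]

lemma contDiff_nat (n : ℕ) (hU : OscSpan U) (f g : 𝓢(Phase N, ℂ)) : ContDiff ℝ n (U f g) := by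
  induction n generalizing U with
  | zero => exact contDiff_zero.2 (hU.differentiable f g).continuous
  | succ n ih =>
    obtain ⟨W, L, hW, e⟩ := hU.fderiv_eq_sum
    rw [show ((n + 1 : ℕ) : WithTop ℕ∞) = (n : WithTop ℕ∞) + 1 by norm_cast,
      contDiff_succ_iff_fderiv]
    refine ⟨hU.differentiable f g, by simp, ?_⟩
    rw [e]
    exact ContDiff.sum fun i _ => (L i).contDiff.comp (ih (hW i))

lemma contDiff (hU : OscSpan U) (f g : 𝓢(Phase N, ℂ)) : ContDiff ℝ ∞ (U f g) :=
  contDiff_infty.2 fun n => hU.contDiff_nat n f g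

lemma bddBilin_iteratedFDeriv (m : ℝ) (k n : ℕ) (hU : OscSpan U) :
    BddBilin m (fun f g ξ => ((‖ξ‖ ^ k * ‖iteratedFDeriv ℝ n (U f g) ξ‖ : ℝ) : ℂ)) := by
  induction n generalizing U with
  | zero => simpa only [norm_iteratedFDeriv_zero] using hU.bddBilin_norm_pow_mul m k
  | succ n ih =>
    obtain ⟨W, L, hW, e⟩ := hU.fderiv_eq_sum
    obtain ⟨p, q, hq, hb⟩ := BddBilin.sum Finset.univ fun i _ => (ih (hW i)).const_mul (‖L i‖ : ℂ)
    refine ⟨p, q, hq, fun f g ξ => le_trans ?_ (hb f g ξ)⟩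
    have hnn : 0 ≤ ∑ i, ‖L i‖ * (‖ξ‖ ^ k * ‖iteratedFDeriv ℝ n (W i f g) ξ‖) :=
      Finset.sum_nonneg fun _ _ => by positivity
    have h3 : ‖∑ i, (‖L i‖ : ℂ) * ((‖ξ‖ ^ k * ‖iteratedFDeriv ℝ n (W i f g) ξ‖ : ℝ) : ℂ)‖ =
        ∑ i, ‖L i‖ * (‖ξ‖ ^ k * ‖iteratedFDeriv ℝ n (W i f g) ξ‖) := by
      rw [← Real.norm_of_nonneg hnn, ← Complex.norm_real]
      push_cast
      rfl
    rw [h3, Complex.norm_real, Real.norm_of_nonneg (by positivity), ← norm_iteratedFDeriv_fderiv, e,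
      iteratedFDeriv_fun_sum_apply (f := fun i ξ => L i (W i f g ξ)) fun i _ =>
        ((L i).contDiff.comp ((hW i).contDiff_nat n f g)).contDiffAt]
    calc ‖ξ‖ ^ k * ‖∑ i, iteratedFDeriv ℝ n (fun ξ => L i (W i f g ξ)) ξ‖
        ≤ ‖ξ‖ ^ k * ∑ i, ‖L i‖ * ‖iteratedFDeriv ℝ n (W i f g) ξ‖ := by
          gcongr
          refine (norm_sum_le _ _).trans (Finset.sum_le_sum fun i _ => ?_)
          exact (L i).norm_iteratedFDeriv_comp_left ((hW i).contDiff_nat n f g).contDiffAt le_rfl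
      _ = _ := by
        rw [Finset.mul_sum]
        exact Finset.sum_congr rfl fun i _ => by ring

/-- The values of the bilinear maps in `OscSpan` are Schwartz functions. -/
def toSchwartz (hU : OscSpan U) (f g : 𝓢(Phase N, ℂ)) : 𝓢(Phase N, ℂ) where
  toFun := U f g
  smooth' := hU.contDiff f g
  decay' k n := by
    obtain ⟨p, q, -, hb⟩ := hU.bddBilin_iteratedFDeriv 0 k n
    refine ⟨R0.norms N 0 p (toR0 0 f) * q g, fun ξ => ?_⟩
    have h := hb f g ξ
    rw [Complex.norm_real, Real.norm_of_nonneg (by positivity)] at h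
    exact h

lemma toSchwartz_apply (hU : OscSpan U) (f g : 𝓢(Phase N, ℂ)) (ξ : Phase N) :
    hU.toSchwartz f g ξ = U f g ξ := rfl

lemma seminorm_toSchwartz_le (m : ℝ) (k n : ℕ) (hU : OscSpan U) :
    ∃ (p : ℕ) (q : Seminorm ℂ 𝓢(Phase N, ℂ)), Continuous q ∧ ∀ f g,
      SchwartzMap.seminorm ℂ k n (hU.toSchwartz f g) ≤ R0.norms N m p (toR0 m f) * q g := by
  obtain ⟨p, q, hq, hb⟩ := hU.bddBilin_iteratedFDeriv m k n
  refine ⟨p, q, hq, fun f g => ?_⟩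
  refine SchwartzMap.seminorm_le_bound ℂ k n _ (mul_nonneg (apply_nonneg _ _) (apply_nonneg _ _))
    fun ξ => ?_
  have h := hb f g ξ
  rwa [Complex.norm_real, Real.norm_of_nonneg (by positivity)] at h

end OscSpan

end MagneticMoyal

/-! ### Integrals depending on a parameter. -/

namespace MagneticMoyal

section ParametricIntegral

variable {E : Type} [NormedAddCommGroup E] [NormedSpace ℝ E]

lemma hasFDerivAt_integral_zero_one {F : Type} [NormedAddCommGroup F] [NormedSpace ℝ F]
    {φ : E × ℝ → F} (hφ : φ.HasTemperateGrowth) (x : E) :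
    HasFDerivAt (fun x => ∫ t in (0 : ℝ)..1, φ (x, t))
      (∫ t in (0 : ℝ)..1, (fderiv ℝ φ (x, t)).comp (ContinuousLinearMap.inl ℝ E ℝ)) x := by
  have hc := hφ.1.continuous
  obtain ⟨k, C, hC, h⟩ := HasTemperateGrowth.bound (temperate_fderiv hφ)
  have hc' : Continuous (fderiv ℝ φ) := (temperate_fderiv hφ).1.continuous
  have hcF' : Continuous fun t : ℝ => (fderiv ℝ φ (x, t)).comp (ContinuousLinearMap.inl ℝ E ℝ) :=
    ((ContinuousLinearMap.compL ℝ E (E × ℝ) F).flip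
      (ContinuousLinearMap.inl ℝ E ℝ)).continuous.comp (hc'.comp (f := fun t => (x, t)) (by fun_prop))
  refine intervalIntegral.hasFDerivAt_integral_of_dominated_of_fderiv_le
    (F' := fun x t => (fderiv ℝ φ (x, t)).comp (ContinuousLinearMap.inl ℝ E ℝ))
    (bound := fun _ => C * (3 + ‖x‖) ^ k)
    (Metric.ball_mem_nhds x one_pos)
    (Filter.Eventually.of_forall fun y =>
      (hc.comp (f := fun t => (y, t)) (by fun_prop)).aestronglyMeasurable)
    ((hc.comp (f := fun t => (x, t)) (by fun_prop)).intervalIntegrable 0 1)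
    hcF'.aestronglyMeasurable ?_ (by simp) ?_
  · refine Filter.Eventually.of_forall fun t ht y hy => ?_
    rw [Set.uIoc_of_le zero_le_one] at ht
    have hy' : ‖y‖ ≤ 1 + ‖x‖ := by
      have := norm_le_norm_add_norm_sub' y x
      rw [mem_ball_iff_norm] at hy
      linarith
    have hyt : ‖(y, t)‖ ≤ 2 + ‖x‖ := by
      rw [Prod.norm_def, Real.norm_of_nonneg ht.1.le]
      exact max_le (by simp only; linarith) (by linarith [ht.2, norm_nonneg x])
    have h2 : ‖(fderiv ℝ φ (y, t)).comp (ContinuousLinearMap.inl ℝ E ℝ)‖ ≤ ‖fderiv ℝ φ (y, t)‖ * 1 :=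
      (ContinuousLinearMap.opNorm_comp_le _ _).trans (by
        gcongr
        exact ContinuousLinearMap.opNorm_le_bound _ zero_le_one fun v => by simp)
    rw [mul_one] at h2
    refine (h2.trans (h _)).trans ?_
    gcongr C * ?_ ^ k
    linarith
  · refine Filter.Eventually.of_forall fun t _ y _ => ?_
    exact (HasTemperateGrowth.differentiable hφ (y, t)).hasFDerivAt.comp y
      ((hasFDerivAt_id y).prodMk (hasFDerivAt_const t y))

/-- The derivative is an integral of the same type with values in `E →L[ℝ] F`; for this reason F is
quantified inside the induction. -/
lemma contDiff_bound_integral_zero_one (n : ℕ) : ∀ {F : Type} [NormedAddCommGroup F]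
    [NormedSpace ℝ F] {φ : E × ℝ → F}, φ.HasTemperateGrowth →
      ContDiff ℝ n (fun x => ∫ t in (0 : ℝ)..1, φ (x, t)) ∧ ∃ (k : ℕ) (C : ℝ), ∀ x,
        ‖iteratedFDeriv ℝ n (fun x => ∫ t in (0 : ℝ)..1, φ (x, t)) x‖ ≤ C * (1 + ‖x‖) ^ k := by
  induction n with
  | zero =>
    intro F _ _ φ hφ
    refine ⟨contDiff_zero.2 (continuous_iff_continuousAt.2 fun x =>
      (hasFDerivAt_integral_zero_one hφ x).continuousAt), ?_⟩
    obtain ⟨k, C, hC, h⟩ := HasTemperateGrowth.bound hφ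
    -- For t in (0, 1] one has 1 + ‖(x, t)‖ ≤ 2(1 + ‖x‖).
    refine ⟨k, C * 2 ^ k, fun x => ?_⟩
    rw [norm_iteratedFDeriv_zero]
    have := intervalIntegral.norm_integral_le_of_norm_le_const (a := 0) (b := 1)
      (f := fun t => φ (x, t)) (C := C * 2 ^ k * (1 + ‖x‖) ^ k) (fun t ht => by
        rw [Set.uIoc_of_le zero_le_one] at ht
        refine (h _).trans ?_
        rw [mul_assoc, ← mul_pow]
        gcongr
        have : ‖(x, t)‖ ≤ 1 + ‖x‖ := by
          rw [Prod.norm_def, Real.norm_of_nonneg ht.1.le]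
          exact max_le (by simp only; linarith) (by linarith [ht.2, norm_nonneg x])
        linarith [norm_nonneg x])
    simpa using this
  | succ n ih =>
    intro F _ _ φ hφ
    have hφ' : Function.HasTemperateGrowth
        fun z => (fderiv ℝ φ z).comp (ContinuousLinearMap.inl ℝ E ℝ) :=
      ((ContinuousLinearMap.compL ℝ E (E × ℝ) F).flip
        (ContinuousLinearMap.inl ℝ E ℝ)).hasTemperateGrowth.comp (temperate_fderiv hφ)
    have hd : fderiv ℝ (fun x => ∫ t in (0 : ℝ)..1, φ (x, t)) = fun x =>
        ∫ t in (0 : ℝ)..1, (fderiv ℝ φ (x, t)).comp (ContinuousLinearMap.inl ℝ E ℝ) :=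
      funext fun x => (hasFDerivAt_integral_zero_one hφ x).fderiv
    obtain ⟨h1, k, C, h2⟩ := ih hφ'
    refine ⟨?_, k, C, fun x => ?_⟩
    · rw [show ((n + 1 : ℕ) : WithTop ℕ∞) = (n : WithTop ℕ∞) + 1 by norm_cast,
        contDiff_succ_iff_fderiv]
      exact ⟨fun x => (hasFDerivAt_integral_zero_one hφ x).differentiableAt, by simp, hd ▸ h1⟩
    · rw [← norm_iteratedFDeriv_fderiv, hd]
      exact h2 x

/-- Integrals of functions of temperate growth over a bounded parameter have temperate growth. -/
lemma hasTemperateGrowth_integral_zero_one {F : Type} [NormedAddCommGroup F] [NormedSpace ℝ F]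
    {φ : E × ℝ → F} (hφ : φ.HasTemperateGrowth) :
    Function.HasTemperateGrowth (fun x => ∫ t in (0 : ℝ)..1, φ (x, t)) :=
  ⟨contDiff_infty.2 fun n => (contDiff_bound_integral_zero_one n hφ).1,
    fun n => (contDiff_bound_integral_zero_one n hφ).2⟩

end ParametricIntegral

/-! ### Symmetries of the integral over the standard triangle. -/

section Triangle

/-- The integral over the standard triangle. -/
def triangleIntegral (φ : ℝ → ℝ → ℝ) : ℝ := ∫ s in (0 : ℝ)..1, ∫ t in (0 : ℝ)..(1 - s), φ s t

lemma triangleIntegral_reflect (φ : ℝ → ℝ → ℝ) :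
    triangleIntegral (fun s t => φ s (1 - s - t)) = triangleIntegral φ := by
  unfold triangleIntegral
  congr 1; ext s
  rw [intervalIntegral.integral_comp_sub_left (fun t => φ s t) (1 - s)]
  simp

lemma triangleIntegral_eq_indicator (φ : ℝ → ℝ → ℝ) : triangleIntegral φ =
    ∫ s in (0 : ℝ)..1, ∫ t in (0 : ℝ)..1, if s + t ≤ 1 then φ s t else 0 := by
  unfold triangleIntegral
  refine intervalIntegral.integral_congr fun s hs => ?_
  rw [Set.uIcc_of_le zero_le_one] at hs
  have h1 : (0 : ℝ) ≤ 1 - s := by linarith [hs.2]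
  rw [intervalIntegral.integral_of_le h1, intervalIntegral.integral_of_le zero_le_one]
  have e : (fun t => if s + t ≤ 1 then φ s t else 0) = (Set.Iic (1 - s)).indicator (φ s) := by
    ext t
    simp only [Set.indicator, Set.mem_Iic, le_sub_iff_add_le']
  rw [e, setIntegral_indicator measurableSet_Iic, Set.Ioc_inter_Iic, min_eq_right (by linarith [hs.1])]

/-- The region s + t ≤ 1 is symmetric; extending by zero to the unit square reduces the claim to
Fubini. -/
lemma triangleIntegral_swap {φ : ℝ → ℝ → ℝ} (hφ : Continuous (Function.uncurry φ)) :
    triangleIntegral (fun s t => φ t s) = triangleIntegral φ := by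
  rw [triangleIntegral_eq_indicator, triangleIntegral_eq_indicator,
    MeasureTheory.intervalIntegral_intervalIntegral_swap]
  · congr 1; ext s; congr 1; ext t
    rw [add_comm]
  · have hi : IntegrableOn (Function.uncurry fun s t => φ t s)
        (Set.Icc (0 : ℝ) 1 ×ˢ Set.Icc (0 : ℝ) 1) (volume.prod volume) :=
      (hφ.comp continuous_swap).continuousOn.integrableOn_compact (isCompact_Icc.prod isCompact_Icc)
    have hs : MeasurableSet {z : ℝ × ℝ | z.1 + z.2 ≤ 1} :=
      measurableSet_le (by fun_prop) measurable_const
    have h2 := hi.indicator hs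
    rw [Set.uIoc_of_le zero_le_one]
    refine IntegrableOn.mono_set (t := Set.Icc (0 : ℝ) 1 ×ˢ Set.Icc (0 : ℝ) 1) ?_
      (Set.prod_mono Set.Ioc_subset_Icc_self Set.Ioc_subset_Icc_self)
    refine h2.congr (Filter.Eventually.of_forall fun z => ?_)
    simp [Set.indicator, Function.uncurry]

end Triangle

/-! ### The magnetic flux, its symmetries and its growth. -/

section Flux

variable {N : ℕ} (B : MagneticField N)

/-- The density of the flux through the triangle with vertices `a, b, c`. -/
def fluxDensity (a b c : X N) (s t : ℝ) : ℝ :=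
  ∑ j, ∑ k, B.comp (a + s • (b - a) + t • (c - a)) j k * (b - a) j * (c - a) k

lemma flux_eq_triangleIntegral (a b c : X N) :
    flux B a b c = triangleIntegral (fluxDensity B a b c) := rfl

lemma continuous_fluxDensity (a b c : X N) :
    Continuous (Function.uncurry (fluxDensity B a b c)) := by
  have h : ∀ j k, Continuous fun x => B.comp x j k := fun j k => (B.temperate j k).1.continuous
  unfold Function.uncurry fluxDensity
  refine continuous_finsetSum _ fun j _ => continuous_finsetSum _ fun k _ => ?_
  exact (((h j k).comp (by fun_prop)).mul continuous_const).mul continuous_const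

lemma sum_antisymm_eq {M : Matrix (Fin N) (Fin N) ℝ} (hM : ∀ j k, M j k = -M k j) (u v : X N) :
    ∑ j, ∑ k, M j k * u j * v k = -∑ j, ∑ k, M j k * v j * u k := by
  rw [Finset.sum_comm, ← Finset.sum_neg_distrib]
  refine Finset.sum_congr rfl fun j _ => ?_
  rw [← Finset.sum_neg_distrib]
  refine Finset.sum_congr rfl fun k _ => ?_
  rw [hM k j]
  ring

lemma sum_antisymm_self {M : Matrix (Fin N) (Fin N) ℝ} (hM : ∀ j k, M j k = -M k j) (u : X N) :
    ∑ j, ∑ k, M j k * u j * u k = 0 := by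
  have := sum_antisymm_eq hM u u
  linarith

/-- In barycentric terms, exchanging a and c replaces t by 1 - s - t; antisymmetry of B removes the
extra term in the density and yields the sign. -/
lemma flux_reverse (a b c : X N) : flux B c b a = -flux B a b c := by
  have h : fluxDensity B c b a = fun s t => -fluxDensity B a b c s (1 - s - t) := by
    ext s t
    have e : c + s • (b - c) + t • (a - c) = a + s • (b - a) + (1 - s - t) • (c - a) := by module
    unfold fluxDensity
    rw [e]
    set M := B.comp (a + s • (b - a) + (1 - s - t) • (c - a)) with hM
    have h1 := sum_antisymm_self (M := M) (B.antisymm _) (c - a)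
    have h2 : ∑ j, ∑ k, M j k * (b - c) j * (a - c) k =
        -(∑ j, ∑ k, M j k * (b - a) j * (c - a) k) + ∑ j, ∑ k, M j k * (c - a) j * (c - a) k := by
      rw [← Finset.sum_neg_distrib, ← Finset.sum_add_distrib]
      refine Finset.sum_congr rfl fun j _ => ?_
      rw [← Finset.sum_neg_distrib, ← Finset.sum_add_distrib]
      refine Finset.sum_congr rfl fun k _ => ?_
      simp only [PiLp.sub_apply]
      ring
    rw [h2, h1, add_zero]
  rw [flux_eq_triangleIntegral, flux_eq_triangleIntegral, h,
    triangleIntegral_reflect (fun s t => -fluxDensity B a b c s t)]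
  simp [triangleIntegral, intervalIntegral.integral_neg]

lemma flux_swap (a b c : X N) : flux B a c b = -flux B a b c := by
  have h : fluxDensity B a c b = fun s t => -fluxDensity B a b c t s := by
    ext s t
    have e : a + s • (c - a) + t • (b - a) = a + t • (b - a) + s • (c - a) := by module
    unfold fluxDensity
    rw [e, sum_antisymm_eq (B.antisymm _)]
  rw [flux_eq_triangleIntegral, flux_eq_triangleIntegral, h,
    triangleIntegral_swap (φ := fun s t => -fluxDensity B a b c s t)
      (continuous_fluxDensity B a b c).neg]
  simp [triangleIntegral, intervalIntegral.integral_neg]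

/-- A rotation is the product of two transpositions, each of which changes the sign. -/
lemma flux_rotate (a b c : X N) : flux B b c a = flux B a b c := by
  rw [flux_reverse, flux_swap, neg_neg]

/-- Replacing t by (1 - s)t turns the triangle into the unit square with Jacobian 1 - s, so that two
integrations over [0, 1] of a temperate function remain. -/
lemma hasTemperateGrowth_flux :
    Function.HasTemperateGrowth (fun u : X N × X N × X N => flux B u.1 u.2.1 u.2.2) := by
  have h1 : (fun u : X N × X N × X N => flux B u.1 u.2.1 u.2.2) = fun u =>
      ∫ s in (0 : ℝ)..1, ∫ t in (0 : ℝ)..1,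
        (1 - s) * fluxDensity B u.1 u.2.1 u.2.2 s ((1 - s) * t) := by
    ext u
    rw [flux_eq_triangleIntegral, triangleIntegral]
    congr 1; ext s
    rw [intervalIntegral.integral_const_mul]
    have := intervalIntegral.smul_integral_comp_mul_left (a := 0) (b := 1)
      (fun t => fluxDensity B u.1 u.2.1 u.2.2 s t) (1 - s)
    rw [mul_zero, mul_one] at this
    exact this.symm
  let T := ((X N × X N × X N) × ℝ) × ℝ
  let U : T →L[ℝ] X N × X N × X N :=
    (ContinuousLinearMap.fst ℝ _ _).comp (ContinuousLinearMap.fst ℝ _ _)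
  let S : T →L[ℝ] ℝ := (ContinuousLinearMap.snd ℝ _ _).comp (ContinuousLinearMap.fst ℝ _ _)
  let R : T →L[ℝ] ℝ := ContinuousLinearMap.snd ℝ _ _
  let a : T →L[ℝ] X N := (ContinuousLinearMap.fst ℝ _ _).comp U
  let b : T →L[ℝ] X N := (ContinuousLinearMap.fst ℝ _ _).comp ((ContinuousLinearMap.snd ℝ _ _).comp U)
  let c : T →L[ℝ] X N := (ContinuousLinearMap.snd ℝ _ _).comp ((ContinuousLinearMap.snd ℝ _ _).comp U)
  have hS : Function.HasTemperateGrowth fun z : T => 1 - S z :=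
    (Function.HasTemperateGrowth.const 1).sub S.hasTemperateGrowth
  have hP : Function.HasTemperateGrowth fun z : T =>
      a z + S z • (b - a) z + ((1 - S z) * R z) • (c - a) z :=
    (a.hasTemperateGrowth.add (S.hasTemperateGrowth.smul (b - a).hasTemperateGrowth)).add
      ((hS.mul R.hasTemperateGrowth).smul (c - a).hasTemperateGrowth)
  have hcoord : ∀ (L : T →L[ℝ] X N) (j : Fin N), Function.HasTemperateGrowth fun z => L z j :=
    fun L j => ((EuclideanSpace.proj (𝕜 := ℝ) j).comp L).hasTemperateGrowth
  have hΦ : Function.HasTemperateGrowth fun z : T => (1 - z.1.2) *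
      fluxDensity B z.1.1.1 z.1.1.2.1 z.1.1.2.2 z.1.2 ((1 - z.1.2) * z.2) :=
    hS.mul (.sum fun j _ => .sum fun k _ =>
      (((B.temperate j k).comp hP).mul (hcoord (b - a) j)).mul (hcoord (c - a) k))
  rw [h1]
  exact hasTemperateGrowth_integral_zero_one (hasTemperateGrowth_integral_zero_one hΦ)

/-- The magnetic amplitude as a function of the positions. -/
def magneticAmplitude (u : X N × X N × X N) : ℂ :=
  Complex.exp (-Complex.I * (flux B (u.1 - u.2.2 + u.2.1) (u.2.1 - u.1 + u.2.2)
    (u.2.2 - u.2.1 + u.1) : ℂ))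

lemma hasTemperateGrowth_magneticAmplitude :
    Function.HasTemperateGrowth (magneticAmplitude B) := by
  let p : X N × X N × X N →L[ℝ] X N := ContinuousLinearMap.fst ℝ _ _
  let q : X N × X N × X N →L[ℝ] X N :=
    (ContinuousLinearMap.fst ℝ _ _).comp (ContinuousLinearMap.snd ℝ _ _)
  let r : X N × X N × X N →L[ℝ] X N :=
    (ContinuousLinearMap.snd ℝ _ _).comp (ContinuousLinearMap.snd ℝ _ _)
  exact HasTemperateGrowth.cexp_neg_I_mul (HasTemperateGrowth.compCLM (hasTemperateGrowth_flux B)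
    ((p - r + q).prod ((q - p + r).prod (r - q + p))))

/-- By antisymmetry σ(ξ-η, ξ-ζ) = σ(ξ,η) + σ(η,ζ) + σ(ζ,ξ), a cyclic expression, and a cyclic
permutation of the points rotates the vertices of the triangle. -/
lemma oscKernel_rotate (ξ η ζ : Phase N) :
    oscKernel (magneticAmplitude B) (η, ζ, ξ) = oscKernel (magneticAmplitude B) (ξ, η, ζ) := by
  have h1 : moyalPhase (η, ζ, ξ) = moyalPhase (ξ, η, ζ) := by
    simp only [moyalPhase, diffFst_apply, diffSnd_apply, symplCLM_apply, Prod.fst_sub, Prod.snd_sub,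
      inner_sub_left, inner_sub_right]
    rw [real_inner_comm η.2 η.1, real_inner_comm η.2 ζ.1, real_inner_comm ξ.2 η.1,
      real_inner_comm ξ.2 ζ.1, real_inner_comm ξ.2 ξ.1, real_inner_comm ζ.2 ξ.1,
      real_inner_comm ζ.2 η.1]
    ring
  have h2 := flux_rotate B (ξ.1 - ζ.1 + η.1) (η.1 - ξ.1 + ζ.1) (ζ.1 - η.1 + ξ.1)
  simp only [oscKernel, h1, positions_apply, magneticAmplitude, h2]

/-- Exchanging η and ζ changes the sign of both real phases. -/
lemma oscKernel_reverse (ξ η ζ : Phase N) : oscKernel (magneticAmplitude B) (ξ, ζ, η) =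
    (starRingEnd ℂ) (oscKernel (magneticAmplitude B) (ξ, η, ζ)) := by
  have h1 : moyalPhase (ξ, ζ, η) = -moyalPhase (ξ, η, ζ) := by
    simp only [moyalPhase, diffFst_apply, diffSnd_apply, symplCLM_apply]
    rw [real_inner_comm (ξ - ζ).1, real_inner_comm (ξ - ζ).2]
    ring
  have h2 := flux_reverse B (ξ.1 - ζ.1 + η.1) (η.1 - ξ.1 + ζ.1) (ζ.1 - η.1 + ξ.1)
  have e1 : ξ.1 - η.1 + ζ.1 = ζ.1 - η.1 + ξ.1 := by abel
  have e2 : ζ.1 - ξ.1 + η.1 = η.1 - ξ.1 + ζ.1 := by abel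
  have e3 : η.1 - ζ.1 + ξ.1 = ξ.1 - ζ.1 + η.1 := by abel
  simp only [oscKernel, h1, positions_apply, magneticAmplitude, e1, e2, e3, h2, map_mul,
    ← Complex.exp_conj, map_neg, Complex.conj_I, Complex.conj_ofReal]
  push_cast
  ring_nf

end Flux

section Moyal

variable {N : ℕ} (B : MagneticField N)

lemma moyal_eq_osc (f g : 𝓢(Phase N, ℂ)) (ξ : Phase N) :
    moyal B f g ξ = 4 ^ N * osc (magneticAmplitude B) f g ξ := by
  unfold moyal osc kernelOp
  rw [integral_prod _ (integrable_kernelOp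
    (hasTemperateGrowth_oscKernel (hasTemperateGrowth_magneticAmplitude B)) f g ξ)]
  congr 2; ext η; congr 1; ext ζ
  simp only [oscKernel, moyalPhase, sympl_eq, magneticAmplitude, positions_apply, diffFst_apply,
    diffSnd_apply]
  push_cast
  ring_nf

end Moyal

end MagneticMoyal

/-! ### The product on Schwartz functions: cyclicity and conjugation. -/

namespace MagneticMoyal

section Trilinear

variable {V : Type*} [NormedAddCommGroup V] [NormedSpace ℝ V] [MeasurableSpace V] [BorelSpace V]
  [FiniteDimensional ℝ V] (μ : Measure V) [μ.IsAddHaarMeasure]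

set_option linter.unusedSectionVars false

lemma integrable_trilinear {Ψ : V × V × V → ℂ} (hΨ : Ψ.HasTemperateGrowth) (f g h : 𝓢(V, ℂ)) :
    Integrable (fun z : V × V × V => Ψ z * f z.2.1 * g z.2.2 * h z.1) (μ.prod (μ.prod μ)) := by
  obtain ⟨k, C, hC, hb⟩ := HasTemperateGrowth.bound hΨ
  have hc := hΨ.1.continuous
  have hint := (integrable_weighted μ h k).mul_prod (integrable_kernelOp_bound μ f g C k)
  refine hint.mono' ?_ (Filter.Eventually.of_forall fun z => ?_)
  · have : Continuous (fun z : V × V × V => Ψ z * f z.2.1 * g z.2.2 * h z.1) := by fun_prop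
    exact this.aestronglyMeasurable
  · rw [norm_mul, norm_mul, norm_mul]
    calc ‖Ψ z‖ * ‖f z.2.1‖ * ‖g z.2.2‖ * ‖h z.1‖ ≤ C * (1 + ‖z.1‖) ^ k *
          ((1 + ‖z.2.1‖) ^ k * ‖f z.2.1‖ * ((1 + ‖z.2.2‖) ^ k * ‖g z.2.2‖)) * ‖h z.1‖ := by
          exact mul_le_mul_of_nonneg_right (norm_kernel_le hC hb f g z.1 z.2) (norm_nonneg _)
      _ = _ := by ring

/-- If the kernel is invariant under cyclic permutations of the variables, so is the trilinear form
`(f, g, h) ↦ ∫ (f ∘ g) h`. -/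
lemma integral_kernelOp_mul {Ψ : V × V × V → ℂ} (hΨ : Ψ.HasTemperateGrowth)
    (hrot : ∀ ξ η ζ, Ψ (η, ζ, ξ) = Ψ (ξ, η, ζ)) (f g h : 𝓢(V, ℂ)) :
    ∫ ξ, kernelOp μ Ψ f g ξ * h ξ ∂μ = ∫ ξ, f ξ * kernelOp μ Ψ g h ξ ∂μ := by
  have h1 : ∫ ξ, kernelOp μ Ψ f g ξ * h ξ ∂μ =
      ∫ z : V × V × V, Ψ z * f z.2.1 * g z.2.2 * h z.1 ∂(μ.prod (μ.prod μ)) := by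
    rw [integral_prod _ (integrable_trilinear μ hΨ f g h)]
    congr 1; ext ξ
    rw [kernelOp, ← integral_mul_const]
  have h2 : ∫ ξ, f ξ * kernelOp μ Ψ g h ξ ∂μ =
      ∫ z : V × V × V, Ψ z * g z.2.1 * h z.2.2 * f z.1 ∂(μ.prod (μ.prod μ)) := by
    rw [integral_prod _ (integrable_trilinear μ hΨ g h f)]
    congr 1; ext ξ
    rw [kernelOp, mul_comm, ← integral_mul_const]
  have hp : MeasurePreserving (fun z : V × V × V => ((z.2.1, z.2.2, z.1) : V × V × V))
      (μ.prod (μ.prod μ)) (μ.prod (μ.prod μ)) :=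
    (measurePreserving_prodAssoc μ μ μ).comp (Measure.measurePreserving_swap (μ := μ) (ν := μ.prod μ))
  have he : MeasurableEmbedding (fun z : V × V × V => ((z.2.1, z.2.2, z.1) : V × V × V)) :=
    (MeasurableEquiv.prodAssoc.measurableEmbedding).comp
      (MeasurableEquiv.prodComm (α := V) (β := V × V)).measurableEmbedding
  rw [h1, h2]
  refine Eq.trans ?_ (hp.integral_comp he _)
  congr 1; ext z
  rw [hrot z.1 z.2.1 z.2.2]
  ring

lemma kernelOp_conj {Ψ : V × V × V → ℂ}
    (hrev : ∀ ξ η ζ, Ψ (ξ, ζ, η) = (starRingEnd ℂ) (Ψ (ξ, η, ζ))) {f g f' g' : 𝓢(V, ℂ)}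
    (hf : ∀ ξ, f' ξ = (starRingEnd ℂ) (f ξ)) (hg : ∀ ξ, g' ξ = (starRingEnd ℂ) (g ξ)) (ξ : V) :
    kernelOp μ Ψ g' f' ξ = (starRingEnd ℂ) (kernelOp μ Ψ f g ξ) := by
  unfold kernelOp
  rw [← integral_conj, ← integral_prod_swap]
  congr 1; ext z
  simp only [Prod.swap, hf, hg, map_mul, hrev ξ z.1 z.2]
  ring

end Trilinear

variable {N : ℕ} (B : MagneticField N)

lemma oscSpan_moyal : OscSpan (fun f g ξ => 4 ^ N * osc (magneticAmplitude B) f g ξ) :=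
  OscSpan.const_mul _ (OscSpan.base (magneticAmplitude B) (hasTemperateGrowth_magneticAmplitude B))

/-- The magnetic Moyal product of Schwartz functions. -/
def moyalSchwartz : 𝓢(Phase N, ℂ) →ₗ[ℂ] 𝓢(Phase N, ℂ) →ₗ[ℂ] 𝓢(Phase N, ℂ) :=
  have hK := hasTemperateGrowth_oscKernel (hasTemperateGrowth_magneticAmplitude B)
  LinearMap.mk₂ ℂ (oscSpan_moyal B).toSchwartz
    (fun f f' g => by
      ext ξ
      simp only [add_apply, OscSpan.toSchwartz_apply, osc, kernelOp_add_left _ hK, mul_add])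
    (fun c f g => by
      ext ξ
      simp only [smul_apply, OscSpan.toSchwartz_apply, osc, kernelOp_smul_left, smul_eq_mul]
      ring)
    (fun f g g' => by
      ext ξ
      simp only [add_apply, OscSpan.toSchwartz_apply, osc, kernelOp_add_right _ hK, mul_add])
    (fun c f g => by
      ext ξ
      simp only [smul_apply, OscSpan.toSchwartz_apply, osc, kernelOp_smul_right, smul_eq_mul]
      ring)

lemma moyalSchwartz_eq_kernelOp (f g : 𝓢(Phase N, ℂ)) (ξ : Phase N) : moyalSchwartz B f g ξ =
    4 ^ N * kernelOp (phaseMeasure N) (oscKernel (magneticAmplitude B)) f g ξ := rfl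

lemma moyalSchwartz_apply (f g : 𝓢(Phase N, ℂ)) (ξ : Phase N) :
    moyalSchwartz B f g ξ = moyal B f g ξ := (moyal_eq_osc B f g ξ).symm

lemma seminorm_moyalSchwartz_le (m : ℝ) (k n : ℕ) :
    ∃ (p : ℕ) (q : Seminorm ℂ 𝓢(Phase N, ℂ)), Continuous q ∧ ∀ f g,
      SchwartzMap.seminorm ℂ k n (moyalSchwartz B f g) ≤ R0.norms N m p (toR0 m f) * q g :=
  (oscSpan_moyal B).seminorm_toSchwartz_le m k n

lemma integral_moyalSchwartz_mul (f g h : 𝓢(Phase N, ℂ)) :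
    ∫ ξ, moyalSchwartz B f g ξ * h ξ ∂(phaseMeasure N) =
      ∫ ξ, f ξ * moyalSchwartz B g h ξ ∂(phaseMeasure N) := by
  have := integral_kernelOp_mul (phaseMeasure N)
    (hasTemperateGrowth_oscKernel (hasTemperateGrowth_magneticAmplitude B)) (oscKernel_rotate B) f g h
  simp only [moyalSchwartz_eq_kernelOp, mul_assoc, mul_left_comm _ ((4 : ℂ) ^ N)]
  rw [integral_const_mul, integral_const_mul, this]

/-- The complex conjugate of a Schwartz function. -/
def conjSchwartz (f : 𝓢(Phase N, ℂ)) : 𝓢(Phase N, ℂ) :=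
  postcompCLM (𝕜 := ℝ) (Complex.conjCLE : ℂ →L[ℝ] ℂ) f

lemma conjSchwartz_apply (f : 𝓢(Phase N, ℂ)) (ξ : Phase N) :
    conjSchwartz f ξ = (starRingEnd ℂ) (f ξ) := rfl

lemma moyalSchwartz_conj (f g : 𝓢(Phase N, ℂ)) (ξ : Phase N) :
    moyalSchwartz B (conjSchwartz g) (conjSchwartz f) ξ =
      (starRingEnd ℂ) (moyalSchwartz B f g ξ) := by
  rw [moyalSchwartz_eq_kernelOp, moyalSchwartz_eq_kernelOp, map_mul,
    kernelOp_conj (phaseMeasure N) (oscKernel_reverse B) (conjSchwartz_apply f)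
      (conjSchwartz_apply g), map_pow, Complex.conj_ofNat]

end MagneticMoyal

namespace MagneticMoyal

open Filter Topology

/-! ### Convergence of geometric sequences of Schwartz functions. -/

section Complete

variable {E F : Type*} [NormedAddCommGroup E] [NormedSpace ℝ E] [NormedAddCommGroup F]
  [NormedSpace ℝ F] [NormedSpace ℂ F] [SMulCommClass ℝ ℂ F] [CompleteSpace F]

/-- A sequence of Schwartz functions whose increments decay geometrically in every seminorm
converges. -/
lemma exists_tendsto_of_seminorm_le_geometric (u : ℕ → 𝓢(E, F))
    (h : ∀ k l, ∃ C, ∀ n, SchwartzMap.seminorm ℂ k l (u (n + 1) - u n) ≤ C * (1 / 2) ^ n) :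
    ∃ v, Tendsto u atTop (𝓝 v) := by
  choose C hC using h
  have hs : ∀ k l, Summable fun n : ℕ => C k l * (1 / 2 : ℝ) ^ n := fun k l =>
    summable_geometric_two.mul_left _
  have hd : ∀ k l n x, ‖x‖ ^ k * ‖iteratedFDeriv ℝ l (u (n + 1) - u n) x‖ ≤ C k l * (1 / 2) ^ n :=
    fun k l n x => (SchwartzMap.le_seminorm ℂ k l _ x).trans (hC k l n)
  have hd0 : ∀ (l n : ℕ) (x : E), (l : ℕ∞) ≤ ⊤ →
      ‖iteratedFDeriv ℝ l (u (n + 1) - u n : 𝓢(E, F)) x‖ ≤ C 0 l * (1 / 2) ^ n :=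
    fun l n x _ => by simpa using hd 0 l n x
  have hsm : ∀ n, ContDiff ℝ ((⊤ : ℕ∞) : WithTop ℕ∞) (u (n + 1) - u n : 𝓢(E, F)) :=
    fun n => (u (n + 1) - u n).smooth ⊤
  -- The candidate limit is the telescoping series, smooth because each derivative has a summable
  -- majorant.
  set w : E → F := fun x => u 0 x + ∑' n, (u (n + 1) - u n) x with hw
  have hw1 : ContDiff ℝ ∞ (fun x => ∑' n, (u (n + 1) - u n) x) :=
    contDiff_tsum hsm (fun l _ => hs 0 l) hd0
  have hwc : ContDiff ℝ ∞ w := ((u 0).smooth ⊤).add hw1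
  have hlim : ∀ l x, Tendsto (fun n => iteratedFDeriv ℝ l (u n) x) atTop
      (𝓝 (iteratedFDeriv ℝ l w x)) := by
    intro l x
    have e : iteratedFDeriv ℝ l w x =
        iteratedFDeriv ℝ l (u 0) x + ∑' n, iteratedFDeriv ℝ l (u (n + 1) - u n : 𝓢(E, F)) x := by
      rw [← iteratedFDeriv_tsum_apply hsm (fun l _ => hs 0 l) hd0 le_top]
      exact iteratedFDeriv_add_apply (((u 0).smooth l).contDiffAt)
        (hw1.contDiffAt.of_le (by exact_mod_cast le_top))
    have hsum : Summable fun n => iteratedFDeriv ℝ l (u (n + 1) - u n : 𝓢(E, F)) x :=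
      Summable.of_norm_bounded (hs 0 l) fun n => hd0 l n x le_top
    rw [e]
    refine (hsum.hasSum.tendsto_sum_nat.const_add (iteratedFDeriv ℝ l (u 0) x)).congr fun n => ?_
    have e2 : ∀ n, iteratedFDeriv ℝ l (u (n + 1) - u n : 𝓢(E, F)) x =
        iteratedFDeriv ℝ l (u (n + 1)) x - iteratedFDeriv ℝ l (u n) x := fun n =>
      iteratedFDeriv_sub_apply (((u (n + 1)).smooth l).contDiffAt) (((u n).smooth l).contDiffAt)
    simp only [e2]
    rw [Finset.sum_range_sub (fun n => iteratedFDeriv ℝ l (u n) x)]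
    abel
  have hdist : ∀ k l n x, ‖x‖ ^ k * ‖iteratedFDeriv ℝ l (u n) x - iteratedFDeriv ℝ l w x‖ ≤
      C k l * (1 / 2) ^ n / (1 - 1 / 2) := by
    intro k l n x
    have h1 := dist_le_of_le_geometric_of_tendsto (1 / 2) (C k l) (by norm_num)
      (f := fun n => (‖x‖ ^ k) • iteratedFDeriv ℝ l (u n) x) (fun n => ?_)
      ((hlim l x).const_smul (‖x‖ ^ k)) n
    · rwa [dist_eq_norm, ← smul_sub, norm_smul, Real.norm_of_nonneg (by positivity)] at h1
    · rw [dist_eq_norm, ← smul_sub, norm_smul, Real.norm_of_nonneg (by positivity), norm_sub_rev]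
      have e2 : iteratedFDeriv ℝ l (u (n + 1) - u n : 𝓢(E, F)) x =
          iteratedFDeriv ℝ l (u (n + 1)) x - iteratedFDeriv ℝ l (u n) x :=
        iteratedFDeriv_sub_apply (((u (n + 1)).smooth l).contDiffAt) (((u n).smooth l).contDiffAt)
      rw [← e2]
      exact hd k l n x
  let v : 𝓢(E, F) :=
    { toFun := w
      smooth' := hwc
      decay' := fun k l => by
        refine ⟨SchwartzMap.seminorm ℂ k l (u 0) + C k l * (1 / 2) ^ 0 / (1 - 1 / 2), fun x => ?_⟩
        have h1 := hdist k l 0 x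
        have h2 := SchwartzMap.le_seminorm ℂ k l (u 0) x
        have h3 : ‖iteratedFDeriv ℝ l w x‖ ≤ ‖iteratedFDeriv ℝ l (u 0) x‖ +
            ‖iteratedFDeriv ℝ l (u 0) x - iteratedFDeriv ℝ l w x‖ := by
          have := norm_sub_le (iteratedFDeriv ℝ l (u 0) x)
            (iteratedFDeriv ℝ l (u 0) x - iteratedFDeriv ℝ l w x)
          rwa [sub_sub_cancel] at this
        calc ‖x‖ ^ k * ‖iteratedFDeriv ℝ l w x‖ ≤ ‖x‖ ^ k * (‖iteratedFDeriv ℝ l (u 0) x‖ +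
            ‖iteratedFDeriv ℝ l (u 0) x - iteratedFDeriv ℝ l w x‖) := by gcongr
          _ ≤ _ := by rw [mul_add]; exact add_le_add h2 h1 }
  refine ⟨v, ((schwartz_withSeminorms ℂ E F).tendsto_nhds u v).2 fun ⟨k, l⟩ ε hε => ?_⟩
  have h0 : Tendsto (fun n : ℕ => C k l * (1 / 2 : ℝ) ^ n / (1 - 1 / 2)) atTop (𝓝 0) := by
    have := ((tendsto_pow_atTop_nhds_zero_of_lt_one (r := (1 / 2 : ℝ)) (by norm_num)
      (by norm_num)).const_mul (C k l)).div_const (1 - 1 / 2)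
    simpa using this
  filter_upwards [h0.eventually_lt_const hε] with n hn
  refine lt_of_le_of_lt ?_ hn
  have hC0 : 0 ≤ C k l * (1 / 2) ^ n / (1 - 1 / 2) :=
    div_nonneg ((apply_nonneg _ _).trans (hC k l n)) (by norm_num)
  refine SchwartzMap.seminorm_le_bound ℂ k l _ hC0 fun x => ?_
  have e2 : iteratedFDeriv ℝ l (u n - v : 𝓢(E, F)) x =
      iteratedFDeriv ℝ l (u n) x - iteratedFDeriv ℝ l w x :=
    iteratedFDeriv_sub_apply (((u n).smooth l).contDiffAt)
      (hwc.contDiffAt.of_le (by exact_mod_cast le_top))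
  rw [e2]
  exact hdist k l n x

end Complete

variable {N : ℕ}

/-! ### Smooth truncation in R^m_0. -/

section Cutoff

/-- A smooth function with compact support, equal to `1` on the unit ball, rescaled by `r`. -/
def cutoff (r : ℝ) (ξ : Phase N) : ℝ :=
  (ContDiffBump.mk 1 2 one_pos one_lt_two : ContDiffBump (0 : Phase N)) (r • ξ)

lemma contDiff_cutoff (r : ℝ) : ContDiff ℝ ∞ (cutoff (N := N) r) :=
  (ContDiffBump.contDiff _).comp (contDiff_const_smul r)

lemma hasCompactSupport_cutoff {r : ℝ} (hr : r ≠ 0) : HasCompactSupport (cutoff (N := N) r) :=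
  (ContDiffBump.hasCompactSupport _).comp_smul hr

lemma cutoff_eq_one {r : ℝ} {ξ : Phase N} (h : ‖r • ξ‖ ≤ 1) : cutoff r ξ = 1 :=
  ContDiffBump.one_of_mem_closedBall _ (by simpa using h)

lemma cutoff_zero (ξ : Phase N) : cutoff 0 ξ = 1 := cutoff_eq_one (by simp)

lemma cutoff_nonneg (r : ℝ) (ξ : Phase N) : 0 ≤ cutoff r ξ := ContDiffBump.nonneg _

lemma cutoff_le_one (r : ℝ) (ξ : Phase N) : cutoff r ξ ≤ 1 := ContDiffBump.le_one _

lemma exists_norm_iteratedFDeriv_cutoff_le (k : ℕ) : ∃ c : ℝ, 0 ≤ c ∧ ∀ i ≤ k, ∀ r : ℝ, |r| ≤ 1 →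
    ∀ ξ : Phase N, ‖iteratedFDeriv ℝ i (cutoff r) ξ‖ ≤ c := by
  set χ : Phase N → ℝ := ⇑(ContDiffBump.mk 1 2 one_pos one_lt_two : ContDiffBump (0 : Phase N)) with hχ
  have hχc : ContDiff ℝ ∞ χ := ContDiffBump.contDiff _
  have hb : ∀ i : ℕ, ∃ c, ∀ ξ, ‖iteratedFDeriv ℝ i χ ξ‖ ≤ c := fun i =>
    (hχc.continuous_iteratedFDeriv (by exact_mod_cast le_top)).bounded_above_of_compact_support
      ((ContDiffBump.hasCompactSupport _).iteratedFDeriv i)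
  choose c hc using hb
  have hc0 : ∀ i, 0 ≤ c i := fun i => (norm_nonneg _).trans (hc i 0)
  refine ⟨∑ i ∈ Finset.range (k + 1), c i, Finset.sum_nonneg fun i _ => hc0 i,
    fun i hi r hr ξ => ?_⟩
  set L : Phase N →L[ℝ] Phase N := r • ContinuousLinearMap.id ℝ (Phase N) with hL
  have e : cutoff (N := N) r = χ ∘ L := by ext ξ; simp [cutoff, hL, hχ]
  have hLn : ‖L‖ ≤ 1 := ContinuousLinearMap.opNorm_le_bound _ zero_le_one fun v => by
    simp only [hL, _root_.smul_apply, ContinuousLinearMap.id_apply, norm_smul,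
      Real.norm_eq_abs]
    gcongr
  rw [e, L.iteratedFDeriv_comp_right hχc ξ (by exact_mod_cast le_top)]
  refine (ContinuousMultilinearMap.norm_compContinuousLinearMap_le _ _).trans ?_
  rw [Finset.prod_const]
  calc ‖iteratedFDeriv ℝ i χ (L ξ)‖ * ‖L‖ ^ (Finset.univ : Finset (Fin i)).card
      ≤ c i * 1 := by
        gcongr
        · exact hc0 i
        · exact hc i _
        · exact pow_le_one₀ (norm_nonneg _) hLn
    _ ≤ _ := by
      rw [mul_one]
      exact Finset.single_le_sum (f := c) (fun i _ => hc0 i) (by simp; omega)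

/-- For ‖ξ‖ < 1/ε both cutoffs equal 1 near ξ, and elsewhere ε⟨ξ⟩ ≥ 1. One power of the weight thus
buys a factor ε. -/
lemma exists_norm_iteratedFDeriv_cutoff_sub_le (k : ℕ) : ∃ c : ℝ, 0 ≤ c ∧ ∀ i ≤ k,
    ∀ ε r s : ℝ, 0 < ε → ε ≤ 1 → |r| ≤ ε → |s| ≤ ε → ∀ ξ : Phase N,
      ‖iteratedFDeriv ℝ i (fun ξ => cutoff r ξ - cutoff s ξ) ξ‖ ≤ c * ε * bracket ξ := by
  obtain ⟨c, hc0, hc⟩ := exists_norm_iteratedFDeriv_cutoff_le (N := N) k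
  refine ⟨c + c, by positivity, fun i hi ε r s hε hε1 hr hs ξ => ?_⟩
  rcases lt_or_ge ‖ξ‖ ε⁻¹ with h | h
  · have hone : ∀ t : ℝ, |t| ≤ ε → ∀ η : Phase N, ‖η‖ < ε⁻¹ → cutoff t η = 1 := by
      intro t ht η hη
      refine cutoff_eq_one ?_
      rw [norm_smul, Real.norm_eq_abs]
      calc |t| * ‖η‖ ≤ ε * ε⁻¹ := by gcongr
        _ = 1 := mul_inv_cancel₀ hε.ne'
    have he : (fun ξ : Phase N => cutoff r ξ - cutoff s ξ) =ᶠ[𝓝 ξ] fun _ => 0 := by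
      filter_upwards [(continuous_norm.tendsto ξ).eventually_lt_const h] with η hη
      rw [hone r hr η hη, hone s hs η hη, sub_self]
    rw [(he.iteratedFDeriv ℝ i).eq_of_nhds]
    have : iteratedFDeriv ℝ i (fun _ : Phase N => (0 : ℝ)) ξ = 0 := by
      rw [show (fun _ : Phase N => (0 : ℝ)) = 0 from rfl, iteratedFDeriv_zero]; rfl
    rw [this, norm_zero]
    have := bracket_nonneg ξ
    positivity
  · have h1 : 1 ≤ ε * bracket ξ := by
      calc 1 = ε * ε⁻¹ := (mul_inv_cancel₀ hε.ne').symm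
        _ ≤ _ := by gcongr; exact h.trans (norm_le_bracket ξ)
    have e : iteratedFDeriv ℝ i (fun ξ => cutoff r ξ - cutoff s ξ) ξ =
        iteratedFDeriv ℝ i (cutoff r) ξ - iteratedFDeriv ℝ i (cutoff s) ξ :=
      iteratedFDeriv_sub_apply
        ((contDiff_cutoff r).contDiffAt.of_le (by exact_mod_cast le_top))
        ((contDiff_cutoff s).contDiffAt.of_le (by exact_mod_cast le_top))
    rw [e, mul_assoc]
    refine (norm_sub_le _ _).trans ((add_le_add (hc i hi r (hr.trans hε1) ξ)
      (hc i hi s (hs.trans hε1) ξ)).trans ?_)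
    exact le_mul_of_one_le_right (by positivity) h1

/-- Multiplication by a smooth function, in terms of the norms of `R^m_0`. -/
lemma R0.norms_smul_le {m m' c : ℝ} {k : ℕ} {φ : Phase N → ℝ} (hφ : ContDiff ℝ ∞ φ)
    (h : ∀ i ≤ k, ∀ ξ, ‖iteratedFDeriv ℝ i φ ξ‖ ≤ c * bracket ξ ^ (m' - m)) (f : R0 N m)
    (g : R0 N m') (hg : ∀ ξ, g.toFun ξ = φ ξ • f.toFun ξ) :
    R0.norms N m' k g ≤ (k + 1) * (2 ^ k * c) * R0.norms N m k f := by
  refine R0.norms_le_of_pointwise _ _ fun j hj ξ => ?_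
  rw [funext hg, ← Finset.mul_sum]
  have hb : 0 < bracket ξ := one_pos.trans_le (one_le_bracket ξ)
  have h2 := norm_iteratedFDeriv_smul_le_of_bound hφ f.contDiff (fun i hi => h i hi ξ) hj
  have h3 : bracket ξ ^ (-m) = bracket ξ ^ (-m') * bracket ξ ^ (m' - m) := by
    rw [← Real.rpow_add hb]; ring_nf
  calc bracket ξ ^ (-m') * ‖iteratedFDeriv ℝ j (fun ξ => φ ξ • f.toFun ξ) ξ‖
      ≤ bracket ξ ^ (-m') * (2 ^ k * (c * bracket ξ ^ (m' - m)) *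
        ∑ i ∈ Finset.range (k + 1), ‖iteratedFDeriv ℝ i f.toFun ξ‖) := by
        gcongr
    _ = _ := by rw [h3]; ring

variable {m : ℝ}

/-- Truncation of a function in `R^m_0` to a ball of radius `2^{n+1}`. -/
def R0.truncate (n : ℕ) : R0 N m →ₗ[ℂ] 𝓢(Phase N, ℂ) where
  toFun f := HasCompactSupport.toSchwartzMap (f := fun ξ => cutoff ((1 / 2) ^ n) ξ • f.toFun ξ)
    ((hasCompactSupport_cutoff (by positivity)).smul_right) ((contDiff_cutoff _).smul f.contDiff)
  map_add' f g := by
    ext ξ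
    exact smul_add _ _ _
  map_smul' c f := by
    ext ξ
    exact smul_comm _ c _

lemma R0.truncate_apply (n : ℕ) (f : R0 N m) (ξ : Phase N) :
    R0.truncate n f ξ = cutoff ((1 / 2) ^ n) ξ • f.toFun ξ := rfl

lemma R0.tendsto_truncate_apply (f : R0 N m) (ξ : Phase N) :
    Tendsto (fun n => R0.truncate n f ξ) atTop (𝓝 (f.toFun ξ)) := by
  have h : Tendsto (fun n : ℕ => ‖((1 / 2 : ℝ) ^ n) • ξ‖) atTop (𝓝 0) := by
    have := ((tendsto_pow_atTop_nhds_zero_of_lt_one (r := (1 / 2 : ℝ)) (by norm_num)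
      (by norm_num)).smul_const ξ).norm
    simpa using this
  refine tendsto_const_nhds.congr' ?_
  filter_upwards [h.eventually_lt_const one_pos] with n hn
  rw [R0.truncate_apply, cutoff_eq_one hn.le, one_smul]

lemma R0.norm_truncate_apply_le (n : ℕ) (f : R0 N m) (ξ : Phase N) :
    ‖R0.truncate n f ξ‖ ≤ ‖f.toFun ξ‖ := by
  rw [R0.truncate_apply, norm_smul, Real.norm_of_nonneg (cutoff_nonneg _ _)]
  exact mul_le_of_le_one_left (norm_nonneg _) (cutoff_le_one _ _)

lemma half_pow_le_one (n : ℕ) : |(1 / 2 : ℝ) ^ n| ≤ 1 := by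
  rw [abs_of_nonneg (by positivity)]
  exact pow_le_one₀ (by norm_num) (by norm_num)

lemma R0.exists_norms_truncate_le (m : ℝ) (k : ℕ) : ∃ C : ℝ, 0 ≤ C ∧ ∀ n (f : R0 N m),
    R0.norms N m k (toR0 m (R0.truncate n f)) ≤ C * R0.norms N m k f := by
  obtain ⟨c, hc0, hc⟩ := exists_norm_iteratedFDeriv_cutoff_le (N := N) k
  refine ⟨(k + 1) * (2 ^ k * c), by positivity, fun n f =>
    R0.norms_smul_le (contDiff_cutoff ((1 / 2) ^ n)) (fun i hi ξ => ?_) _ _ fun ξ => rfl⟩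
  rw [sub_self, Real.rpow_zero, mul_one]
  exact hc i hi _ (half_pow_le_one n) ξ

lemma R0.exists_norms_truncate_succ_sub_le (m : ℝ) (k : ℕ) : ∃ C : ℝ, 0 ≤ C ∧ ∀ n (f : R0 N m),
    R0.norms N (m + 1) k (toR0 (m + 1) (R0.truncate (n + 1) f - R0.truncate n f)) ≤
      C * (1 / 2) ^ n * R0.norms N m k f := by
  obtain ⟨c, hc0, hc⟩ := exists_norm_iteratedFDeriv_cutoff_sub_le (N := N) k
  refine ⟨(k + 1) * (2 ^ k * c), by positivity, fun n f => ?_⟩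
  refine (R0.norms_smul_le (c := c * (1 / 2) ^ n)
    ((contDiff_cutoff ((1 / 2) ^ (n + 1))).sub (contDiff_cutoff ((1 / 2) ^ n)))
    (fun i hi ξ => ?_) f _ fun ξ => ?_).trans_eq (by ring)
  · rw [add_sub_cancel_left, Real.rpow_one]
    refine hc i hi _ _ _ (by positivity) ((le_abs_self _).trans (half_pow_le_one n)) ?_
      (abs_of_nonneg (by positivity)).le ξ
    rw [abs_of_nonneg (by positivity)]
    exact pow_le_pow_of_le_one (by norm_num) (by norm_num) (by omega)
  · exact (sub_smul _ _ _).symm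

/-- The function u is its own truncation with scale 0, so the estimate for a difference of two
cutoffs applies. -/
lemma exists_norms_sub_truncate_le (m : ℝ) (k : ℕ) : ∃ C : ℝ, 0 ≤ C ∧ ∀ n (u : 𝓢(Phase N, ℂ)),
    R0.norms N (m + 1) k (toR0 (m + 1) (R0.truncate n (toR0 m u) - u)) ≤
      C * (1 / 2) ^ n * R0.norms N m k (toR0 m u) := by
  obtain ⟨c, hc0, hc⟩ := exists_norm_iteratedFDeriv_cutoff_sub_le (N := N) k
  refine ⟨(k + 1) * (2 ^ k * c), by positivity, fun n u => ?_⟩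
  refine (R0.norms_smul_le (c := c * (1 / 2) ^ n)
    ((contDiff_cutoff ((1 / 2) ^ n)).sub (contDiff_cutoff 0))
    (fun i hi ξ => ?_) (toR0 m u) _ fun ξ => ?_).trans_eq (by ring)
  · rw [add_sub_cancel_left, Real.rpow_one]
    exact hc i hi _ _ _ (by positivity) ((le_abs_self _).trans (half_pow_le_one n))
      (abs_of_nonneg (by positivity)).le (by simp) ξ
  · rw [sub_smul, cutoff_zero, one_smul]
    rfl

end Cutoff

end MagneticMoyal

namespace MagneticMoyal

open Filter Topology

variable {N : ℕ} {m : ℝ}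

/-! ### R^m_0 as a space of tempered distributions. -/

section Distribution

lemma exists_bracket_rpow_mul_le (m : ℝ) : ∃ (s : Finset (ℕ × ℕ)) (C : ℝ), 0 ≤ C ∧
    ∀ (h : 𝓢(Phase N, ℂ)) (ξ : Phase N),
      bracket ξ ^ m * ‖h ξ‖ ≤ C * s.sup (schwartzSeminormFamily ℂ (Phase N) ℂ) h := by
  obtain ⟨k, hk⟩ := bracket_rpow_le (N := N) m
  refine ⟨Finset.Iic (k, 0), 2 ^ k * 2 ^ k, by positivity, fun h ξ => ?_⟩
  have h1 := SchwartzMap.one_add_le_sup_seminorm_apply (𝕜 := ℂ) (m := (k, 0)) (k := k) (n := 0)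
    le_rfl le_rfl h ξ
  rw [norm_iteratedFDeriv_zero] at h1
  calc bracket ξ ^ m * ‖h ξ‖ ≤ 2 ^ k * (1 + ‖ξ‖) ^ k * ‖h ξ‖ := by gcongr; exact hk ξ
    _ = 2 ^ k * ((1 + ‖ξ‖) ^ k * ‖h ξ‖) := by ring
    _ ≤ 2 ^ k * (2 ^ k * (Finset.Iic (k, 0)).sup (schwartzSeminormFamily ℂ (Phase N) ℂ) h) := by
      exact mul_le_mul_of_nonneg_left h1 (by positivity)
    _ = _ := by ring

lemma norm_mul_le_weight {a b C : ℝ} {z w : ℂ} {ξ : Phase N} (hb : bracket ξ ^ a * ‖w‖ ≤ C)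
    (hab : b = -a) : ‖z * w‖ ≤ C * (bracket ξ ^ b * ‖z‖) := by
  have hp : 0 < bracket ξ := one_pos.trans_le (one_le_bracket ξ)
  have h1 : bracket ξ ^ a * bracket ξ ^ b = 1 := by
    rw [← Real.rpow_add hp, hab, add_neg_cancel, Real.rpow_zero]
  rw [norm_mul]
  calc ‖z‖ * ‖w‖ = (bracket ξ ^ a * bracket ξ ^ b) * (‖z‖ * ‖w‖) := by rw [h1, one_mul]
    _ = (bracket ξ ^ a * ‖w‖) * (bracket ξ ^ b * ‖z‖) := by ring
    _ ≤ _ := mul_le_mul_of_nonneg_right hb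
      (mul_nonneg (Real.rpow_nonneg hp.le _) (norm_nonneg _))

lemma R0.integrable_weight (f : R0 N m) :
    Integrable (fun ξ => bracket ξ ^ (-m) * ‖f.toFun ξ‖) (phaseMeasure N) := by
  simpa only [norm_iteratedFDeriv_zero] using f.integrable 0

lemma R0.integrable_mul (f : R0 N m) (h : 𝓢(Phase N, ℂ)) :
    Integrable (fun ξ => f.toFun ξ * h ξ) (phaseMeasure N) := by
  obtain ⟨s, C, hC, hb⟩ := exists_bracket_rpow_mul_le (N := N) m
  exact (f.integrable_weight.const_mul _).mono'
    (f.contDiff.continuous.mul h.continuous).aestronglyMeasurable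
    (Eventually.of_forall fun ξ => norm_mul_le_weight (hb h ξ) rfl)

/-- The tempered distribution defined by a function in `R^m_0`. -/
def R0.toDistribution (f : R0 N m) : 𝓢'(Phase N, ℂ) :=
  ContinuousLinearMap.toPointwiseConvergenceCLM _ _ _ _
    (mkCLMtoNormedSpace (σ := RingHom.id ℂ) (fun h => ∫ ξ, f.toFun ξ * h ξ ∂(phaseMeasure N))
      (fun h h' => by
        rw [← integral_add (f.integrable_mul h) (f.integrable_mul h')]
        congr 1; ext ξ
        simp only [_root_.add_apply, mul_add])
      (fun c h => by
        rw [RingHom.id_apply, smul_eq_mul, ← integral_const_mul]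
        congr 1; ext ξ
        simp only [_root_.smul_apply, smul_eq_mul, mul_left_comm])
      (by
        obtain ⟨s, C, hC, hb⟩ := exists_bracket_rpow_mul_le (N := N) m
        refine ⟨s, C * ∫ ξ, bracket ξ ^ (-m) * ‖f.toFun ξ‖ ∂(phaseMeasure N),
          mul_nonneg hC (integral_nonneg fun ξ =>
            mul_nonneg (Real.rpow_nonneg (bracket_nonneg ξ) _) (norm_nonneg _)), fun h => ?_⟩
        refine (norm_integral_le_of_norm_le (f.integrable_weight.const_mul _)
          (Eventually.of_forall fun ξ => norm_mul_le_weight (hb h ξ) rfl)).trans_eq ?_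
        rw [integral_const_mul]
        ring))

lemma R0.toDistribution_apply (f : R0 N m) (h : 𝓢(Phase N, ℂ)) :
    f.toDistribution h = ∫ ξ, f.toFun ξ * h ξ ∂(phaseMeasure N) := rfl

lemma R0.represents_toDistribution (f : R0 N m) : Represents f.toDistribution f.toFun :=
  fun h => ⟨f.integrable_mul h, rfl⟩

/-- The complex conjugate of a function in `R^m_0`. -/
def R0.conj (f : R0 N m) : R0 N m :=
  (⟨fun ξ => (starRingEnd ℂ) (f.toFun ξ),
    Complex.conjLIE.toContinuousLinearEquiv.contDiff.comp f.contDiff, fun n => by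
      have h : ∀ ξ, ‖iteratedFDeriv ℝ n (fun ξ => (starRingEnd ℂ) (f.toFun ξ)) ξ‖ =
          ‖iteratedFDeriv ℝ n f.toFun ξ‖ := fun ξ =>
        Complex.conjLIE.norm_iteratedFDeriv_comp_left f.toFun ξ n
      simpa only [h] using f.integrable n⟩ : R0Submodule N m)

lemma R0.conj_toFun (f : R0 N m) (ξ : Phase N) : f.conj.toFun ξ = (starRingEnd ℂ) (f.toFun ξ) := rfl

/-- Functions with uniform polynomial bounds belong to `R^m_0` for large `m`. -/
lemma exists_toFun_eq_of_mem_CPolU {f : Phase N → ℂ} (hf : f ∈ CPolU N) :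
    ∃ (m : ℝ) (g : R0 N m), g.toFun = f := by
  obtain ⟨hs, m, hb⟩ := hf
  -- With this exponent (1 + ‖ξ‖)^(-r) is integrable, so passing from a sup bound of order m to an
  -- L^1 bound costs r powers.
  set r : ℝ := ((phaseMeasure N).integrablePower : ℝ) with hr
  have hr0 : 0 ≤ r := Nat.cast_nonneg _
  refine ⟨m + r, (⟨f, hs, fun n => ?_⟩ : R0Submodule N (m + r)), rfl⟩
  obtain ⟨C, hC⟩ := hb n
  have hC0 : 0 ≤ C := by
    have h1 := (norm_nonneg _).trans (hC 0)
    have h2 : 0 < bracket (0 : Phase N) ^ m := pow_pos (one_pos.trans_le (one_le_bracket _)) m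
    exact nonneg_of_mul_nonneg_left h1 h2
  refine ((Measure.integrable_pow_neg_integrablePower (phaseMeasure N)).const_mul
    (C * 2 ^ r)).mono' (continuous_weight _ n hs).aestronglyMeasurable
    (Eventually.of_forall fun ξ => ?_)
  rw [Real.norm_of_nonneg (weight_nonneg _ _ _ _)]
  have hp : 0 < bracket ξ := one_pos.trans_le (one_le_bracket ξ)
  have h2 : bracket ξ ^ (-(m + r)) * bracket ξ ^ m = bracket ξ ^ (-r) := by
    rw [← Real.rpow_natCast, ← Real.rpow_add hp]
    congr 1
    ring
  have h3 : bracket ξ ^ (-r) ≤ 2 ^ r * (1 + ‖ξ‖) ^ (-r) := by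
    have h4 : (1 + ‖ξ‖) / 2 ≤ bracket ξ := by
      linarith [one_le_bracket ξ, norm_le_bracket ξ]
    have h5 : 0 < 1 + ‖ξ‖ := by positivity
    calc bracket ξ ^ (-r) ≤ ((1 + ‖ξ‖) / 2) ^ (-r) :=
          Real.rpow_le_rpow_of_nonpos (by positivity) h4 (by linarith)
      _ = _ := by
        rw [Real.div_rpow h5.le zero_le_two, Real.rpow_neg zero_le_two]
        field_simp
  calc bracket ξ ^ (-(m + r)) * ‖iteratedFDeriv ℝ n f ξ‖
      ≤ bracket ξ ^ (-(m + r)) * (C * bracket ξ ^ m) :=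
        mul_le_mul_of_nonneg_left (hC ξ) (Real.rpow_nonneg hp.le _)
    _ = C * (bracket ξ ^ (-(m + r)) * bracket ξ ^ m) := by ring
    _ = C * bracket ξ ^ (-r) := by rw [h2]
    _ ≤ C * (2 ^ r * (1 + ‖ξ‖) ^ (-r)) := by gcongr
    _ = _ := by rw [hr]; ring

end Distribution

/-! ### The extended product and its identification with the weak one. -/

section Extension

variable (B : MagneticField N)

lemma exists_tendsto_moyalSchwartz_truncate (f : R0 N m) (g : 𝓢(Phase N, ℂ)) :
    ∃ v, Tendsto (fun n => moyalSchwartz B (R0.truncate n f) g) atTop (𝓝 v) := by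
  refine exists_tendsto_of_seminorm_le_geometric _ fun k l => ?_
  -- The index m + 1 is used because successive truncations of f approach each other geometrically
  -- only after giving up one power of the weight.
  obtain ⟨p, q, -, hb⟩ := seminorm_moyalSchwartz_le B (m + 1) k l
  obtain ⟨C, -, hC⟩ := R0.exists_norms_truncate_succ_sub_le (N := N) m p
  refine ⟨C * R0.norms N m p f * q g, fun n => ?_⟩
  rw [← LinearMap.sub_apply, ← map_sub]
  refine (hb _ _).trans ((mul_le_mul_of_nonneg_right (hC n f) (apply_nonneg _ _)).trans_eq ?_)
  ring

/-- The extension of the magnetic Moyal product to `R^m_0 × 𝓢`. -/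
def moyalR0 : R0 N m →ₗ[ℂ] 𝓢(Phase N, ℂ) →ₗ[ℂ] 𝓢(Phase N, ℂ) :=
  have h := fun (f : R0 N m) g => (exists_tendsto_moyalSchwartz_truncate B f g).choose_spec
  LinearMap.mk₂ ℂ (fun f g => (exists_tendsto_moyalSchwartz_truncate B f g).choose)
    (fun f f' g => tendsto_nhds_unique (h (f + f') g) (((h f g).add (h f' g)).congr fun n => by simp))
    (fun c f g => tendsto_nhds_unique (h (c • f) g) (((h f g).const_smul c).congr fun n => by simp))
    (fun f g g' => tendsto_nhds_unique (h f (g + g')) (((h f g).add (h f g')).congr fun n => by simp))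
    (fun c f g => tendsto_nhds_unique (h f (c • g)) (((h f g).const_smul c).congr fun n => by simp))

lemma tendsto_moyalR0 (f : R0 N m) (g : 𝓢(Phase N, ℂ)) :
    Tendsto (fun n => moyalSchwartz B (R0.truncate n f) g) atTop (𝓝 (moyalR0 B f g)) :=
  (exists_tendsto_moyalSchwartz_truncate B f g).choose_spec

lemma moyalR0_toR0 (u g : 𝓢(Phase N, ℂ)) : moyalR0 B (toR0 m u) g = moyalSchwartz B u g := by
  refine tendsto_nhds_unique (tendsto_moyalR0 B (toR0 m u) g)
    (((schwartz_withSeminorms ℂ (Phase N) ℂ).tendsto_nhds _ _).2 fun ⟨k, l⟩ ε hε => ?_)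
  obtain ⟨p, q, -, hb⟩ := seminorm_moyalSchwartz_le B (m + 1) k l
  obtain ⟨C, -, hC⟩ := exists_norms_sub_truncate_le (N := N) m p
  have h0 : Tendsto (fun n : ℕ => C * (1 / 2 : ℝ) ^ n * R0.norms N m p (toR0 m u) * q g) atTop
      (𝓝 0) := by
    have := (((tendsto_pow_atTop_nhds_zero_of_lt_one (r := (1 / 2 : ℝ)) (by norm_num)
      (by norm_num)).const_mul C).mul_const (R0.norms N m p (toR0 m u))).mul_const (q g)
    simpa using this
  filter_upwards [h0.eventually_lt_const hε] with n hn
  refine lt_of_le_of_lt ?_ hn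
  rw [← LinearMap.sub_apply, ← map_sub]
  exact (hb _ _).trans (mul_le_mul_of_nonneg_right (hC n u) (apply_nonneg _ _))

/-- Truncation is bounded on R^m_0 uniformly in n, so the estimate with the original index m
survives the limit. -/
lemma exists_seminorm_moyalR0_le (m : ℝ) (k l : ℕ) :
    ∃ (p : ℕ) (C : ℝ) (q : Seminorm ℂ 𝓢(Phase N, ℂ)), Continuous q ∧ ∀ (f : R0 N m) g,
      SchwartzMap.seminorm ℂ k l (moyalR0 B f g) ≤ C * R0.norms N m p f * q g := by
  obtain ⟨p, q, hq, hb⟩ := seminorm_moyalSchwartz_le B m k l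
  obtain ⟨C, -, hC⟩ := R0.exists_norms_truncate_le (N := N) m p
  refine ⟨p, C, q, hq, fun f g => ?_⟩
  have hcont : Continuous (SchwartzMap.seminorm ℂ k l : Seminorm ℂ 𝓢(Phase N, ℂ)) :=
    (schwartz_withSeminorms ℂ (Phase N) ℂ).continuous_seminorm (k, l)
  refine le_of_tendsto ((hcont.tendsto _).comp (tendsto_moyalR0 B f g))
    (Eventually.of_forall fun n => (hb _ _).trans ?_)
  exact mul_le_mul_of_nonneg_right (hC n f) (apply_nonneg _ _)

lemma continuous_moyalR0 :
    Continuous (fun z : R0 N m × 𝓢(Phase N, ℂ) => moyalR0 B z.1 z.2) := by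
  have := (R0.withSeminorms N m).topologicalAddGroup
  rw [continuous_iff_continuousAt]
  intro z
  refine ((schwartz_withSeminorms ℂ (Phase N) ℂ).tendsto_nhds _ _).2 fun ⟨k, l⟩ ε hε => ?_
  obtain ⟨p, C, q, hq, hb⟩ := exists_seminorm_moyalR0_le B m k l
  have hp : Continuous (R0.norms N m p) := (R0.withSeminorms N m).continuous_seminorm p
  have h0 : Tendsto (fun y : R0 N m × 𝓢(Phase N, ℂ) =>
      C * R0.norms N m p (y.1 - z.1) * q y.2 + C * R0.norms N m p z.1 * q (y.2 - z.2)) (𝓝 z)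
      (𝓝 0) := by
    have hc : Continuous (fun y : R0 N m × 𝓢(Phase N, ℂ) =>
        C * R0.norms N m p (y.1 - z.1) * q y.2 + C * R0.norms N m p z.1 * q (y.2 - z.2)) :=
      ((continuous_const.mul (hp.comp (continuous_fst.sub continuous_const))).mul
        (hq.comp continuous_snd)).add
        (continuous_const.mul (hq.comp (continuous_snd.sub continuous_const)))
    simpa using hc.tendsto z
  filter_upwards [h0.eventually_lt_const hε] with y hy
  refine lt_of_le_of_lt ?_ hy
  have e : moyalR0 B y.1 y.2 - moyalR0 B z.1 z.2 =
      moyalR0 B (y.1 - z.1) y.2 + moyalR0 B z.1 (y.2 - z.2) := by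
    simp only [map_sub, LinearMap.sub_apply]
    abel
  rw [e]
  exact (map_add_le_add _ _ _).trans (add_le_add (hb _ _) (hb _ _))

/-- Limit of the cyclicity identity for the truncations. The left side converges by continuity of
pairing with h on 𝓢, the right side by dominated convergence, truncation not increasing |f|. -/
lemma integral_moyalR0_mul (f : R0 N m) (g h : 𝓢(Phase N, ℂ)) :
    ∫ ξ, moyalR0 B f g ξ * h ξ ∂(phaseMeasure N) =
      ∫ ξ, f.toFun ξ * moyalSchwartz B g h ξ ∂(phaseMeasure N) := by
  have h1 : Tendsto (fun n => ∫ ξ, moyalSchwartz B (R0.truncate n f) g ξ * h ξ ∂(phaseMeasure N))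
      atTop (𝓝 (∫ ξ, moyalR0 B f g ξ * h ξ ∂(phaseMeasure N))) := by
    have hc := ((toR0 0 h).toDistribution.continuous.tendsto _).comp (tendsto_moyalR0 B f g)
    have e : ∀ u : 𝓢(Phase N, ℂ),
        (toR0 0 h).toDistribution u = ∫ ξ, u ξ * h ξ ∂(phaseMeasure N) := fun u => by
      rw [R0.toDistribution_apply]
      congr 1; ext ξ
      exact mul_comm _ _
    rw [← e (moyalR0 B f g)]
    exact Tendsto.congr (fun n => e _) hc
  refine tendsto_nhds_unique h1 ?_
  simp only [integral_moyalSchwartz_mul]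
  refine tendsto_integral_of_dominated_convergence
    (fun ξ => ‖f.toFun ξ * moyalSchwartz B g h ξ‖) (fun n => ?_) (f.integrable_mul _).norm
    (fun n => Eventually.of_forall fun ξ => ?_) (Eventually.of_forall fun ξ => ?_)
  · exact ((R0.truncate n f).continuous.mul
      (moyalSchwartz B g h).continuous).aestronglyMeasurable
  · rw [norm_mul, norm_mul]
    exact mul_le_mul_of_nonneg_right (R0.norm_truncate_apply_le n f ξ) (norm_nonneg _)
  · exact (R0.tendsto_truncate_apply f ξ).mul_const _

/-- The index 0 only serves to regard the Schwartz product as a distribution; any other would do. -/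
lemma isLeftProduct_moyalR0 (f : R0 N m) (g : 𝓢(Phase N, ℂ)) :
    IsLeftProduct B f.toDistribution g (toR0 0 (moyalR0 B f g)).toDistribution :=
  fun h => ⟨moyalSchwartz B g h, moyalSchwartz_apply B g h, integral_moyalR0_mul B f g h⟩

/-- Conjugation reverses products, so g ∘ f is the conjugate of f̄ ∘ ḡ, and R^m_0 is stable under
conjugation; the claim is the conjugate of `integral_moyalR0_mul`. -/
lemma isRightProduct_conj_moyalR0 (f : R0 N m) (g : 𝓢(Phase N, ℂ)) :
    IsRightProduct B f.toDistribution g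
      (toR0 0 (conjSchwartz (moyalR0 B f.conj (conjSchwartz g)))).toDistribution := by
  refine fun h => ⟨moyalSchwartz B h g, moyalSchwartz_apply B h g, ?_⟩
  have hcc : ∀ u : 𝓢(Phase N, ℂ), conjSchwartz (conjSchwartz u) = u := fun u => by
    ext ξ
    simp [conjSchwartz_apply]
  have h1 : ∀ ξ, moyalSchwartz B h g ξ =
      (starRingEnd ℂ) (moyalSchwartz B (conjSchwartz g) (conjSchwartz h) ξ) := fun ξ => by
    rw [← moyalSchwartz_conj, hcc, hcc]
  have h2 := congrArg (starRingEnd ℂ) (integral_moyalR0_mul B f.conj (conjSchwartz g) (conjSchwartz h))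
  rw [← integral_conj, ← integral_conj] at h2
  rw [R0.toDistribution_apply, R0.toDistribution_apply, toR0_toFun]
  simpa only [map_mul, R0.conj_toFun, conjSchwartz_apply, Complex.conj_conj, ← h1] using h2

lemma toDistribution_mem_moyalAlgebra (f : R0 N m) : f.toDistribution ∈ moyalAlgebra B :=
  ⟨fun g => ⟨_, isLeftProduct_moyalR0 B f g, _, R0.represents_toDistribution _⟩,
    fun g => ⟨_, isRightProduct_conj_moyalR0 B f g, _, R0.represents_toDistribution _⟩⟩

end Extension

end MagneticMoyal

end

/-! ### Conclusion. -/

theorem mainTheorem3 (N : ℕ) (B : MagneticMoyal.MagneticField N) :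
    (∀ f ∈ MagneticMoyal.CPolU N, ∃ F : 𝓢'(MagneticMoyal.Phase N, ℂ),
      MagneticMoyal.Represents F f ∧ F ∈ MagneticMoyal.moyalAlgebra B) ∧
    (∀ m : ℝ, ∃ T : MagneticMoyal.R0 N m →ₗ[ℂ]
        𝓢(MagneticMoyal.Phase N, ℂ) →ₗ[ℂ] 𝓢(MagneticMoyal.Phase N, ℂ),
      Continuous (fun z : MagneticMoyal.R0 N m × 𝓢(MagneticMoyal.Phase N, ℂ) => T z.1 z.2) ∧
      (∀ u : 𝓢(MagneticMoyal.Phase N, ℂ), ∃ v : MagneticMoyal.R0 N m, v.toFun = u ∧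
        ∀ (g : 𝓢(MagneticMoyal.Phase N, ℂ)) (ξ : MagneticMoyal.Phase N),
          T v g ξ = MagneticMoyal.moyal B u g ξ) ∧
      (∀ f : MagneticMoyal.R0 N m, ∃ F : 𝓢'(MagneticMoyal.Phase N, ℂ),
        MagneticMoyal.Represents F f.toFun ∧
        ∀ g : 𝓢(MagneticMoyal.Phase N, ℂ), ∃ G : 𝓢'(MagneticMoyal.Phase N, ℂ),
          MagneticMoyal.IsLeftProduct B F g G ∧ MagneticMoyal.Represents G (T f g))) := by
  refine ⟨fun f hf => ?_, fun m => ⟨MagneticMoyal.moyalR0 B, MagneticMoyal.continuous_moyalR0 B,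
    fun u => ⟨MagneticMoyal.toR0 m u, rfl, fun g ξ => ?_⟩, fun f => ⟨f.toDistribution,
    f.represents_toDistribution, fun g => ⟨_, MagneticMoyal.isLeftProduct_moyalR0 B f g,
      MagneticMoyal.R0.represents_toDistribution _⟩⟩⟩⟩
  · obtain ⟨m, g, rfl⟩ := MagneticMoyal.exists_toFun_eq_of_mem_CPolU hf
    exact ⟨g.toDistribution, g.represents_toDistribution,
      MagneticMoyal.toDistribution_mem_moyalAlgebra B g⟩
  · rw [MagneticMoyal.moyalR0_toR0, MagneticMoyal.moyalSchwartz_apply]
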